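/- Let $E=\mathbb R^m$ and let $X=(X_t)_{t\ge0}$ be a (conservative) Markov process on $E$ with càdlàg paths and laws $(\mathbb P_x)_{x\in E}$, which is Feller in the sense that $x\mapsto\mathbb E_x[g(X_t)]$ is continuous for every $t\ge 0$ and every bounded continuous $g:E\to\mathbb R$. (This holds in particular if $X$ is $C_0$-Feller, i.e. if $x\mapsto \mathbb E_x[g(X_t)]$ belongs to $C_0(E)$ for all $g\in C_0(E)$, $t\ge 0$.) Fix $\delta>0$, $\gamma<0$, a compact set $U\subseteq E$, a continuous weight $\omega:E\to[0,\infty)$, and write $\|g\|_\omega=\sup_x\frac{|g(x)|}{1+\omega(x)}$; let $C_\omega(E)$ be the space of continuous $g$ with $\|g\|_\omega<\infty$. For a random variable $Z$ put $\mu^\gamma(Z)=\frac1\gamma\ln\mathbb E[e^{\gamma Z}]\in[-\infty,\infty]$ for $\gamma\ne0$, $\mu^0(Z)=\mathbb E[Z]$; $\mu^\gamma_x$ refers to the uncontrolled process started at $x$. Assume: (A.1) $f:E\to\mathbb R$ is continuous and $\|f\|_\omega<\infty$. (A.2) $c:E\times U\to\mathbb R$ is continuous, $c\le c_0$ for some constant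 $c_0<0$, and $\hat c(x)=\inf_{\xi\in U}c(x,\xi)$ satisfies $\|\hat c\|_\omega<\infty$. (A.3) There are $b_1\in(0,1)$ and $M_1,M_2:\mathbb R\to\mathbb R$ such that for all $\theta\in\mathbb R$, $x\in E$: $\mu_x^\theta\big(\int_0^\delta\omega(X_s)\,ds\big)\le\omega(x)+M_1(\theta)$ and $\mu_x^\theta(\omega(X_\delta))\le b_1\omega(x)+M_2(\theta)$. (A.4) For every $R>0$ there are $d>0$ and a probability measure $\nu$ with $\nu(U)>0$ such that $\mathbb P_x[X_\delta\in A]\ge d\,\nu(A)$ for all Borel $A$ and all $x$ with $\omega(x)\le R$. A $\delta$-dyadic impulse strategy $V=\{(\tau_i,\xi_i)\}_{i\ge1}\in\mathbb V_\delta$ consists of Markov times $\tau_i$ with values in $\{0,\delta,2\delta,\dots\}\cup\{\infty\}$, strictly increasing as long as they are finite, and $U$-valued shifts $\xi_i$ measurable with respect to the history of the controlled process up to the impulse: at time $\tau_i$ the process is moved from its state $X_{\tau_i^-}$ before the impulse to $\xi_i$ and then follows the dynamics of $X$ until the next impulse. With $\mu^\gamma_{(x,V)}$ the entropic utility under the law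 of the controlled process started at $x$, let $$J(x,V)=\liminf_{n\to\infty}\frac{1}{n\delta}\,\mu^\gamma_{(x,V)}\Big(\int_0^{n\delta}f(X_s)\,ds+\sum_{i\ge1}\mathbf 1_{\{\tau_i\le n\delta\}}\,c(X_{\tau_i^-},\xi_i)\Big).$$ A pair $(w,\lambda)\in C_\omega(E)\times\mathbb R$ solves the Bellman equation if for all $x\in E$ $$w(x)+\lambda=\max\Big\{\mu_x^\gamma\Big(\int_0^\delta f(X_s)\,ds+w(X_\delta)\Big),\ \sup_{\xi\in U}\Big(\mu_\xi^\gamma\Big(\int_0^\delta f(X_s)\,ds+w(X_\delta)\Big)+c(x,\xi)\Big)\Big\}.$$ Then, for every solution $(w,\lambda)$ of the Bellman equation and every $x\in E$, $$\frac{\lambda}{\delta}=\sup_{V\in\mathbb V_\delta}J(x,V).$$ Moreover, if $X$ is $C_0$-Feller, then a solution $(w,\lambda)$ of the Bellman equation exists (so that, by the first part, the constant $\lambda=\lambda^\gamma_\delta$ is well defined and $\lambda^\gamma_\delta/\delta$ is the optimal value from every initial state). -/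

import Mathlib

open MeasureTheory ProbabilityTheory Filter Topology
open scoped NNReal ENNReal

namespace ImpulseControl

noncomputable section

/-! ### Càdlàg paths -/

/-- Right-continuous paths with left limits, on the time set `[0, ∞)`. -/
def IsCadlag {E : Type*} [TopologicalSpace E] (η : ℝ≥0 → E) : Prop :=
  ∀ t : ℝ≥0, ContinuousWithinAt η (Set.Ici t) t ∧ ∃ l : E, Tendsto η (𝓝[<] t) (𝓝 l)

/-- The space of càdlàg paths in `E`. -/
def Path (E : Type*) [TopologicalSpace E] : Type _ :=
  {η : ℝ≥0 → E // IsCadlag η}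

instance {E : Type*} [TopologicalSpace E] : CoeFun (Path E) (fun _ => ℝ≥0 → E) :=
  ⟨fun η => η.1⟩

/-- The path space carries the sigma-algebra generated by the coordinate maps `η ↦ η t`. -/
instance {E : Type*} [TopologicalSpace E] [MeasurableSpace E] : MeasurableSpace (Path E) :=
  MeasurableSpace.comap (fun η : Path E => (η : ℝ≥0 → E)) MeasurableSpace.pi

theorem measurable_eval {E : Type*} [TopologicalSpace E] [MeasurableSpace E] (t : ℝ≥0) :
    Measurable (fun η : Path E => η t) :=
  (measurable_pi_apply t).comp (comap_measurable (fun η : Path E => (η : ℝ≥0 → E)))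

/-- The path that stays at `x`. -/
def constPath {E : Type*} [TopologicalSpace E] (x : E) : Path E :=
  ⟨fun _ => x, fun _ => ⟨continuousWithinAt_const, x, tendsto_const_nhds⟩⟩

/-! ### The uncontrolled process -/

/-- A (conservative, càdlàg) Feller-Markov process on `E`, given by the family of the laws
`P_x = law x` on path space, under which the coordinate process `X_t(η) = η t` starts from `x`. -/
structure FellerMarkovProcess (E : Type*) [TopologicalSpace E] [MeasurableSpace E] where
  law : Kernel E (Path E)
  isMarkovKernel : IsMarkovKernel law
  start : ∀ x : E, ∀ᵐ η ∂(law x), η 0 = x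
  /-- Markov property: for `B` in the sigma-algebra generated by `X_u`, `u ≤ s`, one has
  `P_x (B ∩ {X_{s+t} ∈ A}) = E_x [1_B P_{X_s} (X_t ∈ A)]`. -/
  markov : ∀ (x : E) (s t : ℝ≥0) (A : Set E), MeasurableSet A →
    ∀ B : Set (Path E),
      MeasurableSet[⨆ u : Set.Iic s,
        MeasurableSpace.comap (fun η : Path E => η u.1) inferInstance] B →
      law x (B ∩ {η | η (s + t) ∈ A}) = ∫⁻ η in B, law (η s) {ζ | ζ t ∈ A} ∂(law x)
  /-- Feller property: the transition semigroup maps bounded continuous functions to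
  (bounded) continuous functions. -/
  feller : ∀ (t : ℝ≥0) (g : BoundedContinuousFunction E ℝ),
    Continuous (fun x : E => ∫ η, g (η t) ∂(law x))

instance {E : Type*} [TopologicalSpace E] [MeasurableSpace E] (X : FellerMarkovProcess E) :
    IsMarkovKernel X.law := X.isMarkovKernel

/-- The stronger Feller property: the transition semigroup maps the space `C₀(E)` of continuous
functions vanishing at infinity into itself. -/
def FellerMarkovProcess.IsC0Feller {E : Type*} [TopologicalSpace E] [MeasurableSpace E]
    (X : FellerMarkovProcess E) : Prop :=
  ∀ (t : ℝ≥0) (g : ZeroAtInftyContinuousMap E ℝ),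
    Continuous (fun x : E => ∫ η, g (η t) ∂(X.law x)) ∧
      Tendsto (fun x : E => ∫ η, g (η t) ∂(X.law x)) (cocompact E) (𝓝 0)

/-! ### Entropic utility -/

/-- The entropic utility `μ^γ(Z)` of `Z` under `P`, with values in `[-∞, ∞]`:
`(1/γ) ln E[exp(γ Z)]` for `γ ≠ 0`, and `E[Z] = E[Z⁺] - E[Z⁻]` for `γ = 0`. -/
def entropicUtility {Ω : Type*} [MeasurableSpace Ω] (P : Measure Ω) (γ : ℝ) (Z : Ω → ℝ) : EReal :=
  if γ = 0 then
    ((∫⁻ a, ENNReal.ofReal (Z a) ∂P : ℝ≥0∞) : EReal)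
      - ((∫⁻ a, ENNReal.ofReal (-Z a) ∂P : ℝ≥0∞) : EReal)
  else
    ((1 / γ : ℝ) : EReal) * ENNReal.log (∫⁻ a, ENNReal.ofReal (Real.exp (γ * Z a)) ∂P)

/-- `∫_0^δ f(X_s) ds` along a path. -/
def runningReward {E : Type*} [TopologicalSpace E] (δ : ℝ≥0) (f : E → ℝ) (η : Path E) : ℝ :=
  ∫ s in (0 : ℝ)..δ, f (η s.toNNReal)

/-! ### Assumptions -/

/-- Finiteness of the weighted norm `‖g‖_ω = sup_x |g x| / (1 + ω x)`. -/
def FiniteWeightNorm {E : Type*} (ω g : E → ℝ) : Prop :=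
  BddAbove (Set.range fun x => |g x| / (1 + ω x))

/-- Reward function constraints. -/
def RewardConstraints {E : Type*} [TopologicalSpace E] (ω f : E → ℝ) : Prop :=
  Continuous f ∧ FiniteWeightNorm ω f

/-- Shift cost function constraints. Only the values of `c` on `E × U` matter. -/
def CostConstraints {E : Type*} [TopologicalSpace E] (U : Set E) (ω : E → ℝ) (c : E → E → ℝ) :
    Prop :=
  ContinuousOn (fun p : E × E => c p.1 p.2) (Set.univ ×ˢ U) ∧
    (∃ c₀ : ℝ, c₀ < 0 ∧ ∀ x, ∀ ξ ∈ U, c x ξ ≤ c₀) ∧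
    FiniteWeightNorm ω (fun x => sInf ((fun ξ => c x ξ) '' U))

/-- Geometric drift with controllable noise, for the uncontrolled process. -/
def GeometricDrift {E : Type*} [TopologicalSpace E] [MeasurableSpace E]
    (X : FellerMarkovProcess E) (δ : ℝ≥0) (ω : E → ℝ) : Prop :=
  ∃ b₁ : ℝ, 0 < b₁ ∧ b₁ < 1 ∧ ∃ M₁ M₂ : ℝ → ℝ, ∀ (γ : ℝ) (x : E),
    entropicUtility (X.law x) γ (runningReward δ ω) ≤ ((ω x + M₁ γ : ℝ) : EReal) ∧
    entropicUtility (X.law x) γ (fun η => ω (η δ)) ≤ ((b₁ * ω x + M₂ γ : ℝ) : EReal)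

/-- Local minorization, for the uncontrolled process. -/
def LocalMinorization {E : Type*} [TopologicalSpace E] [MeasurableSpace E]
    (X : FellerMarkovProcess E) (δ : ℝ≥0) (U : Set E) (ω : E → ℝ) : Prop :=
  ∀ R : ℝ, 0 < R → ∃ d : ℝ, 0 < d ∧ ∃ ν : Measure E, IsProbabilityMeasure ν ∧ 0 < ν U ∧
    ∀ x : E, ω x ≤ R → ∀ A : Set E, MeasurableSet A →
      ENNReal.ofReal d * ν A ≤ X.law x {η | η δ ∈ A}

/-! ### Bellman equation -/

/-- `(w, l)` solves the Bellman equation of the `δ`-dyadic problem: `w` is continuous with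
`‖w‖_ω < ∞` and `w(x) + l` is the maximum of `μ_x^γ(∫_0^δ f(X_s) ds + w(X_δ))` and
`sup_{ξ ∈ U} (μ_ξ^γ(∫_0^δ f(X_s) ds + w(X_δ)) + c(x, ξ))`. -/
def IsBellmanSolution {E : Type*} [TopologicalSpace E] [MeasurableSpace E]
    (X : FellerMarkovProcess E) (δ : ℝ≥0) (U : Set E) (ω f : E → ℝ) (c : E → E → ℝ) (γ : ℝ)
    (w : E → ℝ) (l : ℝ) : Prop :=
  Continuous w ∧ FiniteWeightNorm ω w ∧ ∀ x : E,
    ((w x + l : ℝ) : EReal) =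
      max (entropicUtility (X.law x) γ (fun η => runningReward δ f η + w (η δ)))
        (⨆ ξ ∈ U, (entropicUtility (X.law ξ) γ (fun η => runningReward δ f η + w (η δ))
          + ((c x ξ : ℝ) : EReal)))

/-! ### Controlled process

The controlled process is realised on sequences of paths. For `n : ℕ`, the path with index `n + 1`
describes the evolution on the time interval `[n δ, (n + 1) δ]`, in local time and after the
possible impulse at time `n δ`. The path with index `0` is the constant path at the initial state.
Hence, for every `n`, the value at local time `δ` of the path with index `n` is the state at time
`n δ` before the possible impulse at that time. -/

/-- The state at time `n δ` before the possible impulse at that time. -/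
def preState {E : Type*} [TopologicalSpace E] (δ : ℝ≥0) (n : ℕ) (η : ℕ → Path E) : E :=
  η n δ

/-- The state of the controlled process at time `t` (after the possible impulse at time `t`). -/
def state {E : Type*} [TopologicalSpace E] (δ : ℝ≥0) (t : ℝ≥0) (η : ℕ → Path E) : E :=
  η (⌊t / δ⌋₊ + 1) (t - ⌊t / δ⌋₊ * δ)

/-- The information available at time `n δ`, before the possible impulse at that time: the initial
state and the evolution of the controlled process so far. -/
def history (E : Type*) [TopologicalSpace E] [MeasurableSpace E] (δ : ℝ≥0) :
    Filtration ℕ (inferInstance : MeasurableSpace (ℕ → Path E)) where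
  seq n := ⨆ k : Set.Iic n, ⨆ s : Set.Iic δ,
    MeasurableSpace.comap (fun η : ℕ → Path E => η k.1 s.1) inferInstance
  mono' := by
    intro m n hmn
    refine iSup_le fun k => ?_
    exact le_iSup (fun k : Set.Iic n => ⨆ s : Set.Iic δ,
      MeasurableSpace.comap (fun η : ℕ → Path E => η k.1 s.1) inferInstance)
      ⟨k.1, le_trans k.2 hmn⟩
  le' := by
    intro n
    refine iSup_le fun k => iSup_le fun s => ?_
    exact ((measurable_eval s.1).comp (measurable_pi_apply k.1)).comap_le

/-- A `δ`-dyadic impulse strategy `V = {(τ_i, ξ_i)}`: the `i`-th impulse happens at time `(τ i) δ`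
(never, if `τ i = ⊤`) and shifts the process to `ξ i ∈ U`. The times are Markov times for the
history of the controlled process, and strictly increase as long as they are finite; `ξ i` is
measurable with respect to the history up to the `i`-th impulse time. -/
structure DyadicStrategy {E : Type*} [TopologicalSpace E] [MeasurableSpace E] (δ : ℝ≥0)
    (U : Set E) where
  τ : ℕ → (ℕ → Path E) → WithTop ℕ
  ξ : ℕ → (ℕ → Path E) → E
  isStoppingTime : ∀ i, IsStoppingTime (history E δ) (τ i)
  strictly_increasing : ∀ i η, τ i η < τ (i + 1) η ∨ (τ i η = ⊤ ∧ τ (i + 1) η = ⊤)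
  measurable_shift : ∀ i, Measurable[(isStoppingTime i).measurableSpace] (ξ i)
  shift_mem : ∀ i η, ξ i η ∈ U

namespace DyadicStrategy

variable {E : Type*} [TopologicalSpace E] [MeasurableSpace E] {δ : ℝ≥0} {U : Set E}

open Classical in
/-- The state at time `n δ` after the possible impulse at that time. -/
def postState (V : DyadicStrategy δ U) (n : ℕ) (η : ℕ → Path E) : E :=
  if h : ∃ i, V.τ i η = n then V.ξ h.choose η else preState δ n η

theorem τ_strict (V : DyadicStrategy δ U) (η : ℕ → Path E) {i j : ℕ} (hij : i < j)
    (hi : V.τ i η ≠ ⊤) : V.τ i η < V.τ j η := by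
  induction j, hij using Nat.le_induction with
  | base =>
    rcases V.strictly_increasing i η with h | h
    · exact h
    · exact absurd h.1 hi
  | succ j _ ih =>
    rcases V.strictly_increasing j η with h | h
    · exact ih.trans h
    · rw [h.2]; exact lt_top_iff_ne_top.2 hi

theorem τ_unique (V : DyadicStrategy δ U) (η : ℕ → Path E) {i j n : ℕ}
    (hi : V.τ i η = n) (hj : V.τ j η = n) : i = j := by
  rcases lt_trichotomy i j with h | h | h
  · exact absurd (V.τ_strict η h (by simp [hi])) (by simp [hi, hj])
  · exact h
  · exact absurd (V.τ_strict η h (by simp [hj])) (by simp [hi, hj])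

theorem postState_of_eq (V : DyadicStrategy δ U) (η : ℕ → Path E) {i n : ℕ}
    (hi : V.τ i η = n) : V.postState n η = V.ξ i η := by
  have h : ∃ i, V.τ i η = n := ⟨i, hi⟩
  rw [postState, dif_pos h, V.τ_unique η h.choose_spec hi]

theorem measurable_postState (V : DyadicStrategy δ U) (n : ℕ) : Measurable (V.postState n) := by
  have hτ : ∀ i, MeasurableSet {η | V.τ i η = n} := fun i =>
    (V.isStoppingTime i).measurableSpace_le _ ((V.isStoppingTime i).measurableSet_eq' n)
  have hξ : ∀ i, Measurable (V.ξ i) := fun i =>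
    (V.measurable_shift i).mono (V.isStoppingTime i).measurableSpace_le le_rfl
  have hpre : Measurable (preState (E := E) δ n) :=
    (measurable_eval δ).comp (measurable_pi_apply n)
  intro A hA
  have : V.postState n ⁻¹' A =
      (⋃ i, {η | V.τ i η = n} ∩ V.ξ i ⁻¹' A) ∪
        ((⋃ i, {η | V.τ i η = n})ᶜ ∩ preState δ n ⁻¹' A) := by
    ext η
    by_cases h : ∃ i, V.τ i η = n
    · obtain ⟨i, hi⟩ := h
      simp only [Set.mem_preimage, V.postState_of_eq η hi, Set.mem_union, Set.mem_iUnion,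
        Set.mem_inter_iff, Set.mem_ofPred_eq, Set.mem_compl_iff]
      constructor
      · exact fun hA => Or.inl ⟨i, hi, hA⟩
      · rintro (⟨j, hj, hjA⟩ | ⟨h, -⟩)
        · rwa [V.τ_unique η hi hj]
        · exact absurd ⟨i, hi⟩ h
    · simp only [Set.mem_preimage, postState, dif_neg h, Set.mem_union, Set.mem_iUnion,
        Set.mem_inter_iff, Set.mem_ofPred_eq, Set.mem_compl_iff]
      constructor
      · exact fun hA => Or.inr ⟨h, hA⟩
      · rintro (⟨j, hj, -⟩ | ⟨-, hA⟩)
        · exact absurd ⟨j, hj⟩ h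
        · exact hA
  rw [this]
  exact (MeasurableSet.iUnion fun i => (hτ i).inter (hξ i hA)).union
    ((MeasurableSet.iUnion hτ).compl.inter (hpre hA))

end DyadicStrategy

/-- Extend finitely many paths to a sequence. The continuation is irrelevant below, since
`postState n` only depends on the paths with index at most `n`. -/
def extend {E : Type*} [TopologicalSpace E] (n : ℕ) (h : (i : Finset.Iic n) → Path E) :
    ℕ → Path E :=
  fun k => if hk : k ∈ Finset.Iic n then h ⟨k, hk⟩ else h ⟨n, Finset.mem_Iic.2 le_rfl⟩

theorem measurable_extend {E : Type*} [TopologicalSpace E] [MeasurableSpace E] (n : ℕ) :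
    Measurable (extend (E := E) n) := by
  refine measurable_pi_lambda _ fun k => ?_
  unfold extend
  split_ifs with hk
  · exact measurable_pi_apply _
  · exact measurable_pi_apply _

/-- Given the past, the evolution on `[n δ, (n + 1) δ]` is that of the uncontrolled process started
from the state at time `n δ` after the possible impulse. -/
def transition {E : Type*} [TopologicalSpace E] [MeasurableSpace E] (X : FellerMarkovProcess E)
    {δ : ℝ≥0} {U : Set E} (V : DyadicStrategy δ U) (n : ℕ) :
    Kernel ((i : Finset.Iic n) → Path E) (Path E) :=
  X.law.comap (fun h => V.postState n (extend n h))
    ((V.measurable_postState n).comp (measurable_extend n))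

instance {E : Type*} [TopologicalSpace E] [MeasurableSpace E] (X : FellerMarkovProcess E)
    {δ : ℝ≥0} {U : Set E} (V : DyadicStrategy δ U) (n : ℕ) : IsMarkovKernel (transition X V n) := by
  unfold transition; infer_instance

/-- The law `P_{(x, V)}` of the controlled process started from `x` under the strategy `V`. -/
def controlledLaw {E : Type*} [TopologicalSpace E] [MeasurableSpace E] (X : FellerMarkovProcess E)
    {δ : ℝ≥0} {U : Set E} (x : E) (V : DyadicStrategy δ U) : Measure (ℕ → Path E) :=
  Kernel.traj (X := fun _ => Path E) (transition X V) 0 (fun _ => constPath x)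

/-- `∫_0^T f(X_s) ds + ∑_i 1_{τ_i ≤ T} c(X_{τ_i-}, ξ_i)` for `T = n δ`. -/
def totalReward {E : Type*} [TopologicalSpace E] [MeasurableSpace E]
    {δ : ℝ≥0} {U : Set E} (f : E → ℝ) (c : E → E → ℝ) (V : DyadicStrategy δ U) (n : ℕ)
    (η : ℕ → Path E) : ℝ :=
  (∫ s in (0 : ℝ)..(n * δ : ℝ), f (state δ s.toNNReal η)) +
    ∑' i, if V.τ i η ≤ n then c (preState δ ((V.τ i η).untopD 0) η) (V.ξ i η) else 0

/-- The long-run risk-sensitive criterion `J(x, V) = liminf_n J_{n δ}(x, V) / (n δ)`, where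
`J_T(x, V)` is the entropic utility of the total reward up to time `T`. -/
def longRunValue {E : Type*} [TopologicalSpace E] [MeasurableSpace E] (X : FellerMarkovProcess E)
    {δ : ℝ≥0} {U : Set E} (f : E → ℝ) (c : E → E → ℝ) (γ : ℝ) (x : E) (V : DyadicStrategy δ U) :
    EReal :=
  liminf (fun n : ℕ =>
    entropicUtility (controlledLaw X x V) γ (totalReward f c V n) / ((n * δ : ℝ) : EReal)) atTop

end

end ImpulseControl

open ImpulseControl

/-!
Write `Φ g (x) = μ_x^γ(∫₀^δ f(X_s) ds + g(X_δ))` for the one-period entropic utility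
(`entropicStep`). The Bellman equation says that `w + λ` is the maximum of `Φ w` and of
`Φ w ξ + c(·, ξ)` over `ξ ∈ U`. The variational description of `Φ` bounds `Φ g - Φ h` from above
and from below by expectations of `g - h` under path laws tilted by the exponential of the payoff
(`entropicStep_sub_le`, `le_entropicStep_sub`). The drift assumption, which controls all
exponential moments of the weight `ω`, survives such tilts: the expectation of `ω(X_δ)` under them
is at most `r ω(x) + N` with `r < 1` (`exists_tilted_drift`). The entropy cost of the tilt is
divided by a risk parameter that may be taken as large as needed.

*Verification.* By the Markov structure of the controlled process, a function that dominates its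
own one-period utility under all actions dominates the utility of the reward accumulated over `n`
periods (`supersolution_le_lintegral`, `lintegral_le_subsolution`). The terminal value `w(X_{nδ})`
is unbounded, so `w` is corrected by multiples of `ω` that decrease geometrically, thanks to the
drift; the total correction stays bounded in `n` and disappears after division by `n δ`. This
gives `λ / δ` as an upper bound for every strategy. Conversely, for every `ε > 0` there is a
measurable choice of `ε`-optimal shifts, since the states for which a given shift is good enough
form an open set; the resulting feedback strategy reaches `(λ - ε) / δ` (`iSup_longRunValue_eq`).

*Existence.* The operator `S g = max(Φ g, sup_ξ (Φ g ξ + c(·, ξ)))` contracts the span seminorm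
with weight `1 + β ω` for a small `β > 0` (`exists_span_contraction`). This is the argument of
Hairer and Mattingly for Harris' theorem. Where the total weight is large, the drift contracts.
Where it is small, the local minorization makes any two tilted laws overlap, because tilting
changes probabilities in a controlled way on sets of bounded exponential moments
(`sq_measureReal_le_tilted`). The contraction factor depends on the growth of the functions, so an
invariant class of functions is needed. Normalise by `T g = S g - sup_U Φ g`. Then `T g ≤ 0` on
`U`, the costs give a lower bound, and the upper bound comes from the drift for large weights; for
small weights it comes from the event `X_δ ∈ U`, which has probability bounded below and on which
the terminal value is nonpositive (`exists_admissible_normalizedStep`). The iterates of `T` converge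
modulo constants (`exists_fixed_point_mod_const`), and the limit solves the Bellman equation.

*Continuity.* The remaining point is that `Φ` preserves continuity. For bounded `f` and `g` this
follows from the Feller property: powers of the running reward are time integrals of
finite-dimensional moments, and polynomials approximate the exponential function. For unbounded
coefficients one needs that the paths started near a point stay in a common compact set with high
probability (`eventually_law_leavesRegion_le`). Under the `C₀`-Feller property the resolvent `u` of
a positive function in `C₀` is again positive and in `C₀`, and `e^{-t} u(X_t)` is a supermartingale:
a path that has visited the region where `u` is tiny cannot easily return to the region where `u` is
large, in which `X_δ` lies with high probability.
-/

namespace ImpulseControl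

noncomputable section

/-! ### Paths and their additive functionals -/

section Paths

variable {E : Type*} [TopologicalSpace E]

theorem IsCadlag.comp_continuous {η : ℝ≥0 → E} (hη : IsCadlag η) {f : E → ℝ} (hf : Continuous f) :
    IsCadlag (fun s => f (η s)) := by
  intro t
  obtain ⟨h1, l, hl⟩ := hη t
  exact ⟨hf.continuousAt.comp_continuousWithinAt h1, f l, (hf.tendsto l).comp hl⟩

/-- Càdlàg functions are bounded on bounded time intervals. -/
theorem IsCadlag.exists_bound {η : ℝ≥0 → ℝ} (hη : IsCadlag η) (T : ℝ≥0) :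
    ∃ C, ∀ s ≤ T, |η s| ≤ C := by
  have key : ∃ C, ∀ s ∈ Set.Icc 0 T, |η s| ≤ C := by
    refine (isCompact_Icc (a := (0 : ℝ≥0)) (b := T)).induction_on
      (p := fun S => ∃ C, ∀ s ∈ S, |η s| ≤ C) ⟨0, by simp⟩ ?_ ?_ ?_
    · rintro s t hst ⟨C, hC⟩
      exact ⟨C, fun x hx => hC x (hst hx)⟩
    · rintro s t ⟨C, hC⟩ ⟨D, hD⟩
      refine ⟨max C D, fun x hx => ?_⟩
      rcases hx with hx | hx
      · exact (hC x hx).trans (le_max_left _ _)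
      · exact (hD x hx).trans (le_max_right _ _)
    · intro t _
      obtain ⟨h1, l, hl⟩ := hη t
      have e1 : ∀ᶠ s in 𝓝[≥] t, |η s| ≤ |η t| + 1 := by
        have := (h1.abs).eventually (Iio_mem_nhds (lt_add_one (|η t|)))
        filter_upwards [this] with s hs using le_of_lt hs
      have e2 : ∀ᶠ s in 𝓝[<] t, |η s| ≤ |l| + 1 := by
        have := (hl.abs).eventually (Iio_mem_nhds (lt_add_one (|l|)))
        filter_upwards [this] with s hs using le_of_lt hs
      have e : ∀ᶠ s in 𝓝 t, |η s| ≤ max (|η t| + 1) (|l| + 1) := by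
        rw [← nhdsLT_sup_nhdsGE, eventually_sup]
        exact ⟨e2.mono fun s hs => hs.trans (le_max_right _ _),
          e1.mono fun s hs => hs.trans (le_max_left _ _)⟩
      exact ⟨_, mem_nhdsWithin_of_mem_nhds e, _, fun s hs => hs⟩
  obtain ⟨C, hC⟩ := key
  exact ⟨C, fun s hs => hC s ⟨zero_le, hs⟩⟩

/-- The right end point of the interval `[k / (n + 1), (k + 1) / (n + 1))` that
contains `t`. -/
def gridAbove (n : ℕ) (t : ℝ≥0) : ℝ≥0 := (⌊t * (n + 1)⌋₊ + 1) / (n + 1)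

theorem le_gridAbove (n : ℕ) (t : ℝ≥0) : t ≤ gridAbove n t := by
  rw [gridAbove, le_div_iff₀ (by positivity)]
  exact (Nat.lt_floor_add_one _).le

theorem tendsto_gridAbove (t : ℝ≥0) : Tendsto (fun n => gridAbove n t) atTop (𝓝[≥] t) := by
  refine tendsto_nhdsWithin_iff.2 ⟨?_, Eventually.of_forall fun n => le_gridAbove n t⟩
  have h : Tendsto (fun n : ℕ => t + 1 / ((n : ℝ≥0) + 1)) atTop (𝓝 (t + 0)) :=
    tendsto_const_nhds.add tendsto_one_div_add_atTop_nhds_zero_nat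
  rw [add_zero] at h
  refine tendsto_of_tendsto_of_tendsto_of_le_of_le tendsto_const_nhds h
    (fun n => le_gridAbove n t) fun n => ?_
  have hn : (0 : ℝ≥0) < (n : ℝ≥0) + 1 := by positivity
  change (_ : ℝ≥0) / _ ≤ _
  rw [div_le_iff₀ hn, add_mul, one_div, inv_mul_cancel₀ hn.ne']
  exact add_le_add_left (Nat.floor_le (zero_le)) 1

variable [MeasurableSpace E]

/-- The coordinate process is jointly measurable, by right continuity of the paths. -/
theorem measurable_comp_eval_uncurry [OpensMeasurableSpace E] {f : E → ℝ} (hf : Continuous f) :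
    Measurable (fun p : ℝ≥0 × Path E => f (p.2 p.1)) := by
  refine measurable_of_tendsto_metrizable
    (f := fun n (p : ℝ≥0 × Path E) => f (p.2 (gridAbove n p.1))) (fun n => ?_) ?_
  · have : Measurable (fun q : ℕ × Path E => f (q.2 ((q.1 + 1 : ℝ≥0) / (n + 1)))) :=
      measurable_from_prod_countable_right fun k =>
        hf.measurable.comp (measurable_eval ((k + 1 : ℝ≥0) / (n + 1)))
    exact this.comp (f := fun p : ℝ≥0 × Path E => (⌊p.1 * (n + 1)⌋₊, p.2))
      (by fun_prop)
  · rw [tendsto_pi_nhds]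
    rintro ⟨t, η⟩
    exact ((η.2.comp_continuous hf t).1.tendsto).comp (tendsto_gridAbove t)

theorem measurable_comp_eval_toNNReal [OpensMeasurableSpace E] {f : E → ℝ} (hf : Continuous f) :
    Measurable (fun p : ℝ × Path E => f (p.2 p.1.toNNReal)) :=
  (measurable_comp_eval_uncurry hf).comp
    (f := fun p : ℝ × Path E => (p.1.toNNReal, p.2)) (by fun_prop)

theorem measurable_path_comp [OpensMeasurableSpace E] {f : E → ℝ} (hf : Continuous f)
    (η : Path E) : Measurable (fun s : ℝ => f (η s.toNNReal)) :=
  (measurable_comp_eval_toNNReal hf).comp (f := fun s : ℝ => (s, η)) (by fun_prop)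

theorem intervalIntegrable_path_comp [OpensMeasurableSpace E] {f : E → ℝ} (hf : Continuous f)
    (η : Path E) (a b : ℝ) : IntervalIntegrable (fun s => f (η s.toNNReal)) volume a b := by
  obtain ⟨C, hC⟩ := (η.2.comp_continuous hf).exists_bound (max a b).toNNReal
  rw [intervalIntegrable_iff]
  refine Integrable.mono' (g := fun _ => C) intervalIntegrable_const.def'
    (measurable_path_comp hf η).aestronglyMeasurable ?_
  refine (ae_restrict_mem measurableSet_uIoc).mono fun s hs => ?_
  exact hC _ (Real.toNNReal_le_toNNReal hs.2)

theorem measurable_runningReward [OpensMeasurableSpace E] (δ : ℝ≥0) {f : E → ℝ}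
    (hf : Continuous f) : Measurable (runningReward δ f : Path E → ℝ) := by
  have h : (runningReward δ f : Path E → ℝ) =
      fun η => ∫ s in Set.Ioc (0 : ℝ) δ, f (η s.toNNReal) := by
    funext η
    exact intervalIntegral.integral_of_le δ.2
  rw [h]
  exact (((measurable_comp_eval_toNNReal hf).comp measurable_swap).stronglyMeasurable
    |>.integral_prod_right (f := fun (η : Path E) (s : ℝ) => f (η s.toNNReal))
      (ν := volume.restrict (Set.Ioc (0 : ℝ) δ))).measurable

theorem runningReward_mono [OpensMeasurableSpace E] (δ : ℝ≥0) {f g : E → ℝ}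
    (hf : Continuous f) (hg : Continuous g) (h : ∀ x, f x ≤ g x) (η : Path E) :
    runningReward δ f η ≤ runningReward δ g η :=
  intervalIntegral.integral_mono_on δ.2 (intervalIntegrable_path_comp hf η _ _)
    (intervalIntegrable_path_comp hg η _ _) fun _ _ => h _

theorem runningReward_affine [OpensMeasurableSpace E] (δ : ℝ≥0) {f : E → ℝ}
    (hf : Continuous f) (a b : ℝ) (η : Path E) :
    runningReward δ (fun x => a * (b + f x)) η = a * (b * δ + runningReward δ f η) := by
  unfold runningReward
  rw [intervalIntegral.integral_const_mul, intervalIntegral.integral_add (by simp)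
    (intervalIntegrable_path_comp hf η _ _)]
  simp [mul_comm]

omit [MeasurableSpace E] in
theorem runningReward_nonneg (δ : ℝ≥0) {f : E → ℝ} (h : ∀ x, 0 ≤ f x) (η : Path E) :
    0 ≤ runningReward δ f η :=
  intervalIntegral.integral_nonneg δ.2 fun _ _ => h _

theorem abs_runningReward_le [OpensMeasurableSpace E] (δ : ℝ≥0) {f ω : E → ℝ} {K : ℝ}
    (hf : Continuous f) (hω : Continuous ω) (h : ∀ x, |f x| ≤ K * (1 + ω x)) (η : Path E) :
    |runningReward δ f η| ≤ K * (δ + runningReward δ ω η) := by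
  have hc (a : ℝ) : Continuous fun x => a * (1 + ω x) := by fun_prop
  rw [abs_le]
  constructor
  · have := runningReward_mono δ (hc (-K)) hf (fun x => by linarith [(abs_le.1 (h x)).1]) η
    rw [runningReward_affine δ hω] at this
    linarith
  · have := runningReward_mono δ hf (hc K) (fun x => (abs_le.1 (h x)).2) η
    rw [runningReward_affine δ hω] at this
    linarith

end Paths

/-! ### Exponential moments and exponential tilting -/

section Tilting

variable {Ω : Type*} [MeasurableSpace Ω] {P : Measure Ω}

/-- Cauchy–Schwarz for exponentials. -/
theorem integral_exp_add_le {a b : Ω → ℝ} {α β : ℝ}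
    (ha : Integrable (fun η => Real.exp (2 * a η)) P)
    (hb : Integrable (fun η => Real.exp (2 * b η)) P) (hma : Measurable a) (hmb : Measurable b)
    (hα : ∫ η, Real.exp (2 * a η) ∂P ≤ Real.exp α)
    (hβ : ∫ η, Real.exp (2 * b η) ∂P ≤ Real.exp β) :
    Integrable (fun η => Real.exp (a η + b η)) P ∧
      ∫ η, Real.exp (a η + b η) ∂P ≤ Real.exp ((α + β) / 2) := by
  -- the arithmetic-geometric mean inequality after normalising both factors
  have key : ∀ η, Real.exp (a η + b η) ≤ Real.exp ((α + β) / 2) / 2 *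
      (Real.exp (-α) * Real.exp (2 * a η) + Real.exp (-β) * Real.exp (2 * b η)) := by
    intro η
    have h := two_mul_le_add_sq (Real.exp (a η - α / 2)) (Real.exp (b η - β / 2))
    rw [mul_assoc, ← Real.exp_add, ← Real.exp_nat_mul, ← Real.exp_nat_mul] at h
    rw [← Real.exp_add, ← Real.exp_add]
    have e : Real.exp (a η + b η) =
        Real.exp ((α + β) / 2) * Real.exp (a η - α / 2 + (b η - β / 2)) := by
      rw [← Real.exp_add]; congr 1; ring
    rw [e]
    have e1 : ((2 : ℕ) : ℝ) * (a η - α / 2) = -α + 2 * a η := by push_cast; ring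
    have e2 : ((2 : ℕ) : ℝ) * (b η - β / 2) = -β + 2 * b η := by push_cast; ring
    rw [e1, e2] at h
    nlinarith [Real.exp_pos ((α + β) / 2)]
  have hi : Integrable (fun η => Real.exp ((α + β) / 2) / 2 *
      (Real.exp (-α) * Real.exp (2 * a η) + Real.exp (-β) * Real.exp (2 * b η))) P :=
    ((ha.const_mul _).add (hb.const_mul _)).const_mul _
  have hI : Integrable (fun η => Real.exp (a η + b η)) P := by
    refine hi.mono' (by fun_prop) (Eventually.of_forall fun η => ?_)
    rw [Real.norm_eq_abs, abs_of_pos (Real.exp_pos _)]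
    exact key η
  refine ⟨hI, (integral_mono hI hi key).trans ?_⟩
  rw [integral_const_mul, integral_add (ha.const_mul _) (hb.const_mul _), integral_const_mul,
    integral_const_mul]
  have h1 : Real.exp (-α) * ∫ η, Real.exp (2 * a η) ∂P ≤ 1 := by
    calc _ ≤ Real.exp (-α) * Real.exp α := by gcongr
      _ = 1 := by rw [← Real.exp_add]; simp
  have h2 : Real.exp (-β) * ∫ η, Real.exp (2 * b η) ∂P ≤ 1 := by
    calc _ ≤ Real.exp (-β) * Real.exp β := by gcongr
      _ = 1 := by rw [← Real.exp_add]; simp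
  nlinarith [Real.exp_pos ((α + β) / 2)]

/-- Jensen's inequality for the exponential function. -/
theorem integral_le_log_integral_exp [IsProbabilityMeasure P] {v : Ω → ℝ} (hv : Integrable v P)
    (he : Integrable (fun η => Real.exp (v η)) P) :
    ∫ η, v η ∂P ≤ Real.log (∫ η, Real.exp (v η) ∂P) := by
  rw [Real.le_log_iff_exp_le (integral_exp_pos he)]
  exact convexOn_exp.map_integral_le Real.continuous_exp.continuousOn isClosed_univ
    (Eventually.of_forall fun _ => Set.mem_univ _) hv he

/-- Random variables that grow at most linearly in a function `G ≥ 1` with exponential moments. -/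
theorem integrable_exp_mul_of_le {G : Ω → ℝ} (hG : ∀ p : ℝ, Integrable (fun η => Real.exp (p * G η)) P)
    {Z u : Ω → ℝ} (hZ : Measurable Z) (hu : Measurable u) {A B : ℝ}
    (hZG : ∀ η, |Z η| ≤ A * G η) (huG : ∀ η, |u η| ≤ B * G η) :
    Integrable (fun η => Real.exp (Z η) * u η) P := by
  refine (hG (A + B)).mono' (by fun_prop) (Eventually.of_forall fun η => ?_)
  rw [norm_mul, Real.norm_eq_abs, Real.norm_eq_abs, abs_of_pos (Real.exp_pos _), add_mul,
    Real.exp_add]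
  have h1 : Real.exp (Z η) ≤ Real.exp (A * G η) :=
    Real.exp_le_exp.2 ((le_abs_self _).trans (hZG η))
  have h2 : |u η| ≤ Real.exp (B * G η) := by
    linarith [huG η, Real.add_one_le_exp (B * G η)]
  gcongr

theorem integrable_exp_of_le {G : Ω → ℝ} (hG : ∀ p : ℝ, Integrable (fun η => Real.exp (p * G η)) P)
    {Z : Ω → ℝ} (hZ : Measurable Z) {A : ℝ} (hZG : ∀ η, |Z η| ≤ A * G η) :
    Integrable (fun η => Real.exp (Z η)) P := by
  refine (hG A).mono' (by fun_prop) (Eventually.of_forall fun η => ?_)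
  rw [Real.norm_eq_abs, abs_of_pos (Real.exp_pos _)]
  exact Real.exp_le_exp.2 ((le_abs_self _).trans (hZG η))

theorem integrable_tilted_of_le {G : Ω → ℝ}
    (hG : ∀ p : ℝ, Integrable (fun η => Real.exp (p * G η)) P)
    {Z u : Ω → ℝ} (hZ : Measurable Z) (hu : Measurable u) {A B : ℝ}
    (hZG : ∀ η, |Z η| ≤ A * G η) (huG : ∀ η, |u η| ≤ B * G η) :
    Integrable u (P.tilted Z) :=
  (integrable_tilted_iff (integrable_exp_of_le hG hZ hZG) u).2
    (integrable_exp_mul_of_le hG hZ hu hZG huG)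

/-- A set of positive mass keeps a positive mass under tilting, with a bound that depends only on
the exponential moments of `Z` and `-Z`. -/
theorem sq_measureReal_le_tilted [IsProbabilityMeasure P] {Z : Ω → ℝ} {C : ℝ}
    (h1 : Integrable (fun η => Real.exp (Z η)) P) (h2 : Integrable (fun η => Real.exp (-Z η)) P)
    (hC1 : ∫ η, Real.exp (Z η) ∂P ≤ C) (hC2 : ∫ η, Real.exp (-Z η) ∂P ≤ C)
    (B : Set Ω) :
    P.real B ^ 2 / C ≤ ∫ η in B, Real.exp (Z η) ∂P ∧
      (P.real B / C) ^ 2 ≤ (P.tilted Z).real B := by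
  have hpos : 0 < ∫ η, Real.exp (Z η) ∂P := integral_exp_pos h1
  have hC : 0 < C := hpos.trans_le hC1
  have hstep : P.real B ^ 2 / C ≤ ∫ η in B, Real.exp (Z η) ∂P := by
    set s := P.real B / C with hs
    -- `exp Z ≥ 2 s - s² exp (-Z)` for every real `s`
    have hpt : ∀ η, 2 * s - s ^ 2 * Real.exp (-Z η) ≤ Real.exp (Z η) := by
      intro η
      have h := mul_nonneg (Real.exp_pos (-Z η)).le (sq_nonneg (Real.exp (Z η) - s))
      have h' : Real.exp (-Z η) * Real.exp (Z η) = 1 := by rw [← Real.exp_add]; simp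
      have : Real.exp (-Z η) * (Real.exp (Z η) - s) ^ 2 =
        (Real.exp (-Z η) * Real.exp (Z η)) * Real.exp (Z η)
          - 2 * s * (Real.exp (-Z η) * Real.exp (Z η)) + s ^ 2 * Real.exp (-Z η) := by ring
      rw [this, h'] at h
      linarith
    have hi : IntegrableOn (fun η => 2 * s - s ^ 2 * Real.exp (-Z η)) B P :=
      ((integrable_const _).sub (h2.const_mul _)).integrableOn
    have hle := setIntegral_mono hi h1.integrableOn hpt
    rw [integral_sub (integrable_const _).integrableOn (h2.const_mul _).integrableOn,
      setIntegral_const, smul_eq_mul, integral_const_mul (s ^ 2)] at hle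
    have h3 : ∫ η in B, Real.exp (-Z η) ∂P ≤ C :=
      (setIntegral_le_integral h2 (Eventually.of_forall fun _ => (Real.exp_pos _).le)).trans hC2
    have h4 : s ^ 2 * ∫ η in B, Real.exp (-Z η) ∂P ≤ s ^ 2 * C := by gcongr
    have h5 : P.real B * (2 * s) - s ^ 2 * C = P.real B ^ 2 / C := by
      rw [hs]; field_simp; ring
    linarith
  refine ⟨hstep, ?_⟩
  have heq : (P.tilted Z).real B = (∫ η in B, Real.exp (Z η) ∂P) / ∫ η, Real.exp (Z η) ∂P := by
    rw [measureReal_def, tilted_apply_eq_ofReal_integral _ _, ENNReal.toReal_ofReal,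
      integral_div]
    positivity
  rw [heq, le_div_iff₀ hpos, div_pow]
  calc P.real B ^ 2 / C ^ 2 * ∫ η, Real.exp (Z η) ∂P ≤ P.real B ^ 2 / C ^ 2 * C := by gcongr
    _ = P.real B ^ 2 / C := by field_simp
    _ ≤ _ := hstep

end Tilting

/-! ### The exponential Lyapunov condition -/

section Lyapunov

variable {E : Type*} [TopologicalSpace E] [MeasurableSpace E]

/-- The geometric drift assumption in exponential form: `b` is the contraction rate of the weight
`ω` and `M θ` bounds the noise at risk parameter `θ`. Only positive risk parameters are kept. -/
structure ExpLyapunov (X : FellerMarkovProcess E) (δ : ℝ≥0) (ω : E → ℝ) (b : ℝ) (M : ℝ → ℝ) :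
    Prop where
  continuous : Continuous ω
  nonneg : ∀ x, 0 ≤ ω x
  rate_pos : 0 < b
  rate_lt_one : b < 1
  noise_nonneg : ∀ θ, 0 ≤ M θ
  integrable_run : ∀ θ > 0, ∀ x,
    Integrable (fun η => Real.exp (θ * runningReward δ ω η)) (X.law x)
  run_le : ∀ θ > 0, ∀ x,
    ∫ η, Real.exp (θ * runningReward δ ω η) ∂(X.law x) ≤ Real.exp (θ * (ω x + M θ))
  integrable_end : ∀ θ > 0, ∀ x, Integrable (fun η => Real.exp (θ * ω (η δ))) (X.law x)
  end_le : ∀ θ > 0, ∀ x,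
    ∫ η, Real.exp (θ * ω (η δ)) ∂(X.law x) ≤ Real.exp (θ * (b * ω x + M θ))

/-- For positive risk parameters, an upper bound on the entropic utility carries the integrability of
the exponential with it, because the utility is `⊤` otherwise. -/
theorem entropicUtility_le_of_pos {Ω : Type*} [MeasurableSpace Ω] {P : Measure Ω} {θ a : ℝ}
    (hθ : 0 < θ) {Z : Ω → ℝ} (hZ : Measurable Z) (h : entropicUtility P θ Z ≤ (a : EReal)) :
    Integrable (fun η => Real.exp (θ * Z η)) P ∧
      ∫ η, Real.exp (θ * Z η) ∂P ≤ Real.exp (θ * a) := by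
  rw [entropicUtility, if_neg hθ.ne'] at h
  have h1 : ENNReal.log (∫⁻ η, ENNReal.ofReal (Real.exp (θ * Z η)) ∂P) ≤ ((θ * a : ℝ) : EReal) := by
    have h2 : ((θ : ℝ) : EReal) * (((1 / θ : ℝ) : EReal) *
        ENNReal.log (∫⁻ η, ENNReal.ofReal (Real.exp (θ * Z η)) ∂P)) ≤ (θ : EReal) * (a : EReal) :=
      mul_le_mul_of_nonneg_left h (by exact_mod_cast hθ.le)
    rwa [← mul_assoc, ← EReal.coe_mul, mul_one_div_cancel hθ.ne', EReal.coe_one, one_mul,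
      ← EReal.coe_mul] at h2
  have h3 : ∫⁻ η, ENNReal.ofReal (Real.exp (θ * Z η)) ∂P ≤ ENNReal.ofReal (Real.exp (θ * a)) := by
    have := EReal.exp_monotone h1
    rwa [ENNReal.exp_log, EReal.exp_coe] at this
  have hi : Integrable (fun η => Real.exp (θ * Z η)) P := by
    refine ⟨by fun_prop, ?_⟩
    rw [hasFiniteIntegral_iff_ofReal (Eventually.of_forall fun _ => (Real.exp_pos _).le)]
    exact h3.trans_lt ENNReal.ofReal_lt_top
  refine ⟨hi, ?_⟩
  rwa [← ofReal_integral_eq_lintegral_ofReal hi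
    (Eventually.of_forall fun _ => (Real.exp_pos _).le),
    ENNReal.ofReal_le_ofReal_iff (Real.exp_pos _).le] at h3

variable [OpensMeasurableSpace E]

theorem GeometricDrift.expLyapunov {X : FellerMarkovProcess E} {δ : ℝ≥0} {ω : E → ℝ}
    (hω : Continuous ω) (hω0 : ∀ x, 0 ≤ ω x) (h : GeometricDrift X δ ω) :
    ∃ b M, ExpLyapunov X δ ω b M := by
  obtain ⟨b, hb0, hb1, M₁, M₂, h⟩ := h
  have h1 := fun θ (hθ : 0 < θ) x =>
    entropicUtility_le_of_pos hθ (measurable_runningReward δ hω) (h θ x).1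
  have h2 := fun θ (hθ : 0 < θ) x =>
    entropicUtility_le_of_pos hθ (hω.measurable.comp (measurable_eval δ)) (h θ x).2
  refine ⟨b, fun θ => |M₁ θ| + |M₂ θ|, hω, hω0, hb0, hb1, fun θ => by positivity,
    fun θ hθ x => (h1 θ hθ x).1, fun θ hθ x => (h1 θ hθ x).2.trans ?_,
    fun θ hθ x => (h2 θ hθ x).1, fun θ hθ x => (h2 θ hθ x).2.trans ?_⟩
  · gcongr
    linarith [le_abs_self (M₁ θ), abs_nonneg (M₂ θ)]
  · gcongr
    linarith [le_abs_self (M₂ θ), abs_nonneg (M₁ θ)]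

/-- The path functional `1 + ∫₀^δ ω(X_s) ds + ω(X_δ)` that dominates all rewards. -/
def gauge (δ : ℝ≥0) (ω : E → ℝ) (η : Path E) : ℝ := 1 + runningReward δ ω η + ω (η δ)

/-- The reward `∫₀^δ f(X_s) ds + g(X_δ)` collected over one period with terminal value `g`. -/
def payoff (δ : ℝ≥0) (f g : E → ℝ) (η : Path E) : ℝ := runningReward δ f η + g (η δ)

theorem measurable_payoff (δ : ℝ≥0) {f g : E → ℝ} (hf : Continuous f) (hg : Measurable g) :
    Measurable (payoff δ f g : Path E → ℝ) :=
  (measurable_runningReward δ hf).add (hg.comp (measurable_eval δ))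

namespace ExpLyapunov

variable {X : FellerMarkovProcess E} {δ : ℝ≥0} {ω : E → ℝ} {b : ℝ} {M : ℝ → ℝ}

omit [OpensMeasurableSpace E] in
theorem one_le_gauge (hL : ExpLyapunov X δ ω b M) (η : Path E) : 1 ≤ gauge δ ω η := by
  have := runningReward_nonneg δ hL.nonneg η
  have := hL.nonneg (η δ)
  unfold gauge; linarith

theorem measurable_gauge (hL : ExpLyapunov X δ ω b M) :
    Measurable (gauge δ ω : Path E → ℝ) :=
  ((measurable_runningReward δ hL.continuous).const_add 1).add
    (hL.continuous.measurable.comp (measurable_eval δ))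

theorem abs_payoff_le (hL : ExpLyapunov X δ ω b M) {f g : E → ℝ} {K A : ℝ} (hf : Continuous f)
    (hfK : ∀ x, |f x| ≤ K * (1 + ω x)) (hgA : ∀ x, |g x| ≤ A * (1 + ω x)) (η : Path E) :
    |payoff δ f g η| ≤ (K * (1 + δ) + A) * gauge δ ω η := by
  have h1 := abs_runningReward_le δ hf hL.continuous hfK η
  have h2 := hgA (η δ)
  have hW := runningReward_nonneg δ hL.nonneg η
  have hY := hL.nonneg (η δ)
  have hK : 0 ≤ K := by
    by_contra hK
    nlinarith [abs_nonneg (f (η δ)), hfK (η δ)]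
  have hA : 0 ≤ A := by
    by_contra hA
    nlinarith [abs_nonneg (g (η δ)), hgA (η δ)]
  have hδ : (0 : ℝ) ≤ δ := δ.2
  have h3 := abs_add_le (runningReward δ f η) (g (η δ))
  unfold payoff gauge
  nlinarith [mul_nonneg hK hW, mul_nonneg hK hY, mul_nonneg hA hW, mul_nonneg hA hY,
    mul_nonneg (mul_nonneg hK hδ) hW, mul_nonneg (mul_nonneg hK hδ) hY]

/-- All exponential moments of the gauge are finite, with logarithm of linear growth in `ω x`. -/
theorem exp_gauge (hL : ExpLyapunov X δ ω b M) {p : ℝ} (hp : 0 < p) (x : E) :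
    Integrable (fun η => Real.exp (p * gauge δ ω η)) (X.law x) ∧
      ∫ η, Real.exp (p * gauge δ ω η) ∂(X.law x) ≤ Real.exp (p * (1 + 2 * ω x + 2 * M (2 * p))) := by
  have h2p : 0 < 2 * p := by linarith
  have mW := measurable_runningReward (E := E) δ hL.continuous
  have mY : Measurable (fun η : Path E => ω (η δ)) :=
    hL.continuous.measurable.comp (measurable_eval δ)
  have h := integral_exp_add_le (P := X.law x) (a := fun η => p * runningReward δ ω η)
    (b := fun η => p * ω (η δ)) (α := 2 * p * (ω x + M (2 * p)))
    (β := 2 * p * (b * ω x + M (2 * p)))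
    (by simpa [mul_assoc] using hL.integrable_run (2 * p) h2p x)
    (by simpa [mul_assoc] using hL.integrable_end (2 * p) h2p x) (mW.const_mul _) (mY.const_mul _)
    (by simpa [mul_assoc] using hL.run_le (2 * p) h2p x)
    (by simpa [mul_assoc] using hL.end_le (2 * p) h2p x)
  have e : (fun η : Path E => Real.exp (p * gauge δ ω η)) =
      fun η => Real.exp p * Real.exp (p * runningReward δ ω η + p * ω (η δ)) := by
    funext η
    rw [← Real.exp_add]
    unfold gauge
    ring_nf
  rw [e]
  refine ⟨h.1.const_mul _, ?_⟩
  rw [integral_const_mul]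
  calc _ ≤ Real.exp p * Real.exp ((2 * p * (ω x + M (2 * p)) + 2 * p * (b * ω x + M (2 * p))) / 2) := by
        gcongr
        exact h.2
    _ ≤ _ := by
        rw [← Real.exp_add]
        gcongr
        nlinarith [mul_nonneg hp.le (mul_nonneg (sub_nonneg.2 hL.rate_lt_one.le) (hL.nonneg x))]

theorem integrable_exp_gauge (hL : ExpLyapunov X δ ω b M) (x : E) (p : ℝ) :
    Integrable (fun η => Real.exp (p * gauge δ ω η)) (X.law x) := by
  have hm := hL.measurable_gauge
  refine (hL.exp_gauge (p := |p| + 1) (by positivity) x).1.mono' (by fun_prop)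
    (Eventually.of_forall fun η => ?_)
  rw [Real.norm_eq_abs, abs_of_pos (Real.exp_pos _)]
  have := hL.one_le_gauge η
  gcongr
  linarith [le_abs_self p]

/-- Exponential moments of functionals dominated by the gauge are bounded in terms of `ω x`. -/
theorem integral_exp_le (hL : ExpLyapunov X δ ω b M) {A : ℝ} (hA : 0 < A) {Z : Path E → ℝ}
    (hZ : Measurable Z) (hZA : ∀ η, |Z η| ≤ A * gauge δ ω η) (x : E) :
    ∫ η, Real.exp (Z η) ∂(X.law x) ≤ Real.exp (A * (1 + 2 * ω x + 2 * M (2 * A))) :=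
  (integral_mono (integrable_exp_of_le (hL.integrable_exp_gauge x) hZ hZA)
    (hL.integrable_exp_gauge x A) fun η =>
      Real.exp_le_exp.2 ((le_abs_self _).trans (hZA η))).trans (hL.exp_gauge hA x).2

theorem integrable_of_le (hL : ExpLyapunov X δ ω b M) {A : ℝ} {Z : Path E → ℝ}
    (hZ : Measurable Z) (hZA : ∀ η, |Z η| ≤ A * gauge δ ω η) (x : E) :
    Integrable Z (X.law x) := by
  simpa using integrable_exp_mul_of_le (hL.integrable_exp_gauge x) (Z := fun _ => 0) (A := 0)
    measurable_const hZ (by simp) hZA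

theorem integral_gauge_le (hL : ExpLyapunov X δ ω b M) (x : E) :
    ∫ η, gauge δ ω η ∂(X.law x) ≤ 1 + 2 * ω x + 2 * M 2 := by
  have hi : Integrable (gauge δ ω) (X.law x) :=
    hL.integrable_of_le (A := 1) hL.measurable_gauge
      (fun η => by rw [abs_of_nonneg (by linarith [hL.one_le_gauge η]), one_mul]) x
  have h := integral_le_log_integral_exp hi (by simpa using hL.integrable_exp_gauge x 1)
  refine h.trans ((Real.log_le_iff_le_exp
    (integral_exp_pos (by simpa using hL.integrable_exp_gauge x 1))).2 ?_)
  simpa using (hL.exp_gauge one_pos x).2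

/-- Exponential tilts by functionals of linear growth preserve the geometric drift. The rate stays
below one because the entropy cost of the tilt is divided by a risk parameter `θ` that can be taken
arbitrarily large. -/
theorem exists_tilted_drift (hL : ExpLyapunov X δ ω b M) {A : ℝ} (hA : 0 < A) :
    ∃ r N : ℝ, 0 < r ∧ r < 1 ∧ 0 ≤ N ∧ ∀ (x : E) (Z : Path E → ℝ), Measurable Z →
      (∀ η, |Z η| ≤ A * gauge δ ω η) →
        ∫ η, ω (η δ) ∂((X.law x).tilted Z) ≤ r * ω x + N := by
  have hb1 : 0 < 1 - b := by linarith [hL.rate_lt_one]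
  set θ : ℝ := 8 * A / (1 - b) with hθ
  have hθ0 : 0 < θ := by positivity
  refine ⟨(1 + b) / 2, M (2 * θ) + A * (2 + 2 * M (2 * (2 * A)) + 2 * M 2) / θ,
    by linarith [hL.rate_pos], by linarith,
    add_nonneg (hL.noise_nonneg _) (div_nonneg (mul_nonneg hA.le (by
      linarith [hL.noise_nonneg (2 * (2 * A)), hL.noise_nonneg 2])) hθ0.le),
    fun x Z hZ hZA => ?_⟩
  have hgauge := hL.integrable_exp_gauge x
  have mY : Measurable (fun η : Path E => ω (η δ)) :=
    hL.continuous.measurable.comp (measurable_eval δ)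
  have hY : ∀ η : Path E, |θ * ω (η δ)| ≤ θ * gauge δ ω η := by
    intro η
    rw [abs_of_nonneg (mul_nonneg hθ0.le (hL.nonneg _))]
    have := runningReward_nonneg δ hL.nonneg η
    gcongr
    unfold gauge
    linarith
  have hZi := integrable_exp_of_le hgauge hZ hZA
  have : IsProbabilityMeasure ((X.law x).tilted Z) := isProbabilityMeasure_tilted hZi
  have hYQ := integrable_tilted_of_le hgauge hZ (mY.const_mul θ) hZA hY
  have hsum : Integrable
      (fun η => Real.exp ((Z + fun η : Path E => θ * ω (η δ)) η)) (X.law x) :=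
    integrable_exp_of_le (A := A + θ) hgauge (hZ.add (mY.const_mul θ)) fun η =>
      (abs_add_le (Z η) (θ * ω (η δ))).trans (by rw [add_mul]; exact add_le_add (hZA η) (hY η))
  have hEQ : Integrable (fun η => Real.exp (θ * ω (η δ))) ((X.law x).tilted Z) := by
    rw [integrable_tilted_iff hZi]
    refine hsum.congr (Eventually.of_forall fun η => ?_)
    simp [Real.exp_add]
  have hJ := integral_le_log_integral_exp hYQ hEQ
  rw [integral_exp_tilted, integral_const_mul] at hJ
  rw [Real.log_div (integral_exp_pos hsum).ne' (integral_exp_pos hZi).ne'] at hJ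
  -- the numerator, by Cauchy-Schwarz
  have h2A : 0 < 2 * A := by linarith
  have h2Z : ∀ η, |2 * Z η| ≤ 2 * A * gauge δ ω η := fun η => by
    rw [abs_mul, abs_two, mul_assoc]; gcongr; exact hZA η
  have hnum := (integral_exp_add_le (P := X.law x) (a := Z) (b := fun η => θ * ω (η δ))
    (α := 2 * A * (1 + 2 * ω x + 2 * M (2 * (2 * A))))
    (β := 2 * θ * (b * ω x + M (2 * θ)))
    (integrable_exp_of_le hgauge (hZ.const_mul 2) h2Z)
    (by simpa [mul_assoc] using hL.integrable_end (2 * θ) (by linarith) x)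
    hZ (mY.const_mul θ) (hL.integral_exp_le h2A (hZ.const_mul 2) h2Z x)
    (by simpa [mul_assoc] using hL.end_le (2 * θ) (by linarith) x)).2
  have hnum' := (Real.log_le_iff_le_exp (integral_exp_pos hsum)).2 hnum
  -- the denominator, by Jensen's inequality
  have hden := integral_le_log_integral_exp (hL.integrable_of_le hZ hZA x) hZi
  have hden' : -(A * (1 + 2 * ω x + 2 * M 2)) ≤ ∫ η, Z η ∂(X.law x) := by
    have hg := hL.integrable_of_le (A := 1) hL.measurable_gauge
      (fun η => by rw [abs_of_nonneg (by linarith [hL.one_le_gauge η]), one_mul]) x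
    have := integral_mono (hg.const_mul (-A)) (hL.integrable_of_le hZ hZA x)
      fun η => by linarith [(abs_le.1 (hZA η)).1]
    rw [integral_const_mul] at this
    nlinarith [hL.integral_gauge_le x]
  have hfin : θ * ∫ η, ω (η δ) ∂((X.law x).tilted Z) ≤
      θ * (b * ω x + M (2 * θ)) + A * (4 * ω x + 2 + 2 * M (2 * (2 * A)) + 2 * M 2) := by
    linarith
  have hAθ : A = θ * (1 - b) / 8 := by rw [hθ]; field_simp
  have hfin' : ∫ η, ω (η δ) ∂((X.law x).tilted Z) ≤
      b * ω x + M (2 * θ) + A * (4 * ω x + 2 + 2 * M (2 * (2 * A)) + 2 * M 2) / θ := by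
    rw [← mul_le_mul_iff_right₀ hθ0]
    refine hfin.trans_eq ?_
    field_simp
  refine hfin'.trans_eq ?_
  have : A * (4 * ω x + 2 + 2 * M (2 * (2 * A)) + 2 * M 2) / θ =
      A / θ * (4 * ω x) + A * (2 + 2 * M (2 * (2 * A)) + 2 * M 2) / θ := by ring
  rw [this]
  have hA8 : A / θ = (1 - b) / 8 := by rw [hθ]; field_simp
  rw [hA8]
  ring

end ExpLyapunov

end Lyapunov

/-! ### The one-period entropic operator -/

section EntropicUtility

variable {Ω : Type*} [MeasurableSpace Ω] {P : Measure Ω}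

theorem entropicUtility_eq_coe [NeZero P] {γ : ℝ} (hγ : γ ≠ 0) {Z : Ω → ℝ}
    (hZ : Integrable (fun η => Real.exp (γ * Z η)) P) :
    entropicUtility P γ Z = ((γ⁻¹ * Real.log (∫ η, Real.exp (γ * Z η) ∂P) : ℝ) : EReal) := by
  rw [entropicUtility, if_neg hγ, ← ofReal_integral_eq_lintegral_ofReal hZ
    (Eventually.of_forall fun _ => (Real.exp_pos _).le),
    ENNReal.log_ofReal_of_pos (integral_exp_pos hZ), one_div, EReal.coe_mul]

theorem coe_mul_log_ofReal_exp {γ : ℝ} (hγ : γ ≠ 0) (a : ℝ) :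
    ((1 / γ : ℝ) : EReal) * ENNReal.log (ENNReal.ofReal (Real.exp (γ * a))) = (a : EReal) := by
  rw [ENNReal.log_ofReal_of_pos (Real.exp_pos _), Real.log_exp, ← EReal.coe_mul]
  congr 1
  field_simp

theorem antitone_coe_mul_log {γ : ℝ} (hγ : γ < 0) :
    Antitone fun t : ℝ≥0∞ => ((1 / γ : ℝ) : EReal) * ENNReal.log t := by
  intro s t hst
  have h : ENNReal.log s ≤ ENNReal.log t := ENNReal.log_le_log_iff.2 hst
  have h0 : (0 : EReal) ≤ ((-(1 / γ) : ℝ) : EReal) := by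
    have : 1 / γ < 0 := one_div_neg.2 hγ
    exact_mod_cast (neg_pos.2 this).le
  have := mul_le_mul_of_nonneg_left h h0
  rw [EReal.coe_neg, EReal.neg_mul, EReal.neg_mul] at this
  exact EReal.neg_le_neg_iff.1 this

theorem entropicUtility_le_of_le_lintegral {γ a : ℝ} (hγ : γ < 0) {Z : Ω → ℝ}
    (h : ENNReal.ofReal (Real.exp (γ * a)) ≤ ∫⁻ η, ENNReal.ofReal (Real.exp (γ * Z η)) ∂P) :
    entropicUtility P γ Z ≤ (a : EReal) := by
  rw [entropicUtility, if_neg hγ.ne, ← coe_mul_log_ofReal_exp hγ.ne a]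
  exact antitone_coe_mul_log hγ h

theorem le_entropicUtility_of_lintegral_le {γ a : ℝ} (hγ : γ < 0) {Z : Ω → ℝ}
    (h : ∫⁻ η, ENNReal.ofReal (Real.exp (γ * Z η)) ∂P ≤ ENNReal.ofReal (Real.exp (γ * a))) :
    (a : EReal) ≤ entropicUtility P γ Z := by
  rw [entropicUtility, if_neg hγ.ne, ← coe_mul_log_ofReal_exp hγ.ne a]
  exact antitone_coe_mul_log hγ h

end EntropicUtility

section Step

variable {E : Type*} [TopologicalSpace E] [MeasurableSpace E] [OpensMeasurableSpace E]

/-- Measurable functions of at most linear growth in the weight `ω`. -/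
structure GrowthBound (ω : E → ℝ) (A : ℝ) (g : E → ℝ) : Prop where
  measurable : Measurable g
  bound : ∀ x, |g x| ≤ A * (1 + ω x)

/-- The entropic utility `μ_x^γ(∫₀^δ f(X_s) ds + g(X_δ))` as a real number. -/
def entropicStep (X : FellerMarkovProcess E) (δ : ℝ≥0) (f : E → ℝ) (γ : ℝ) (g : E → ℝ) (x : E) :
    ℝ :=
  γ⁻¹ * Real.log (∫ η, Real.exp (γ * payoff δ f g η) ∂(X.law x))

/-- The law of the process over one period, tilted by the exponential of the payoff. -/
def tiltedLaw (X : FellerMarkovProcess E) (δ : ℝ≥0) (f : E → ℝ) (γ : ℝ) (g : E → ℝ) (x : E) :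
    Measure (Path E) :=
  (X.law x).tilted fun η => γ * payoff δ f g η

/-- Standing data of the estimates below: the exponential Lyapunov condition, a continuous running
reward of linear growth `K` in the weight and a negative risk parameter. -/
structure RewardData (X : FellerMarkovProcess E) (δ : ℝ≥0) (ω : E → ℝ) (b : ℝ) (M : ℝ → ℝ)
    (f : E → ℝ) (K γ : ℝ) : Prop extends ExpLyapunov X δ ω b M where
  reward_continuous : Continuous f
  reward_bound : ∀ x, |f x| ≤ K * (1 + ω x)
  growth_nonneg : 0 ≤ K
  risk_neg : γ < 0

namespace RewardData

variable {X : FellerMarkovProcess E} {δ : ℝ≥0} {ω : E → ℝ} {b : ℝ} {M : ℝ → ℝ} {f : E → ℝ}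
  {K γ A A' : ℝ} {g h : E → ℝ}

/-- The growth constant of the exponent `γ (∫₀^δ f(X_s) ds + g(X_δ))` when `g` has growth constant
`A`. -/
def exponentGrowth (δ : ℝ≥0) (K γ A : ℝ) : ℝ := |γ| * (K * (1 + δ) + A)

omit [OpensMeasurableSpace E] in
theorem exponentGrowth_pos (hD : RewardData X δ ω b M f K γ) (hA : 0 < A) :
    0 < exponentGrowth δ K γ A := by
  have := hD.growth_nonneg
  have := abs_pos.2 hD.risk_neg.ne
  unfold exponentGrowth
  positivity

theorem abs_exponent_le (hD : RewardData X δ ω b M f K γ) (hg : GrowthBound ω A g) (η : Path E) :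
    |γ * payoff δ f g η| ≤ exponentGrowth δ K γ A * gauge δ ω η := by
  rw [abs_mul, exponentGrowth, mul_assoc]
  gcongr
  exact hD.abs_payoff_le hD.reward_continuous hD.reward_bound hg.bound η

theorem measurable_exponent (hD : RewardData X δ ω b M f K γ) (hg : GrowthBound ω A g) :
    Measurable fun η : Path E => γ * payoff δ f g η :=
  (measurable_payoff δ hD.reward_continuous hg.measurable).const_mul γ

theorem integrable_exp_exponent (hD : RewardData X δ ω b M f K γ) (hg : GrowthBound ω A g) (x : E) :
    Integrable (fun η => Real.exp (γ * payoff δ f g η)) (X.law x) :=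
  integrable_exp_of_le (hD.integrable_exp_gauge x) (hD.measurable_exponent hg)
    (hD.abs_exponent_le hg)

theorem isProbabilityMeasure_tiltedLaw (hD : RewardData X δ ω b M f K γ) (hg : GrowthBound ω A g)
    (x : E) : IsProbabilityMeasure (tiltedLaw X δ f γ g x) :=
  isProbabilityMeasure_tilted (hD.integrable_exp_exponent hg x)

theorem entropicUtility_eq (hD : RewardData X δ ω b M f K γ) (hg : GrowthBound ω A g) (x : E) :
    entropicUtility (X.law x) γ (fun η => runningReward δ f η + g (η δ)) =
      (entropicStep X δ f γ g x : EReal) :=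
  entropicUtility_eq_coe hD.risk_neg.ne (hD.integrable_exp_exponent hg x)

theorem lintegral_exp_eq (hD : RewardData X δ ω b M f K γ) (hg : GrowthBound ω A g) (x : E) :
    ∫⁻ η, ENNReal.ofReal (Real.exp (γ * payoff δ f g η)) ∂(X.law x) =
      ENNReal.ofReal (Real.exp (γ * entropicStep X δ f γ g x)) := by
  have hi := hD.integrable_exp_exponent hg x
  rw [← ofReal_integral_eq_lintegral_ofReal hi
    (Eventually.of_forall fun _ => (Real.exp_pos _).le), entropicStep,
    mul_inv_cancel_left₀ hD.risk_neg.ne, Real.exp_log (integral_exp_pos hi)]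

theorem measurable_entropicStep (hD : RewardData X δ ω b M f K γ) (hg : GrowthBound ω A g) :
    Measurable (entropicStep X δ f γ g) := by
  have hm : StronglyMeasurable fun η : Path E => Real.exp (γ * payoff δ f g η) :=
    (Real.measurable_exp.comp (hD.measurable_exponent hg)).stronglyMeasurable
  have h : StronglyMeasurable fun x => ∫ η, Real.exp (γ * payoff δ f g η) ∂(X.law x) :=
    hm.integral_kernel
  exact (Real.measurable_log.comp h.measurable).const_mul _

theorem integrable_tiltedLaw (hD : RewardData X δ ω b M f K γ) (hg : GrowthBound ω A g)
    (hh : GrowthBound ω A' h) (x : E) :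
    Integrable (fun η => h (η δ)) (tiltedLaw X δ f γ g x) := by
  refine integrable_tilted_of_le (B := A') (hD.integrable_exp_gauge x) (hD.measurable_exponent hg)
    (hh.measurable.comp (measurable_eval δ)) (hD.abs_exponent_le hg) fun η => ?_
  have h1 := hh.bound (η δ)
  have h2 := hD.nonneg (η δ)
  have h3 := runningReward_nonneg δ hD.nonneg η
  have hA' : 0 ≤ A' := by
    by_contra hA
    nlinarith [abs_nonneg (h (η δ))]
  unfold gauge
  nlinarith [mul_nonneg hA' h3]

/-- Differences of entropic utilities are bounded above by the expectation of the difference of the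
terminal values under the law tilted by the subtracted payoff: Jensen's inequality, reversed by the
negative risk parameter. -/
theorem entropicStep_sub_le (hD : RewardData X δ ω b M f K γ) (hg : GrowthBound ω A g)
    (hh : GrowthBound ω A' h) (x : E) :
    entropicStep X δ f γ g x - entropicStep X δ f γ h x ≤
      ∫ η, (g (η δ) - h (η δ)) ∂(tiltedLaw X δ f γ h x) := by
  have hgi := hD.integrable_exp_exponent hg x
  have hhi := hD.integrable_exp_exponent hh x
  have := hD.isProbabilityMeasure_tiltedLaw hh x
  have hint := (hD.integrable_tiltedLaw hh hg x).sub (hD.integrable_tiltedLaw hh hh x)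
  have e : ∀ η : Path E, γ * payoff δ f g η =
      ((fun η => γ * payoff δ f h η) + fun η : Path E => γ * (g (η δ) - h (η δ))) η := by
    intro η
    simp only [Pi.add_apply, payoff]
    ring
  have hJ := integral_le_log_integral_exp (P := tiltedLaw X δ f γ h x)
    (v := fun η => γ * (g (η δ) - h (η δ))) (hint.const_mul γ) (by
      rw [tiltedLaw, integrable_tilted_iff hhi]
      refine hgi.congr (Eventually.of_forall fun η => ?_)
      simp only [smul_eq_mul]
      rw [e η, ← Real.exp_add]
      rfl)
  rw [tiltedLaw, integral_exp_tilted] at hJ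
  simp_rw [← e] at hJ
  rw [integral_const_mul, Real.log_div (integral_exp_pos hgi).ne' (integral_exp_pos hhi).ne'] at hJ
  rw [entropicStep, entropicStep, ← mul_sub, inv_mul_eq_div, div_le_iff_of_neg hD.risk_neg, mul_comm]
  exact hJ

theorem le_entropicStep_sub (hD : RewardData X δ ω b M f K γ) (hg : GrowthBound ω A g)
    (hh : GrowthBound ω A' h) (x : E) :
    ∫ η, (g (η δ) - h (η δ)) ∂(tiltedLaw X δ f γ g x) ≤
      entropicStep X δ f γ g x - entropicStep X δ f γ h x := by
  have h1 := hD.entropicStep_sub_le hh hg x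
  have h2 : ∫ η, (g (η δ) - h (η δ)) ∂(tiltedLaw X δ f γ g x) =
      -∫ η, (h (η δ) - g (η δ)) ∂(tiltedLaw X δ f γ g x) := by
    rw [← integral_neg]
    simp
  linarith

theorem entropicStep_mono (hD : RewardData X δ ω b M f K γ) (hg : GrowthBound ω A g)
    (hh : GrowthBound ω A' h) (hgh : ∀ x, g x ≤ h x) (x : E) :
    entropicStep X δ f γ g x ≤ entropicStep X δ f γ h x := by
  have h1 := hD.entropicStep_sub_le hg hh x
  have h2 : ∫ η, (g (η δ) - h (η δ)) ∂(tiltedLaw X δ f γ h x) ≤ 0 :=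
    integral_nonpos fun η => sub_nonpos.2 (hgh _)
  linarith

omit [OpensMeasurableSpace E] in
theorem _root_.ImpulseControl.entropicStep_add_const (X : FellerMarkovProcess E) (δ : ℝ≥0)
    (f : E → ℝ) (hγ : γ < 0) (a : ℝ) (x : E)
    (hg : Integrable (fun η => Real.exp (γ * payoff δ f g η)) (X.law x)) :
    entropicStep X δ f γ (fun y => g y + a) x = entropicStep X δ f γ g x + a := by
  have e : ∀ η : Path E, Real.exp (γ * payoff δ f (fun y => g y + a) η) =
      Real.exp (γ * a) * Real.exp (γ * payoff δ f g η) := by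
    intro η
    rw [← Real.exp_add, payoff, payoff]
    ring_nf
  rw [entropicStep, entropicStep]
  simp_rw [e]
  rw [integral_const_mul, Real.log_mul (Real.exp_pos _).ne' (integral_exp_pos hg).ne',
    Real.log_exp, mul_add, inv_mul_cancel_left₀ hγ.ne, add_comm]

/-- The tilted laws of payoffs with a common growth constant satisfy a common drift condition. -/
theorem exists_drift (hD : RewardData X δ ω b M f K γ) (hA : 0 < A) :
    ∃ r N : ℝ, 0 < r ∧ r < 1 ∧ 0 ≤ N ∧ ∀ (x : E) (g : E → ℝ), GrowthBound ω A g →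
      ∫ η, ω (η δ) ∂(tiltedLaw X δ f γ g x) ≤ r * ω x + N := by
  obtain ⟨r, N, h0, h1, h2, h⟩ := hD.exists_tilted_drift (hD.exponentGrowth_pos hA)
  exact ⟨r, N, h0, h1, h2, fun x g hg =>
    h x _ (hD.measurable_exponent hg) (hD.abs_exponent_le hg)⟩

theorem growthBound_weight (hD : RewardData X δ ω b M f K γ) : GrowthBound ω 1 ω :=
  ⟨hD.continuous.measurable, fun x => by
    rw [abs_of_nonneg (hD.nonneg x)]
    linarith⟩

end RewardData

end Step

/-! ### The controlled process -/

section Controlled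

variable {E : Type*} [TopologicalSpace E] [MeasurableSpace E] {δ : ℝ≥0} {U : Set E}

theorem history_le_comap (n : ℕ) :
    history E δ n ≤ MeasurableSpace.comap (Preorder.frestrictLe (π := fun _ => Path E) n)
      inferInstance := by
  refine iSup_le fun k => iSup_le fun s => ?_
  rintro B ⟨A, hA, rfl⟩
  refine ⟨(fun y : (i : Finset.Iic n) → Path E => y ⟨k.1, Finset.mem_Iic.2 k.2⟩ s.1) ⁻¹' A, ?_, rfl⟩
  exact (measurable_eval s.1).comp (measurable_pi_apply _) hA

/-- Events of the history up to time `n δ` only depend on the paths with index at most `n`. -/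
theorem mem_iff_of_measurableSet_history {n : ℕ} {B : Set (ℕ → Path E)}
    (hB : MeasurableSet[history E δ n] B) {η η' : ℕ → Path E} (h : ∀ k ≤ n, η k = η' k) :
    η ∈ B ↔ η' ∈ B := by
  obtain ⟨C, -, rfl⟩ := history_le_comap n B hB
  have : Preorder.frestrictLe (π := fun _ => Path E) n η =
      Preorder.frestrictLe (π := fun _ => Path E) n η' := by
    funext i
    exact h i.1 (Finset.mem_Iic.1 i.2)
  rw [Set.mem_preimage, Set.mem_preimage, this]

omit [MeasurableSpace E] in
theorem extend_apply {n k : ℕ} (hk : k ≤ n) (y : (i : Finset.Iic n) → Path E) :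
    extend n y k = y ⟨k, Finset.mem_Iic.2 hk⟩ := by
  rw [extend, dif_pos (Finset.mem_Iic.2 hk)]

namespace DyadicStrategy

variable (V : DyadicStrategy δ U)

theorem τ_eq_iff_of_agree {n : ℕ} {η η' : ℕ → Path E} (h : ∀ k ≤ n, η k = η' k) (i : ℕ) :
    V.τ i η = n ↔ V.τ i η' = n :=
  mem_iff_of_measurableSet_history ((V.isStoppingTime i).measurableSet_eq n) h

/-- The `i`-th shift, if it takes place at time `n δ`, only depends on the paths up to that time. -/
theorem ξ_eq_of_agree [MeasurableSingletonClass E] {n : ℕ} {η η' : ℕ → Path E}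
    (h : ∀ k ≤ n, η k = η' k) {i : ℕ} (hi : V.τ i η = n) : V.ξ i η' = V.ξ i η := by
  have hm : MeasurableSet[history E δ n] (V.ξ i ⁻¹' {V.ξ i η} ∩ {ζ | V.τ i ζ = n}) := by
    refine ((V.isStoppingTime i).measurableSet_inter_eq_iff (V.ξ i ⁻¹' {V.ξ i η}) n).1 ?_
    exact (V.measurable_shift i (measurableSet_singleton _)).inter
      ((V.isStoppingTime i).measurableSet_eq' n)
  exact ((mem_iff_of_measurableSet_history hm h).1 ⟨rfl, hi⟩).1

theorem postState_eq_of_agree [MeasurableSingletonClass E] {n : ℕ} {η η' : ℕ → Path E}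
    (h : ∀ k ≤ n, η k = η' k) : V.postState n η = V.postState n η' := by
  by_cases hi : ∃ i, V.τ i η = n
  · obtain ⟨i, hi⟩ := hi
    rw [V.postState_of_eq η hi, V.postState_of_eq η' ((V.τ_eq_iff_of_agree h i).1 hi),
      V.ξ_eq_of_agree h hi]
  · have hi' : ¬ ∃ i, V.τ i η' = n := by
      simpa only [V.τ_eq_iff_of_agree h] using hi
    rw [postState, postState, dif_neg hi, dif_neg hi', preState, preState, h n le_rfl]

theorem postState_mem {n : ℕ} {η : ℕ → Path E} (h : ∃ i, V.τ i η = n) : V.postState n η ∈ U := by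
  obtain ⟨i, hi⟩ := h
  rw [V.postState_of_eq η hi]
  exact V.shift_mem i η

theorem postState_of_not {n : ℕ} {η : ℕ → Path E} (h : ¬ ∃ i, V.τ i η = n) :
    V.postState n η = preState δ n η := by
  rw [postState, dif_neg h]

open Classical in
/-- The cost of the possible impulse at time `n δ`. -/
def impulseCost (c : E → E → ℝ) (n : ℕ) (η : ℕ → Path E) : ℝ :=
  if ∃ i, V.τ i η = n then c (preState δ n η) (V.postState n η) else 0

theorem impulseCost_eq_of_agree [MeasurableSingletonClass E] (c : E → E → ℝ) {n : ℕ}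
    {η η' : ℕ → Path E} (h : ∀ k ≤ n, η k = η' k) :
    V.impulseCost c n η = V.impulseCost c n η' := by
  have hp : preState δ n η = preState δ n η' := by rw [preState, preState, h n le_rfl]
  have hi : (∃ i, V.τ i η = n) ↔ ∃ i, V.τ i η' = n :=
    exists_congr fun i => V.τ_eq_iff_of_agree h i
  by_cases hn : ∃ i, V.τ i η = n
  · rw [impulseCost, impulseCost, if_pos hn, if_pos (hi.1 hn), V.postState_eq_of_agree h, hp]
  · rw [impulseCost, impulseCost, if_neg hn, if_neg (hi.not.1 hn)]

theorem measurable_preState (n : ℕ) : Measurable (preState (E := E) δ n) :=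
  (measurable_eval δ).comp (measurable_pi_apply n)

theorem measurable_impulseCost {c : E → E → ℝ}
    (hc : Measurable (Set.indicator (Set.univ ×ˢ U) fun p : E × E => c p.1 p.2)) (n : ℕ) :
    Measurable (V.impulseCost c n) := by
  classical
  have hS : MeasurableSet {η | ∃ i, V.τ i η = n} := by
    rw [Set.ofPred_exists]
    exact MeasurableSet.iUnion fun i =>
      (V.isStoppingTime i).measurableSpace_le _ ((V.isStoppingTime i).measurableSet_eq' n)
  have e : V.impulseCost c n = fun η => if ∃ i, V.τ i η = n then
      Set.indicator (Set.univ ×ˢ U) (fun p : E × E => c p.1 p.2)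
        (preState δ n η, V.postState n η) else 0 := by
    funext η
    by_cases h : ∃ i, V.τ i η = n
    · rw [impulseCost, if_pos h, if_pos h, Set.indicator_of_mem]
      exact ⟨trivial, V.postState_mem h⟩
    · rw [impulseCost, if_neg h, if_neg h]
  rw [e]
  exact Measurable.ite hS (hc.comp ((measurable_preState n).prodMk (V.measurable_postState n)))
    measurable_const

/-- The reward accumulated up to time `n δ`, not including the possible impulse at that time. -/
def accumulated (f : E → ℝ) (c : E → E → ℝ) (n : ℕ) (η : ℕ → Path E) : ℝ :=
  ∑ k ∈ Finset.range n, (V.impulseCost c k η + runningReward δ f (η (k + 1)))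

theorem accumulated_succ (f : E → ℝ) (c : E → E → ℝ) (n : ℕ) (η : ℕ → Path E) :
    V.accumulated f c (n + 1) η = V.accumulated f c n η +
      (V.impulseCost c n η + runningReward δ f (η (n + 1))) :=
  Finset.sum_range_succ _ _

theorem accumulated_eq_of_agree [MeasurableSingletonClass E] (f : E → ℝ) (c : E → E → ℝ) {n : ℕ}
    {η η' : ℕ → Path E} (h : ∀ k ≤ n, η k = η' k) :
    V.accumulated f c n η = V.accumulated f c n η' := by
  refine Finset.sum_congr rfl fun k hk => ?_
  have hk := Finset.mem_range.1 hk
  rw [V.impulseCost_eq_of_agree c fun j hj => h j (by omega), h (k + 1) (by omega)]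

theorem measurable_accumulated [OpensMeasurableSpace E] {f : E → ℝ} (hf : Continuous f)
    {c : E → E → ℝ} (hc : Measurable (Set.indicator (Set.univ ×ˢ U) fun p : E × E => c p.1 p.2))
    (n : ℕ) : Measurable (V.accumulated f c n) := by
  unfold accumulated
  exact Finset.measurable_sum _ fun k _ => (V.measurable_impulseCost hc k).add
    ((measurable_runningReward δ hf).comp (measurable_pi_apply (k + 1)))

theorem exists_τ_eq_of_ne_top {i : ℕ} {η : ℕ → Path E} (h : V.τ i η ≠ ⊤) :
    ∃ m : ℕ, V.τ i η = m := by
  obtain ⟨m, hm⟩ := WithTop.ne_top_iff_exists.1 h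
  exact ⟨m, hm.symm⟩

/-- Only the first `n + 1` impulses can take place up to time `n δ`. -/
theorem le_τ (i : ℕ) (η : ℕ → Path E) : (i : WithTop ℕ) ≤ V.τ i η := by
  induction i with
  | zero => simp
  | succ i ih =>
    rcases V.strictly_increasing i η with h | h
    · by_cases ht : V.τ (i + 1) η = ⊤
      · rw [ht]; exact le_top
      · obtain ⟨m, hm⟩ := V.exists_τ_eq_of_ne_top ht
        have h2 := ih.trans_lt h
        rw [hm] at h2 ⊢
        have h3 : i < m := by exact_mod_cast h2
        exact_mod_cast h3
    · rw [h.2]; exact le_top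

/-- The impulse costs, summed over the impulses or over the times. -/
theorem tsum_cost_eq (c : E → E → ℝ) (n : ℕ) (η : ℕ → Path E) :
    (∑' i, if V.τ i η ≤ n then c (preState δ ((V.τ i η).untopD 0) η) (V.ξ i η) else 0) =
      ∑ k ∈ Finset.range (n + 1), V.impulseCost c k η := by
  classical
  rw [tsum_eq_sum (s := Finset.range (n + 1))]
  · have h1 : ∀ i, (if V.τ i η ≤ n then c (preState δ ((V.τ i η).untopD 0) η) (V.ξ i η) else 0) =
        ∑ k ∈ Finset.range (n + 1), if V.τ i η = k then c (preState δ k η) (V.ξ i η) else 0 := by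
      intro i
      split_ifs with h
      · obtain ⟨m, hm⟩ := V.exists_τ_eq_of_ne_top
          (ne_top_of_le_ne_top (WithTop.natCast_ne_top n) h)
        have hmn : m ≤ n := by rw [hm] at h; exact_mod_cast h
        rw [Finset.sum_eq_single m]
        · rw [if_pos hm, hm]
          rfl
        · intro k _ hk
          rw [if_neg]
          rw [hm]
          exact fun hmk => hk (by exact_mod_cast hmk.symm)
        · intro hm'
          exact absurd (Finset.mem_range.2 (by omega)) hm'
      · refine (Finset.sum_eq_zero fun k hk => ?_).symm
        rw [if_neg]
        intro hk'
        rw [hk'] at h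
        have := Finset.mem_range.1 hk
        exact h (by exact_mod_cast (by omega : k ≤ n))
    simp_rw [h1]
    rw [Finset.sum_comm]
    refine Finset.sum_congr rfl fun k hk => ?_
    by_cases h : ∃ i, V.τ i η = k
    · rw [impulseCost, if_pos h]
      obtain ⟨i, hi⟩ := h
      have hik : i ≤ k := by have := V.le_τ i η; rw [hi] at this; exact_mod_cast this
      have := Finset.mem_range.1 hk
      rw [Finset.sum_eq_single i, if_pos hi, V.postState_of_eq η hi]
      · intro j _ hj
        rw [if_neg]
        exact fun hj' => hj (V.τ_unique η hj' hi)
      · intro hi'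
        exact absurd (Finset.mem_range.2 (by omega)) hi'
    · rw [impulseCost, if_neg h]
      refine Finset.sum_eq_zero fun i _ => if_neg fun hi => h ⟨i, hi⟩
  · intro i hi
    rw [if_neg]
    intro h
    have h2 : i ≤ n := by have := (V.le_τ i η).trans h; exact_mod_cast this
    exact hi (Finset.mem_range.2 (by omega))

end DyadicStrategy

/-- The running reward splits into the contributions of the periods `[k δ, (k + 1) δ]`. -/
theorem integral_state_eq [OpensMeasurableSpace E] (hδ : 0 < δ) {f : E → ℝ} (hf : Continuous f)
    (n : ℕ) (η : ℕ → Path E) :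
    ∫ s in (0 : ℝ)..(n * δ : ℝ), f (state δ s.toNNReal η) =
      ∑ k ∈ Finset.range n, runningReward δ f (η (k + 1)) := by
  have hδ' : (0 : ℝ) < δ := hδ
  have hpt : ∀ k : ℕ, ∀ s ∈ Set.Ioo (k * δ : ℝ) ((k + 1 : ℕ) * δ : ℝ),
      f (state δ s.toNNReal η) = f (η (k + 1) (s - k * δ).toNNReal) := by
    intro k s hs
    have hs0 : 0 ≤ s := (by positivity : (0 : ℝ) ≤ k * δ).trans hs.1.le
    have hfl : ⌊s.toNNReal / δ⌋₊ = k := by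
      rw [Nat.floor_eq_iff (zero_le)]
      constructor
      · rw [le_div_iff₀ hδ, ← NNReal.coe_le_coe]
        push_cast
        rw [Real.coe_toNNReal _ hs0]
        exact hs.1.le
      · rw [div_lt_iff₀ hδ, ← NNReal.coe_lt_coe]
        push_cast
        rw [Real.coe_toNNReal _ hs0]
        have := hs.2
        push_cast at this
        exact this
    have hsub : s.toNNReal - (k : ℝ≥0) * δ = (s - k * δ).toNNReal := by
      ext
      rw [NNReal.coe_sub_def, Real.coe_toNNReal _ hs0]
      push_cast
      rw [Real.coe_toNNReal']
    rw [state, hfl, hsub]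
  have hshift : ∀ k : ℕ, IntervalIntegrable
      (fun s => f (η (k + 1) (s - k * δ).toNNReal)) volume (k * δ : ℝ) ((k + 1 : ℕ) * δ : ℝ) := by
    intro k
    have := (intervalIntegrable_path_comp hf (η (k + 1)) 0 δ).comp_sub_right (k * δ : ℝ)
    rw [zero_add] at this
    convert this using 1
    push_cast; ring
  have hle : ∀ k : ℕ, (k * δ : ℝ) ≤ ((k + 1 : ℕ) * δ : ℝ) := fun k => by
    push_cast; nlinarith
  -- at the end points of the periods, a null set, the two integrands may differ
  have hint : ∀ k < n, IntervalIntegrable (fun s : ℝ => f (state δ s.toNNReal η)) volume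
      (k * δ : ℝ) ((k + 1 : ℕ) * δ : ℝ) := by
    intro k _
    refine (hshift k).congr_ae ?_
    rw [Set.uIoc_of_le (hle k), ← restrict_Ioo_eq_restrict_Ioc]
    exact (ae_restrict_mem measurableSet_Ioo).mono fun s hs => (hpt k s hs).symm
  have h := intervalIntegral.sum_integral_adjacent_intervals (a := fun k : ℕ => (k * δ : ℝ)) hint
  simp only [Nat.cast_zero, zero_mul] at h
  rw [← h]
  refine Finset.sum_congr rfl fun k _ => ?_
  have h2 : ∫ s in (k * δ : ℝ)..((k + 1 : ℕ) * δ : ℝ), f (state δ s.toNNReal η) =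
      ∫ s in (k * δ : ℝ)..((k + 1 : ℕ) * δ : ℝ), f (η (k + 1) (s - k * δ).toNNReal) := by
    rw [intervalIntegral.integral_of_le (hle k), intervalIntegral.integral_of_le (hle k),
      ← restrict_Ioo_eq_restrict_Ioc]
    exact setIntegral_congr_fun measurableSet_Ioo (hpt k)
  rw [h2, runningReward,
    intervalIntegral.integral_comp_sub_right (fun s => f (η (k + 1) s.toNNReal)) (k * δ : ℝ)]
  congr 1
  · ring
  · push_cast; ring

/-- The total reward up to time `n δ` includes the cost of an impulse at the final time, which the
accumulated reward leaves out. -/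
theorem totalReward_eq [OpensMeasurableSpace E] (hδ : 0 < δ) {f : E → ℝ} (hf : Continuous f)
    (c : E → E → ℝ) (V : DyadicStrategy δ U) (n : ℕ) (η : ℕ → Path E) :
    totalReward f c V n η = V.accumulated f c n η + V.impulseCost c n η := by
  rw [totalReward, integral_state_eq hδ hf, V.tsum_cost_eq, Finset.sum_range_succ,
    DyadicStrategy.accumulated, Finset.sum_add_distrib]
  ring

variable (X : FellerMarkovProcess E)

theorem lintegral_controlledLaw_initial (V : DyadicStrategy δ U) (x : E) {φ : Path E → ℝ≥0∞}
    (hφ : Measurable φ) :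
    ∫⁻ η, φ (η 0) ∂(controlledLaw X x V) = φ (constPath x) := by
  rw [controlledLaw, Kernel.lintegral_traj (X := fun _ => Path E) _
    (f := fun η => φ (η 0)) (hφ.comp (measurable_pi_apply 0))]
  have : ∀ η : ℕ → Path E, Function.updateFinset η (Finset.Iic 0) (fun _ => constPath x) 0 =
      constPath x := fun η => by simp [Function.updateFinset]
  simp [this]

/-- The Markov structure of the controlled process: given the past up to time `n δ`, the next
piece of the path has the law of the uncontrolled process started at the state after the possible
impulse. -/
theorem lintegral_controlledLaw_succ [MeasurableSingletonClass E] (V : DyadicStrategy δ U) (x : E)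
    (n : ℕ) {φ : (ℕ → Path E) → ℝ≥0∞} (hφ : Measurable φ)
    (hφn : ∀ η η' : ℕ → Path E, (∀ k ≤ n, η k = η' k) → φ η = φ η')
    {ψ : Path E → ℝ≥0∞} (hψ : Measurable ψ) :
    ∫⁻ η, φ η * ψ (η (n + 1)) ∂(controlledLaw X x V) =
      ∫⁻ η, φ η * ∫⁻ ζ, ψ ζ ∂(X.law (V.postState n η)) ∂(controlledLaw X x V) := by
  set κ := transition X V with hκ
  set x₀ : (i : Finset.Iic 0) → Path E := fun _ => constPath x
  have hΨ : Measurable fun y : E => ∫⁻ ζ, ψ ζ ∂(X.law y) := hψ.lintegral_kernel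
  have hG : Measurable fun η : ℕ → Path E => φ η * ψ (η (n + 1)) :=
    hφ.mul (hψ.comp (measurable_pi_apply _))
  have hinner : ∀ y : (i : Finset.Iic n) → Path E,
      ∫⁻ η, φ η * ψ (η (n + 1)) ∂(Kernel.traj (X := fun _ => Path E) κ n y) =
        φ (extend n y) * ∫⁻ ζ, ψ ζ ∂(X.law (V.postState n (extend n y))) := by
    intro y
    rw [Kernel.lintegral_traj (X := fun _ => Path E) y hG]
    have h1 : ∀ η : ℕ → Path E, φ (Function.updateFinset η (Finset.Iic n) y) = φ (extend n y) := by
      intro η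
      refine hφn _ _ fun k hk => ?_
      rw [extend_apply hk, Function.updateFinset, dif_pos (Finset.mem_Iic.2 hk)]
    have h2 : ∀ η : ℕ → Path E, Function.updateFinset η (Finset.Iic n) y (n + 1) = η (n + 1) :=
      fun η => by simp [Function.updateFinset]
    simp_rw [h1, h2]
    have h4 : Measurable fun η : ℕ → Path E => ψ (η (n + 1)) := hψ.comp (measurable_pi_apply _)
    rw [lintegral_const_mul _ h4]
    congr 1
    have h3 := congrArg (fun k => k y) (Kernel.map_traj_succ_self (X := fun _ => Path E)
      (κ := κ) (a := n))
    change Kernel.map _ _ y = κ n y at h3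
    rw [Kernel.map_apply _ (measurable_pi_apply _)] at h3
    rw [← lintegral_map (μ := Kernel.traj (X := fun _ => Path E) κ n y) hψ
      (measurable_pi_apply (n + 1)), h3]
    rfl
  have hpost : ∀ η : ℕ → Path E,
      φ η * ∫⁻ ζ, ψ ζ ∂(X.law (V.postState n η)) =
        φ (extend n (Preorder.frestrictLe (π := fun _ => Path E) n η)) *
          ∫⁻ ζ, ψ ζ ∂(X.law (V.postState n
            (extend n (Preorder.frestrictLe (π := fun _ => Path E) n η)))) := by
    intro η
    have hag : ∀ k ≤ n, η k = extend n (Preorder.frestrictLe (π := fun _ => Path E) n η) k :=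
      fun k hk => by rw [extend_apply hk]; rfl
    rw [← hφn _ _ hag, ← V.postState_eq_of_agree hag]
  have hmeas : Measurable fun y : (i : Finset.Iic n) → Path E =>
      φ (extend n y) * ∫⁻ ζ, ψ ζ ∂(X.law (V.postState n (extend n y))) :=
    (hφ.comp (measurable_extend n)).mul
      (hΨ.comp ((V.measurable_postState n).comp (measurable_extend n)))
  change ∫⁻ η, _ ∂(Kernel.traj (X := fun _ => Path E) κ 0 x₀) =
    ∫⁻ η, _ ∂(Kernel.traj (X := fun _ => Path E) κ 0 x₀)
  rw [lintegral_congr hpost]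
  rw [← lintegral_map (μ := Kernel.traj (X := fun _ => Path E) κ 0 x₀) hmeas
    (Preorder.measurable_frestrictLe n), Kernel.traj_map_frestrictLe_apply]
  conv_lhs => rw [← Kernel.traj_comp_partialTraj (X := fun _ => Path E) (κ := κ) (Nat.zero_le n)]
  rw [Kernel.lintegral_comp _ _ _ hG]
  exact lintegral_congr hinner

/-- One backward step for the exponential of the accumulated reward with terminal value `h`. -/
theorem lintegral_exp_accumulated_succ [MeasurableSingletonClass E] [OpensMeasurableSpace E]
    (V : DyadicStrategy δ U) (x : E) {f : E → ℝ} (hf : Continuous f) {c : E → E → ℝ}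
    (hc : Measurable (Set.indicator (Set.univ ×ˢ U) fun p : E × E => c p.1 p.2)) (γ : ℝ)
    {h : E → ℝ} (hh : Measurable h) (n : ℕ) :
    ∫⁻ η, ENNReal.ofReal (Real.exp (γ * (V.accumulated f c (n + 1) η + h (preState δ (n + 1) η))))
        ∂(controlledLaw X x V) =
      ∫⁻ η, ENNReal.ofReal (Real.exp (γ * (V.accumulated f c n η + V.impulseCost c n η))) *
        ∫⁻ ζ, ENNReal.ofReal (Real.exp (γ * payoff δ f h ζ)) ∂(X.law (V.postState n η))
          ∂(controlledLaw X x V) := by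
  rw [← lintegral_controlledLaw_succ X V x n
    (φ := fun η => ENNReal.ofReal (Real.exp (γ * (V.accumulated f c n η + V.impulseCost c n η))))]
  · refine lintegral_congr fun η => ?_
    rw [← ENNReal.ofReal_mul (Real.exp_pos _).le, ← Real.exp_add, V.accumulated_succ, payoff,
      preState]
    ring_nf
  · have := V.measurable_accumulated hf hc n
    have := V.measurable_impulseCost hc n
    fun_prop
  · intro η η' hag
    rw [V.accumulated_eq_of_agree f c hag, V.impulseCost_eq_of_agree c hag]
  · have := measurable_payoff δ hf hh
    fun_prop

end Controlled

/-! ### Super- and subsolutions along a strategy -/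

section Verification

variable {E : Type*} [TopologicalSpace E] [MeasurableSpace E] [OpensMeasurableSpace E]
  [MeasurableSingletonClass E]
  {X : FellerMarkovProcess E} {δ : ℝ≥0} {U : Set E} {ω : E → ℝ} {b : ℝ} {M : ℝ → ℝ} {f : E → ℝ}
  {K γ : ℝ} {c : E → E → ℝ}

omit [TopologicalSpace E] [MeasurableSpace E] [OpensMeasurableSpace E]
    [MeasurableSingletonClass E] in
theorem FiniteWeightNorm.exists_bound {ω g : E → ℝ} (hω : ∀ x, 0 ≤ ω x)
    (h : FiniteWeightNorm ω g) : ∃ A : ℝ, 0 < A ∧ ∀ x, |g x| ≤ A * (1 + ω x) := by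
  obtain ⟨A, hA⟩ := h
  refine ⟨max A 1, by positivity, fun x => ?_⟩
  have h1 : |g x| / (1 + ω x) ≤ A := hA ⟨x, rfl⟩
  have h2 : 0 < 1 + ω x := by linarith [hω x]
  rw [div_le_iff₀ h2] at h1
  exact h1.trans (by gcongr; exact le_max_left _ _)

omit [TopologicalSpace E] [MeasurableSpace E] [OpensMeasurableSpace E]
    [MeasurableSingletonClass E] in
theorem FiniteWeightNorm.of_bound {ω g : E → ℝ} (hω : ∀ x, 0 ≤ ω x) {A : ℝ}
    (h : ∀ x, |g x| ≤ A * (1 + ω x)) : FiniteWeightNorm ω g := by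
  refine ⟨A, ?_⟩
  rintro _ ⟨x, rfl⟩
  have h2 : 0 < 1 + ω x := by linarith [hω x]
  exact (div_le_iff₀ h2).2 (h x)

/-- If `h (k + 1)` dominates the one-period utility of `h k` under every action that the strategy
uses, then it dominates the utility of the accumulated reward with terminal value `h 0`. -/
theorem supersolution_le_lintegral (hD : RewardData X δ ω b M f K γ)
    (hc : Measurable (Set.indicator (Set.univ ×ˢ U) fun p : E × E => c p.1 p.2))
    (V : DyadicStrategy δ U) (x : E) {h : ℕ → E → ℝ} (hh : ∀ k, ∃ A, GrowthBound ω A (h k))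
    (hstep : ∀ k n η, entropicStep X δ f γ (h k) (V.postState n η) + V.impulseCost c n η ≤
      h (k + 1) (preState δ n η)) (n k : ℕ) :
    ENNReal.ofReal (Real.exp (γ * h (n + k) x)) ≤
      ∫⁻ η, ENNReal.ofReal (Real.exp (γ * (V.accumulated f c n η + h k (preState δ n η))))
        ∂(controlledLaw X x V) := by
  induction n generalizing k with
  | zero =>
    have hm : Measurable (h k) := (hh k).choose_spec.measurable
    have := lintegral_controlledLaw_initial X V x
      (φ := fun ζ => ENNReal.ofReal (Real.exp (γ * h k (ζ δ))))
      ((hm.comp (measurable_eval δ)).const_mul γ).exp.ennreal_ofReal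
    simp only [DyadicStrategy.accumulated, Finset.range_zero, Finset.sum_empty, zero_add, preState]
    exact this.ge
  | succ n ih =>
    obtain ⟨A, hA⟩ := hh k
    rw [lintegral_exp_accumulated_succ X V x hD.reward_continuous hc γ hA.measurable, add_right_comm]
    refine (ih (k + 1)).trans (lintegral_mono fun η => ?_)
    rw [hD.lintegral_exp_eq hA, ← ENNReal.ofReal_mul (Real.exp_pos _).le, ← Real.exp_add]
    refine ENNReal.ofReal_le_ofReal (Real.exp_le_exp.2 ?_)
    have := hstep k n η
    rw [← mul_add]
    refine mul_le_mul_of_nonpos_left ?_ hD.risk_neg.le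
    linarith

/-- If `h (k + 1)` is dominated by the one-period utility of `h k` under every action that the
strategy uses, then it is dominated by the utility of the accumulated reward with terminal value
`h 0`. -/
theorem lintegral_le_subsolution (hD : RewardData X δ ω b M f K γ)
    (hc : Measurable (Set.indicator (Set.univ ×ˢ U) fun p : E × E => c p.1 p.2))
    (V : DyadicStrategy δ U) (x : E) {h : ℕ → E → ℝ} (hh : ∀ k, ∃ A, GrowthBound ω A (h k))
    (hstep : ∀ k n η, h (k + 1) (preState δ n η) ≤
      entropicStep X δ f γ (h k) (V.postState n η) + V.impulseCost c n η) (n k : ℕ) :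
    ∫⁻ η, ENNReal.ofReal (Real.exp (γ * (V.accumulated f c n η + h k (preState δ n η))))
        ∂(controlledLaw X x V) ≤
      ENNReal.ofReal (Real.exp (γ * h (n + k) x)) := by
  induction n generalizing k with
  | zero =>
    have hm : Measurable (h k) := (hh k).choose_spec.measurable
    have := lintegral_controlledLaw_initial X V x
      (φ := fun ζ => ENNReal.ofReal (Real.exp (γ * h k (ζ δ))))
      ((hm.comp (measurable_eval δ)).const_mul γ).exp.ennreal_ofReal
    simp only [DyadicStrategy.accumulated, Finset.range_zero, Finset.sum_empty, zero_add, preState]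
    exact this.le
  | succ n ih =>
    obtain ⟨A, hA⟩ := hh k
    rw [lintegral_exp_accumulated_succ X V x hD.reward_continuous hc γ hA.measurable, add_right_comm]
    refine (lintegral_mono fun η => ?_).trans (ih (k + 1))
    rw [hD.lintegral_exp_eq hA, ← ENNReal.ofReal_mul (Real.exp_pos _).le, ← Real.exp_add]
    refine ENNReal.ofReal_le_ofReal (Real.exp_le_exp.2 ?_)
    have := hstep k n η
    rw [← mul_add]
    refine mul_le_mul_of_nonpos_left ?_ hD.risk_neg.le
    linarith

/-- The geometric corrections that absorb an error term proportional to `ω`. For `k = 0` this is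
`β (1 + ω)`, which dominates functions of linear growth. Passing from `k` to `k + 1` replaces the
weight by its drift bound `r ω + N`, so that the corrections are bounded in `k`. -/
def driftCorrection (ω : E → ℝ) (β r N : ℝ) (k : ℕ) (y : E) : ℝ :=
  β + β * N * ∑ j ∈ Finset.range k, r ^ j + β * r ^ k * ω y

omit [TopologicalSpace E] [MeasurableSpace E] [OpensMeasurableSpace E]
    [MeasurableSingletonClass E] in
theorem driftCorrection_le (hω : ∀ y, 0 ≤ ω y) {β r N : ℝ} (hβ : 0 ≤ β) (hr0 : 0 < r) (hr1 : r < 1)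
    (hN : 0 ≤ N) (k : ℕ) (y : E) :
    driftCorrection ω β r N k y ≤ β + β * N * (1 - r)⁻¹ + β * ω y := by
  have h1 : ∑ j ∈ Finset.range k, r ^ j ≤ (1 - r)⁻¹ := by
    have := (hasSum_geometric_of_lt_one hr0.le hr1)
    exact sum_le_hasSum _ (fun i _ => by positivity) this
  have h2 : r ^ k ≤ 1 := pow_le_one₀ hr0.le hr1.le
  have h3 : β * r ^ k * ω y ≤ β * ω y := by
    nlinarith [mul_nonneg hβ (hω y)]
  have h4 : β * N * ∑ j ∈ Finset.range k, r ^ j ≤ β * N * (1 - r)⁻¹ := by gcongr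
  unfold driftCorrection
  linarith

omit [MeasurableSingletonClass E] in
theorem GrowthBound.add_driftCorrection (hω : Continuous ω) (hω0 : ∀ y, 0 ≤ ω y) {A : ℝ}
    {w : E → ℝ} (hw : GrowthBound ω A w) (s β r N a : ℝ) (k : ℕ) :
    ∃ B, GrowthBound ω B (fun y => w y + a + s * driftCorrection ω β r N k y) := by
  set C := β + β * N * ∑ j ∈ Finset.range k, r ^ j with hC
  refine ⟨A + |a| + |s| * (|C| + |β * r ^ k|), ?_, fun x => ?_⟩
  · have := hw.measurable
    have := hω.measurable
    unfold driftCorrection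
    fun_prop
  · have h0 := hω0 x
    have h1 := hw.bound x
    have h2 : |driftCorrection ω β r N k x| ≤ (|C| + |β * r ^ k|) * (1 + ω x) := by
      have : driftCorrection ω β r N k x = C + β * r ^ k * ω x := rfl
      rw [this]
      refine (abs_add_le _ _).trans ?_
      rw [abs_mul (β * r ^ k), abs_of_nonneg h0]
      nlinarith [abs_nonneg C, abs_nonneg (β * r ^ k), mul_nonneg (abs_nonneg C) h0]
    calc |w x + a + s * driftCorrection ω β r N k x|
        ≤ |w x| + |a| + |s| * |driftCorrection ω β r N k x| := by
          rw [← abs_mul]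
          exact (abs_add_le _ _).trans (by gcongr; exact abs_add_le _ _)
      _ ≤ A * (1 + ω x) + |a| * (1 + ω x) + |s| * ((|C| + |β * r ^ k|) * (1 + ω x)) := by
          gcongr
          nlinarith [abs_nonneg a]
      _ = _ := by ring

omit [MeasurableSingletonClass E] in
/-- Adding a multiple of the weight to the terminal value changes the one-period utility by a
contracted multiple of the weight. -/
theorem RewardData.exists_weight_perturbation (hD : RewardData X δ ω b M f K γ) {A β : ℝ}
    (hA : 0 < A) (hβ : 0 ≤ β) {w : E → ℝ} (hw : GrowthBound ω A w) :
    ∃ r N : ℝ, 0 < r ∧ r < 1 ∧ 0 ≤ N ∧ ∀ t, 0 ≤ t → t ≤ β → ∀ a z,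
      entropicStep X δ f γ (fun y => w y + a + t * ω y) z ≤
          entropicStep X δ f γ w z + a + t * (r * ω z + N) ∧
        entropicStep X δ f γ w z + a - t * (r * ω z + N) ≤
          entropicStep X δ f γ (fun y => w y + a - t * ω y) z := by
  obtain ⟨r, N, hr0, hr1, hN, hdrift⟩ := hD.exists_drift (A := A + β) (by positivity)
  refine ⟨r, N, hr0, hr1, hN, fun t ht0 htβ a z => ?_⟩
  have hgrow : ∀ s : ℝ, |s| ≤ β → GrowthBound ω (A + β) (fun y => w y + s * ω y) := by
    intro s hs
    refine ⟨by have := hw.measurable; have := hD.continuous.measurable; fun_prop, fun x => ?_⟩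
    refine (abs_add_le _ _).trans ?_
    rw [abs_mul, abs_of_nonneg (hD.nonneg x)]
    nlinarith [hw.bound x, hD.nonneg x, mul_le_mul_of_nonneg_right hs (hD.nonneg x)]
  have hwβ : GrowthBound ω (A + β) w := by simpa using hgrow 0 (by simpa using hβ)
  have htβ' : |t| ≤ β := by rwa [abs_of_nonneg ht0]
  constructor
  · have hg := hgrow t htβ'
    have e : (fun y => w y + a + t * ω y) = fun y => (w y + t * ω y) + a := by funext y; ring
    rw [e, entropicStep_add_const X δ f hD.risk_neg a z (hD.integrable_exp_exponent hg z)]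
    have h1 := hD.entropicStep_sub_le hg hw z
    have h2 := hdrift z w hwβ
    simp only [add_sub_cancel_left] at h1
    rw [integral_const_mul] at h1
    nlinarith
  · have hg : GrowthBound ω (A + β) (fun y => w y - t * ω y) := by
      simpa [sub_eq_add_neg] using hgrow (-t) (by simpa using htβ')
    have e : (fun y => w y + a - t * ω y) = fun y => (w y - t * ω y) + a := by funext y; ring
    rw [e, entropicStep_add_const X δ f hD.risk_neg a z (hD.integrable_exp_exponent hg z)]
    have h1 := hD.le_entropicStep_sub hg hw z
    have h2 := hdrift z _ hg
    simp only [sub_sub_cancel_left] at h1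
    rw [integral_neg, integral_const_mul] at h1
    nlinarith

omit [OpensMeasurableSpace E] [MeasurableSingletonClass E] in
theorem impulseCost_nonpos (hc0 : ∀ x, ∀ ξ ∈ U, c x ξ ≤ 0) (V : DyadicStrategy δ U) (n : ℕ)
    (η : ℕ → Path E) : V.impulseCost c n η ≤ 0 := by
  unfold DyadicStrategy.impulseCost
  split_ifs with h
  · exact hc0 _ _ (V.postState_mem h)
  · exact le_rfl

omit [OpensMeasurableSpace E] [MeasurableSingletonClass E] in
theorem weight_postState_le {W : ℝ} (hω0 : ∀ x, 0 ≤ ω x) (hW0 : 0 ≤ W) (hW : ∀ ξ ∈ U, ω ξ ≤ W)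
    (V : DyadicStrategy δ U) (n : ℕ) (η : ℕ → Path E) :
    ω (V.postState n η) ≤ ω (preState δ n η) + W := by
  by_cases h : ∃ i, V.τ i η = n
  · linarith [hW _ (V.postState_mem h), hω0 (preState δ n η)]
  · rw [V.postState_of_not h]; linarith

/-- Every strategy is dominated by a solution of the Bellman inequality, up to a bounded error. -/
theorem exists_forall_entropicUtility_le (hD : RewardData X δ ω b M f K γ) (hδ : 0 < δ)
    (hc : Measurable (Set.indicator (Set.univ ×ˢ U) fun p : E × E => c p.1 p.2))
    (hc0 : ∀ x, ∀ ξ ∈ U, c x ξ ≤ 0) {W : ℝ} (hW0 : 0 ≤ W) (hW : ∀ ξ ∈ U, ω ξ ≤ W)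
    {A : ℝ} (hA : 0 < A) {w : E → ℝ} (hw : GrowthBound ω A w) {l : ℝ}
    (h1 : ∀ x, entropicStep X δ f γ w x ≤ w x + l)
    (h2 : ∀ x, ∀ ξ ∈ U, entropicStep X δ f γ w ξ + c x ξ ≤ w x + l) (x : E) :
    ∃ C : ℝ, ∀ (V : DyadicStrategy δ U) (n : ℕ),
      entropicUtility (controlledLaw X x V) γ (totalReward f c V n) ≤ ((n * l + C : ℝ) : EReal) := by
  obtain ⟨r, N, hr0, hr1, hN, hpert⟩ := hD.exists_weight_perturbation hA hA.le hw
  have hN' : 0 ≤ N + r * W := by positivity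
  refine ⟨w x + (A + A * (N + r * W) * (1 - r)⁻¹ + A * ω x), fun V n => ?_⟩
  -- `k` counts the remaining periods
  set h : ℕ → E → ℝ := fun k y => w y + k * l + 1 * driftCorrection ω A r (N + r * W) k y with hh
  have hbell : ∀ n η, entropicStep X δ f γ w (V.postState n η) + V.impulseCost c n η ≤
      w (preState δ n η) + l := by
    intro n η
    unfold DyadicStrategy.impulseCost
    split_ifs with hi
    · exact h2 _ _ (V.postState_mem hi)
    · rw [V.postState_of_not hi, add_zero]
      exact h1 _
  have hsup := supersolution_le_lintegral hD hc V x (h := h)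
    (fun k => hw.add_driftCorrection hD.continuous hD.nonneg 1 A r (N + r * W) (k * l) k)
    (fun k n η => ?_) n 0
  · refine entropicUtility_le_of_le_lintegral hD.risk_neg ?_
    refine le_trans ?_ (hsup.trans (lintegral_mono fun η => ?_))
    · refine ENNReal.ofReal_le_ofReal (Real.exp_le_exp.2 ?_)
      refine mul_le_mul_of_nonpos_left ?_ hD.risk_neg.le
      have := driftCorrection_le hD.nonneg hA.le hr0 hr1 hN' n x
      simp only [hh, add_zero]
      linarith
    · refine ENNReal.ofReal_le_ofReal (Real.exp_le_exp.2 ?_)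
      refine mul_le_mul_of_nonpos_left ?_ hD.risk_neg.le
      rw [totalReward_eq hδ hD.reward_continuous]
      have := impulseCost_nonpos hc0 V n η
      have := (abs_le.1 (hw.bound (preState δ n η))).1
      simp [hh, driftCorrection]
      linarith
  · have hrk : r ^ k ≤ 1 := pow_le_one₀ hr0.le hr1.le
    have hrk0 : 0 < r ^ k := by positivity
    have hp := (hpert (A * r ^ k) (by positivity) (by nlinarith)
      (k * l + (A + A * (N + r * W) * ∑ j ∈ Finset.range k, r ^ j)) (V.postState n η)).1
    have e : h k = fun y => w y +
        (k * l + (A + A * (N + r * W) * ∑ j ∈ Finset.range k, r ^ j)) + A * r ^ k * ω y := by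
      funext y
      simp only [hh, driftCorrection]
      ring
    rw [e]
    have hb := hbell n η
    have hz := weight_postState_le hD.nonneg hW0 hW V n η
    have hz' : A * r ^ k * (r * ω (V.postState n η) + N) ≤
        A * r ^ k * (r * (ω (preState δ n η) + W) + N) := by gcongr
    simp only [hh, driftCorrection, Finset.sum_range_succ]
    push_cast
    rw [pow_succ]
    linarith

/-- A strategy that almost attains the maximum in the Bellman equation almost attains the optimal
growth rate, up to a bounded error. -/
theorem exists_forall_le_entropicUtility (hD : RewardData X δ ω b M f K γ) (hδ : 0 < δ)
    (hc : Measurable (Set.indicator (Set.univ ×ˢ U) fun p : E × E => c p.1 p.2))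
    {Kc : ℝ} (hKc : 0 ≤ Kc) (hcK : ∀ x, ∀ ξ ∈ U, -(Kc * (1 + ω x)) ≤ c x ξ)
    {W : ℝ} (hW0 : 0 ≤ W) (hW : ∀ ξ ∈ U, ω ξ ≤ W)
    {A : ℝ} (hA : 0 < A) {w : E → ℝ} (hw : GrowthBound ω A w) {l : ℝ} (V : DyadicStrategy δ U)
    (hV : ∀ n η, w (preState δ n η) + l ≤
      entropicStep X δ f γ w (V.postState n η) + V.impulseCost c n η) (x : E) :
    ∃ C : ℝ, ∀ n : ℕ,
      ((n * l - C : ℝ) : EReal) ≤ entropicUtility (controlledLaw X x V) γ (totalReward f c V n) := by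
  have hβ : 0 ≤ A + Kc := by positivity
  obtain ⟨r, N, hr0, hr1, hN, hpert⟩ := hD.exists_weight_perturbation hA hβ hw
  have hN' : 0 ≤ N + r * W := by positivity
  set β := A + Kc with hβdef
  refine ⟨-w x + (β + β * (N + r * W) * (1 - r)⁻¹ + β * ω x), fun n => ?_⟩
  set h : ℕ → E → ℝ := fun k y => w y + k * l + (-1) * driftCorrection ω β r (N + r * W) k y with hh
  have hsub := lintegral_le_subsolution hD hc V x (h := h)
    (fun k => hw.add_driftCorrection hD.continuous hD.nonneg (-1) β r (N + r * W) (k * l) k)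
    (fun k n η => ?_) n 0
  · refine le_entropicUtility_of_lintegral_le hD.risk_neg ?_
    refine le_trans (lintegral_mono fun η => ?_) (hsub.trans ?_)
    · refine ENNReal.ofReal_le_ofReal (Real.exp_le_exp.2 ?_)
      refine mul_le_mul_of_nonpos_left ?_ hD.risk_neg.le
      rw [totalReward_eq hδ hD.reward_continuous]
      have h3 : -(Kc * (1 + ω (preState δ n η))) ≤ V.impulseCost c n η := by
        have := hD.nonneg (preState δ n η)
        unfold DyadicStrategy.impulseCost
        split_ifs with hi
        · exact hcK _ _ (V.postState_mem hi)
        · rw [neg_nonpos]; positivity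
      have := (abs_le.1 (hw.bound (preState δ n η))).2
      simp [hh, driftCorrection]
      linarith
    · refine ENNReal.ofReal_le_ofReal (Real.exp_le_exp.2 ?_)
      refine mul_le_mul_of_nonpos_left ?_ hD.risk_neg.le
      have := driftCorrection_le hD.nonneg hβ hr0 hr1 hN' n x
      simp only [hh, add_zero]
      linarith
  · have hrk : r ^ k ≤ 1 := pow_le_one₀ hr0.le hr1.le
    have hrk0 : 0 < r ^ k := by positivity
    have hp := (hpert (β * r ^ k) (by positivity) (by nlinarith)
      (k * l - (β + β * (N + r * W) * ∑ j ∈ Finset.range k, r ^ j)) (V.postState n η)).2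
    have e : h k = fun y => w y +
        (k * l - (β + β * (N + r * W) * ∑ j ∈ Finset.range k, r ^ j)) - β * r ^ k * ω y := by
      funext y
      simp only [hh, driftCorrection]
      ring
    rw [e]
    have hb := hV n η
    have hz := weight_postState_le hD.nonneg hW0 hW V n η
    have hz' : β * r ^ k * (r * ω (V.postState n η) + N) ≤
        β * r ^ k * (r * (ω (preState δ n η) + W) + N) := by gcongr
    simp only [hh, driftCorrection, Finset.sum_range_succ]
    push_cast
    rw [pow_succ]
    linarith

theorem tendsto_affine_div {d : ℝ} (hd : 0 < d) (l C : ℝ) :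
    Tendsto (fun n : ℕ => (((n * l + C) / (n * d) : ℝ) : EReal)) atTop (𝓝 ((l / d : ℝ) : EReal)) := by
  refine (continuous_coe_real_ereal.tendsto _).comp ?_
  have h1 : Tendsto (fun n : ℕ => l / d + C / d * (1 / (n : ℝ))) atTop (𝓝 (l / d + C / d * 0)) :=
    tendsto_const_nhds.add (tendsto_one_div_atTop_nhds_zero_nat.const_mul _)
  rw [mul_zero, add_zero] at h1
  refine h1.congr' ?_
  filter_upwards [eventually_gt_atTop 0] with n hn
  have : (n : ℝ) ≠ 0 := by positivity
  field_simp

omit [OpensMeasurableSpace E] [MeasurableSingletonClass E] in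
theorem longRunValue_le {V : DyadicStrategy δ U} (hδ : 0 < δ) {x : E} {l C : ℝ}
    (h : ∀ n : ℕ, entropicUtility (controlledLaw X x V) γ (totalReward f c V n) ≤
      ((n * l + C : ℝ) : EReal)) :
    longRunValue X f c γ x V ≤ ((l / δ : ℝ) : EReal) := by
  rw [← (tendsto_affine_div (d := δ) hδ l C).liminf_eq]
  refine liminf_le_liminf (Eventually.of_forall fun n => ?_)
  rw [EReal.coe_div]
  exact EReal.div_le_div_right_of_nonneg (by exact_mod_cast (by positivity : (0 : ℝ) ≤ n * δ)) (h n)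

omit [OpensMeasurableSpace E] [MeasurableSingletonClass E] in
theorem le_longRunValue {V : DyadicStrategy δ U} (hδ : 0 < δ) {x : E} {l C : ℝ}
    (h : ∀ n : ℕ, ((n * l - C : ℝ) : EReal) ≤
      entropicUtility (controlledLaw X x V) γ (totalReward f c V n)) :
    ((l / δ : ℝ) : EReal) ≤ longRunValue X f c γ x V := by
  rw [← (tendsto_affine_div (d := δ) hδ l (-C)).liminf_eq]
  refine liminf_le_liminf (Eventually.of_forall fun n => ?_)
  rw [EReal.coe_div, ← sub_eq_add_neg]
  exact EReal.div_le_div_right_of_nonneg (by exact_mod_cast (by positivity : (0 : ℝ) ≤ n * δ)) (h n)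

end Verification

/-! ### Almost optimal stationary strategies -/

section Strategy

variable {E : Type*} [TopologicalSpace E] [MeasurableSpace E] {δ : ℝ≥0} {U : Set E}

/-- Measurable selection of an almost optimal shift. The reward `φ` of a shift target need not be
continuous: the set of states in which a given shift is good enough is open, so countably many
shifts suffice. -/
theorem exists_measurable_selector [SecondCountableTopology E] [OpensMeasurableSpace E]
    (hU : U.Nonempty) {v : E → ℝ} (hv : Continuous v) (φ : E → ℝ) {c : E → E → ℝ}
    (hc : ∀ ξ ∈ U, Continuous fun x => c x ξ) :
    ∃ s : E → E, Measurable s ∧ (∀ x, s x ∈ U) ∧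
      ∀ x, (∃ ξ ∈ U, v x < φ ξ + c x ξ) → v x < φ (s x) + c x (s x) := by
  classical
  obtain ⟨u₀, hu₀⟩ := hU
  set O : E → Set E := fun ξ => {x | v x < φ ξ + c x ξ} with hO
  have hOo : ∀ ξ ∈ U, IsOpen (O ξ) := fun ξ hξ =>
    isOpen_lt hv (continuous_const.add (hc ξ hξ))
  obtain ⟨T, hTU, hTc, hT⟩ := TopologicalSpace.isOpen_biUnion_countable U O hOo
  -- adding `u₀` makes the countable family nonempty
  obtain ⟨e, he⟩ := (hTc.insert u₀).exists_eq_range (Set.insert_nonempty _ _)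
  have heU : ∀ n, e n ∈ U := by
    intro n
    have : e n ∈ insert u₀ T := he ▸ Set.mem_range_self n
    rcases this with h | h
    · rwa [h]
    · exact hTU h
  let p : E → ℕ → Prop := fun x n => x ∈ O (e n) ∨ x ∉ ⋃ m, O (e m)
  have hp : ∀ x, ∃ n, p x n := by
    intro x
    by_cases h : x ∈ ⋃ m, O (e m)
    · obtain ⟨n, hn⟩ := Set.mem_iUnion.1 h
      exact ⟨n, Or.inl hn⟩
    · exact ⟨0, Or.inr h⟩
  have hpm : ∀ n, MeasurableSet {x | p x n} := fun n =>
    ((hOo _ (heU n)).measurableSet).union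
      (isOpen_iUnion fun m => hOo _ (heU m)).measurableSet.compl
  refine ⟨fun x => e (Nat.find (hp x)), ?_, fun x => heU _, fun x hx => ?_⟩
  · exact (measurable_from_top (f := e)).comp (measurable_find hp hpm)
  · obtain ⟨ξ, hξ, hxξ⟩ := hx
    have hmem : x ∈ ⋃ ξ ∈ T, O ξ := by
      rw [hT]
      exact Set.mem_biUnion hξ hxξ
    obtain ⟨ξ', hξ', hx'⟩ := Set.mem_iUnion₂.1 hmem
    obtain ⟨n, hn⟩ : ξ' ∈ Set.range e := he ▸ Set.mem_insert_of_mem _ hξ'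
    rcases Nat.find_spec (hp x) with h | h
    · exact h
    · exact absurd (Set.mem_iUnion.2 ⟨n, by rwa [hn]⟩) h

section Visits

variable (δ) (I : Set E)

open Classical in
/-- The number of times `k < n` at which the state before a possible impulse lies in `I`. -/
def visitCount (n : ℕ) (η : ℕ → Path E) : ℕ :=
  ∑ k ∈ Finset.range n, if preState δ k η ∈ I then 1 else 0

/-- The `i`-th visit to `I` takes place at time `n δ`. -/
def IsVisit (i n : ℕ) (η : ℕ → Path E) : Prop := preState δ n η ∈ I ∧ visitCount δ I n η = i

open Classical in
/-- The time of the `i`-th visit to `I`, in units of `δ`. -/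
def visitTime (i : ℕ) (η : ℕ → Path E) : WithTop ℕ :=
  if h : ∃ n, IsVisit δ I i n η then (h.choose : WithTop ℕ) else ⊤

variable {δ I}

omit [MeasurableSpace E] in
theorem visitCount_mono {m n : ℕ} (h : m ≤ n) (η : ℕ → Path E) :
    visitCount δ I m η ≤ visitCount δ I n η :=
  Finset.sum_le_sum_of_subset (Finset.range_mono h)

omit [MeasurableSpace E] in
theorem visitCount_lt {m n : ℕ} {η : ℕ → Path E} (hm : preState δ m η ∈ I) (h : m < n) :
    visitCount δ I m η < visitCount δ I n η := by
  refine lt_of_lt_of_le ?_ (visitCount_mono (Nat.succ_le_of_lt h) η)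
  rw [visitCount, visitCount, Finset.sum_range_succ, if_pos hm]
  exact Nat.lt_succ_self _

omit [MeasurableSpace E] in
theorem IsVisit.unique {i m n : ℕ} {η : ℕ → Path E} (hm : IsVisit δ I i m η)
    (hn : IsVisit δ I i n η) : m = n := by
  rcases lt_trichotomy m n with h | h | h
  · have := visitCount_lt hm.1 h
    rw [hm.2, hn.2] at this
    exact absurd this (lt_irrefl _)
  · exact h
  · have := visitCount_lt hn.1 h
    rw [hm.2, hn.2] at this
    exact absurd this (lt_irrefl _)

omit [MeasurableSpace E] in
theorem visitTime_eq_iff {i n : ℕ} {η : ℕ → Path E} :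
    visitTime δ I i η = n ↔ IsVisit δ I i n η := by
  constructor
  · intro h
    unfold visitTime at h
    split_ifs at h with hex
    · have : hex.choose = n := by exact_mod_cast h
      rw [← this]
      exact hex.choose_spec
    · exact absurd h.symm (WithTop.natCast_ne_top n)
  · intro h
    have hex : ∃ n, IsVisit δ I i n η := ⟨n, h⟩
    rw [visitTime, dif_pos hex, hex.choose_spec.unique h]

omit [MeasurableSpace E] in
theorem exists_visitTime_eq_iff {n : ℕ} {η : ℕ → Path E} :
    (∃ i, visitTime δ I i η = n) ↔ preState δ n η ∈ I := by
  simp only [visitTime_eq_iff]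
  exact ⟨fun ⟨i, h⟩ => h.1, fun h => ⟨_, h, rfl⟩⟩

omit [MeasurableSpace E] in
/-- The number of visits increases by steps of one, so that no visit number is skipped. -/
theorem exists_isVisit_lt {i n : ℕ} {η : ℕ → Path E} (h : visitCount δ I n η = i + 1) :
    ∃ m < n, IsVisit δ I i m η := by
  induction n with
  | zero => simp [visitCount] at h
  | succ n ih =>
    by_cases hn : visitCount δ I n η = i + 1
    · obtain ⟨m, hm, hv⟩ := ih hn
      exact ⟨m, hm.trans (Nat.lt_succ_self _), hv⟩
    · rw [visitCount, Finset.sum_range_succ] at h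
      change visitCount δ I n η + _ = _ at h
      split_ifs at h with hI
      · exact ⟨n, Nat.lt_succ_self _, hI, by omega⟩
      · exact absurd (by omega) hn

omit [MeasurableSpace E] in
theorem visitTime_strict (i : ℕ) (η : ℕ → Path E) :
    visitTime δ I i η < visitTime δ I (i + 1) η ∨
      (visitTime δ I i η = ⊤ ∧ visitTime δ I (i + 1) η = ⊤) := by
  by_cases h : visitTime δ I (i + 1) η = ⊤
  · rw [h]
    by_cases h' : visitTime δ I i η = ⊤
    · exact Or.inr ⟨h', rfl⟩
    · exact Or.inl (lt_top_iff_ne_top.2 h')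
  · obtain ⟨n, hn⟩ := WithTop.ne_top_iff_exists.1 h
    have hn' : visitTime δ I (i + 1) η = (n : ℕ) := hn.symm
    obtain ⟨m, hm, hv⟩ := exists_isVisit_lt (visitTime_eq_iff.1 hn').2
    rw [hn', visitTime_eq_iff.2 hv]
    exact Or.inl (by exact_mod_cast hm)

theorem measurable_preState_history {k n : ℕ} (hk : k ≤ n) :
    Measurable[history E δ n] (preState (E := E) δ k) := by
  refine Measurable.mono (comap_measurable (preState (E := E) δ k)) ?_ le_rfl
  exact le_iSup_of_le (⟨k, hk⟩ : Set.Iic n)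
    (le_iSup_of_le (⟨δ, le_refl δ⟩ : Set.Iic δ) le_rfl)

theorem measurableSet_isVisit (hI : MeasurableSet I) (i n : ℕ) :
    MeasurableSet[history E δ n] {η | IsVisit δ I i n η} := by
  have h1 : Measurable[history E δ n] (visitCount (E := E) δ I n) := by
    unfold visitCount
    refine Finset.measurable_sum _ fun k hk => ?_
    exact Measurable.ite (measurable_preState_history (Finset.mem_range.1 hk).le hI)
      measurable_const measurable_const
  exact MeasurableSet.inter (measurable_preState_history le_rfl hI) (h1 (measurableSet_singleton i))

theorem isStoppingTime_visitTime (hI : MeasurableSet I) (i : ℕ) :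
    IsStoppingTime (history E δ) (visitTime δ I i) := by
  refine isStoppingTime_of_measurableSet_eq fun n => ?_
  have : {η | visitTime δ I i η = (n : WithTop ℕ)} = {η : ℕ → Path E | IsVisit δ I i n η} := by
    ext η
    exact visitTime_eq_iff
  exact this ▸ measurableSet_isVisit hI i n

open Classical in
/-- The strategy that shifts the process to `s x` whenever its state `x` lies in `I`. -/
def feedbackStrategy (hI : MeasurableSet I) {s : E → E} (hs : Measurable s) (hsU : ∀ x, s x ∈ U)
    {u₀ : E} (hu₀ : u₀ ∈ U) : DyadicStrategy δ U where
  τ := visitTime δ I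
  ξ i η := if visitTime δ I i η = ⊤ then u₀ else s (preState δ ((visitTime δ I i η).untopD 0) η)
  isStoppingTime := isStoppingTime_visitTime hI
  strictly_increasing := visitTime_strict
  measurable_shift i := by
    intro A hA
    set Ξ : (ℕ → Path E) → E := fun η =>
      if visitTime δ I i η = ⊤ then u₀ else s (preState δ ((visitTime δ I i η).untopD 0) η) with hΞ
    have hn : ∀ n : ℕ, MeasurableSet[history E δ n]
        (Ξ ⁻¹' A ∩ {η | visitTime δ I i η = (n : WithTop ℕ)}) := by
      intro n
      have e : Ξ ⁻¹' A ∩ {η | visitTime δ I i η = (n : WithTop ℕ)} =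
          (preState δ n ⁻¹' (s ⁻¹' A)) ∩ {η | IsVisit δ I i n η} := by
        ext η
        simp only [Set.mem_inter_iff, Set.mem_preimage, Set.mem_ofPred_eq, ← visitTime_eq_iff]
        refine and_congr_left fun h => ?_
        simp only [hΞ]
        rw [if_neg (by rw [h]; exact WithTop.natCast_ne_top n), h]
        rfl
      rw [e]
      exact (measurable_preState_history le_rfl (hs hA)).inter (measurableSet_isVisit hI i n)
    have hle : ∀ n : ℕ, MeasurableSet[history E δ n]
        (Ξ ⁻¹' A ∩ {η | visitTime δ I i η ≤ (n : WithTop ℕ)}) := by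
      intro n
      have e : Ξ ⁻¹' A ∩ {η | visitTime δ I i η ≤ (n : WithTop ℕ)} =
          ⋃ k : Set.Iic n, Ξ ⁻¹' A ∩ {η | visitTime δ I i η = ((k : ℕ) : WithTop ℕ)} := by
        ext η
        simp only [Set.mem_inter_iff, Set.mem_iUnion, Set.mem_ofPred_eq]
        constructor
        · rintro ⟨h1, h2⟩
          obtain ⟨k, hk⟩ := WithTop.ne_top_iff_exists.1
            (ne_top_of_le_ne_top (WithTop.natCast_ne_top n) h2)
          have hk' : visitTime δ I i η = ((k : ℕ) : WithTop ℕ) := hk.symm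
          rw [hk'] at h2
          exact ⟨⟨k, by exact_mod_cast h2⟩, h1, hk'⟩
        · rintro ⟨⟨k, hk⟩, h1, h2⟩
          refine ⟨h1, ?_⟩
          rw [h2]
          exact_mod_cast hk
      rw [e]
      exact MeasurableSet.iUnion fun k => (history E δ).mono k.2 _ (hn k)
    refine ((isStoppingTime_visitTime hI i).measurableSet _).2 ⟨?_, fun n => hle n⟩
    have e : Ξ ⁻¹' A = (⋃ n : ℕ, Ξ ⁻¹' A ∩ {η | visitTime δ I i η = (n : WithTop ℕ)}) ∪
        ({_η | u₀ ∈ A} ∩ (⋃ n : ℕ, {η | IsVisit δ I i n η})ᶜ) := by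
      ext η
      by_cases h : visitTime δ I i η = ⊤
      · have hno : ∀ n : ℕ, ¬ IsVisit δ I i n η := fun n hn => by
          rw [visitTime_eq_iff.2 hn] at h
          exact WithTop.natCast_ne_top n h
        simp [hΞ, h, hno]
      · obtain ⟨k, hk⟩ := WithTop.ne_top_iff_exists.1 h
        have hk' : visitTime δ I i η = ((k : ℕ) : WithTop ℕ) := hk.symm
        have hv := visitTime_eq_iff.1 hk'
        constructor
        · intro hA
          exact Or.inl (Set.mem_iUnion.2 ⟨k, hA, hk'⟩)
        · rintro (hA | hA)
          · exact (Set.mem_iUnion.1 hA).choose_spec.1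
          · exact absurd (Set.mem_iUnion.2 ⟨k, hv⟩) hA.2
    rw [e]
    have hsub : ∀ n, history E δ n ≤ ⨆ t, history E δ t := fun n => le_iSup (history E δ) n
    exact (MeasurableSet.iUnion fun n => hsub n _ (hn n)).union ((MeasurableSet.const _).inter
      (MeasurableSet.iUnion fun n => hsub n _ (measurableSet_isVisit hI i n)).compl)
  shift_mem i η := by
    split_ifs
    · exact hu₀
    · exact hsU _

theorem feedbackStrategy_postState_of_mem (hI : MeasurableSet I) {s : E → E} (hs : Measurable s)
    (hsU : ∀ x, s x ∈ U) {u₀ : E} (hu₀ : u₀ ∈ U) {n : ℕ} {η : ℕ → Path E}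
    (h : preState δ n η ∈ I) :
    (feedbackStrategy (δ := δ) hI hs hsU hu₀).postState n η = s (preState δ n η) := by
  obtain ⟨i, hi⟩ := exists_visitTime_eq_iff.2 h
  rw [DyadicStrategy.postState_of_eq _ η (i := i) hi]
  change (if visitTime δ I i η = ⊤ then u₀ else s (preState δ ((visitTime δ I i η).untopD 0) η)) = _
  rw [if_neg (by rw [hi]; exact WithTop.natCast_ne_top n), hi]
  rfl

end Visits

end Strategy

/-! ### The value of the control problem -/

section Value

variable {E : Type*} [TopologicalSpace E] [T2Space E] [SecondCountableTopology E]
  [MeasurableSpace E] [BorelSpace E]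
  {X : FellerMarkovProcess E} {δ : ℝ≥0} {U : Set E} {ω : E → ℝ} {f : E → ℝ} {γ : ℝ}
  {c : E → E → ℝ}

/-- The costs are restricted to `E × U`, outside of which nothing is known about them. -/
theorem measurable_indicator_cost (hU : IsCompact U)
    (hc : ContinuousOn (fun p : E × E => c p.1 p.2) (Set.univ ×ˢ U)) :
    Measurable (Set.indicator (Set.univ ×ˢ U) fun p : E × E => c p.1 p.2) := by
  classical
  rw [← Set.piecewise_eq_indicator]
  exact hc.measurable_piecewise continuousOn_const
    (MeasurableSet.univ.prod hU.isClosed.measurableSet)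

omit [T2Space E] [SecondCountableTopology E] [BorelSpace E] in
theorem RewardConstraints.rewardData {b : ℝ} {M : ℝ → ℝ} (hL : ExpLyapunov X δ ω b M)
    (hf : RewardConstraints ω f) (hγ : γ < 0) : ∃ K, RewardData X δ ω b M f K γ := by
  obtain ⟨K, hK0, hK⟩ := hf.2.exists_bound hL.nonneg
  exact ⟨K, hL, hf.1, hK, hK0.le, hγ⟩

omit [T2Space E] [SecondCountableTopology E] [MeasurableSpace E] [BorelSpace E] in
theorem CostConstraints.exists_lower_bound (hω0 : ∀ x, 0 ≤ ω x) (hU : IsCompact U)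
    (hc : CostConstraints U ω c) :
    ∃ Kc : ℝ, 0 < Kc ∧ ∀ x, ∀ ξ ∈ U, -(Kc * (1 + ω x)) ≤ c x ξ := by
  obtain ⟨Kc, h0, hKc⟩ := hc.2.2.exists_bound hω0
  refine ⟨Kc, h0, fun x ξ hξ => (abs_le.1 (hKc x)).1.trans ?_⟩
  refine csInf_le (hU.image_of_continuousOn ?_).bddBelow ⟨ξ, hξ, rfl⟩
  exact hc.1.comp (f := fun ξ => (x, ξ)) (by fun_prop) fun ξ hξ => ⟨trivial, hξ⟩

omit [T2Space E] [SecondCountableTopology E] [MeasurableSpace E] [BorelSpace E] in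
theorem exists_weight_bound (hω : Continuous ω) (hU : IsCompact U) :
    ∃ W : ℝ, 0 ≤ W ∧ ∀ ξ ∈ U, ω ξ ≤ W := by
  obtain ⟨W, hW⟩ := hU.bddAbove_image hω.continuousOn
  exact ⟨max W 0, le_max_right _ _, fun ξ hξ => (hW ⟨ξ, hξ, rfl⟩).trans (le_max_left _ _)⟩

omit [T2Space E] [SecondCountableTopology E] in
/-- The Bellman equation in terms of real numbers. -/
theorem isBellmanSolution_iff {b : ℝ} {M : ℝ → ℝ} {K A : ℝ} {w : E → ℝ} {l : ℝ}
    (hD : RewardData X δ ω b M f K γ) (hw : GrowthBound ω A w) (hwc : Continuous w) :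
    IsBellmanSolution X δ U ω f c γ w l ↔
      (∀ x, entropicStep X δ f γ w x ≤ w x + l) ∧
      (∀ x, ∀ ξ ∈ U, entropicStep X δ f γ w ξ + c x ξ ≤ w x + l) ∧
      ∀ x, w x + l ≤ entropicStep X δ f γ w x ∨
        ∀ ε > 0, ∃ ξ ∈ U, w x + l - ε < entropicStep X δ f γ w ξ + c x ξ := by
  have hn : FiniteWeightNorm ω w := FiniteWeightNorm.of_bound hD.nonneg hw.bound
  rw [IsBellmanSolution, and_iff_right hwc, and_iff_right hn, ← forall_and, ← forall_and]
  refine forall_congr' fun x => ?_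
  simp only [hD.entropicUtility_eq hw, ← EReal.coe_add]
  set S : EReal := ⨆ ξ ∈ U, ((entropicStep X δ f γ w ξ + c x ξ : ℝ) : EReal) with hS
  constructor
  · intro h
    have h1 : (entropicStep X δ f γ w x : EReal) ≤ ((w x + l : ℝ) : EReal) := h ▸ le_max_left _ _
    have h2 : S ≤ ((w x + l : ℝ) : EReal) := h ▸ le_max_right _ _
    refine ⟨by exact_mod_cast h1, fun ξ hξ => ?_, ?_⟩
    · exact EReal.coe_le_coe_iff.1 ((le_iSup₂_of_le ξ hξ le_rfl).trans h2)
    · rcases le_total S (entropicStep X δ f γ w x : EReal) with h3 | h3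
      · rw [max_eq_left h3] at h
        left
        exact_mod_cast h.le
      · rw [max_eq_right h3] at h
        right
        intro ε hε
        have h4 : ((w x + l - ε : ℝ) : EReal) < S := by
          rw [← h]
          exact EReal.coe_lt_coe_iff.2 (by linarith)
        obtain ⟨ξ, h5⟩ := lt_iSup_iff.1 h4
        obtain ⟨hξ, h6⟩ := lt_iSup_iff.1 h5
        exact ⟨ξ, hξ, EReal.coe_lt_coe_iff.1 h6⟩
  · rintro ⟨h1, h2, h3⟩
    refine le_antisymm ?_ (max_le (by exact_mod_cast h1)
      (iSup₂_le fun ξ hξ => by exact_mod_cast h2 ξ hξ))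
    rcases h3 with h3 | h3
    · exact le_max_of_le_left (by exact_mod_cast h3)
    · refine le_max_of_le_right ?_
      refine EReal.ge_of_forall_gt_iff_ge.1 fun z hz => ?_
      obtain ⟨ξ, hξ, h4⟩ := h3 (w x + l - z) (by linarith [EReal.coe_lt_coe_iff.1 hz])
      refine le_trans (EReal.coe_le_coe_iff.2 ?_) (le_iSup₂ (f := fun ξ (_ : ξ ∈ U) =>
        ((entropicStep X δ f γ w ξ + c x ξ : ℝ) : EReal)) ξ hξ)
      linarith

omit [T2Space E] [SecondCountableTopology E] [BorelSpace E] in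
theorem LocalMinorization.nonempty (h : LocalMinorization X δ U ω) : U.Nonempty := by
  obtain ⟨d, -, ν, -, hν, -⟩ := h 1 one_pos
  exact nonempty_of_measure_ne_zero hν.ne'

/-- Verification: the constant of the Bellman equation is the optimal growth rate. -/
theorem iSup_longRunValue_eq {b : ℝ} {M : ℝ → ℝ} {K : ℝ} (hδ : 0 < δ) (hU : IsCompact U)
    (hUn : U.Nonempty) (hD : RewardData X δ ω b M f K γ) (hc : CostConstraints U ω c)
    {w : E → ℝ} {l : ℝ} (hw : IsBellmanSolution X δ U ω f c γ w l) (x : E) :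
    (⨆ V : DyadicStrategy δ U, longRunValue X f c γ x V) = ((l / δ : ℝ) : EReal) := by
  obtain ⟨A, hA0, hA⟩ := hw.2.1.exists_bound hD.nonneg
  have hwc := hw.1
  have hwG : GrowthBound ω A w := ⟨hwc.measurable, hA⟩
  obtain ⟨h1, h2, h3⟩ := (isBellmanSolution_iff hD hwG hwc).1 hw
  obtain ⟨W, hW0, hW⟩ := exists_weight_bound hD.continuous hU
  have hcm := measurable_indicator_cost hU hc.1
  have hc0 : ∀ x, ∀ ξ ∈ U, c x ξ ≤ 0 := by
    obtain ⟨c₀, hc₀, h⟩ := hc.2.1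
    exact fun x ξ hξ => (h x ξ hξ).trans hc₀.le
  obtain ⟨Kc, hKc0, hKc⟩ := hc.exists_lower_bound hD.nonneg hU
  refine le_antisymm (iSup_le fun V => ?_) ?_
  · obtain ⟨C, hC⟩ := exists_forall_entropicUtility_le hD hδ hcm hc0 hW0 hW hA0 hwG h1 h2 x
    exact longRunValue_le hδ (hC V)
  · have key : ∀ ε > 0, (((l - ε) / δ : ℝ) : EReal) ≤
        ⨆ V : DyadicStrategy δ U, longRunValue X f c γ x V := by
      intro ε hε
      obtain ⟨s, hs, hsU, hsopt⟩ := exists_measurable_selector hUn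
        (v := fun x => w x + l - ε) (by fun_prop) (entropicStep X δ f γ w) (c := c)
        (fun ξ hξ => continuousOn_univ.1 (hc.1.comp (f := fun x => (x, ξ)) (by fun_prop)
          fun x _ => ⟨trivial, hξ⟩))
      -- where waiting is not optimal, the Bellman equation provides an almost optimal shift
      set I : Set E := {x | entropicStep X δ f γ w x < w x + l} with hI
      have hIm : MeasurableSet I :=
        measurableSet_lt (hD.measurable_entropicStep hwG) (hwc.measurable.add_const l)
      obtain ⟨u₀, hu₀⟩ := hUn
      set V : DyadicStrategy δ U := feedbackStrategy hIm hs hsU hu₀ with hV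
      refine le_iSup_of_le V ?_
      have hopt : ∀ n η, w (preState δ n η) + (l - ε) ≤
          entropicStep X δ f γ w (V.postState n η) + V.impulseCost c n η := by
        intro n η
        by_cases hn : preState δ n η ∈ I
        · have hex : ∃ i, V.τ i η = n := exists_visitTime_eq_iff.2 hn
          rw [DyadicStrategy.impulseCost, if_pos hex,
            feedbackStrategy_postState_of_mem hIm hs hsU hu₀ hn]
          have := hsopt (preState δ n η) ((h3 _).resolve_left (not_le.2 hn) ε hε)
          linarith
        · have hex : ¬ ∃ i, V.τ i η = n := fun h => hn (exists_visitTime_eq_iff.1 h)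
          rw [DyadicStrategy.impulseCost, if_neg hex, V.postState_of_not hex]
          have : w (preState δ n η) + l ≤ entropicStep X δ f γ w (preState δ n η) := not_lt.1 hn
          linarith
      obtain ⟨C, hC⟩ := exists_forall_le_entropicUtility hD hδ hcm hKc0.le hKc hW0 hW hA0 hwG V
        hopt x
      exact le_longRunValue hδ hC
    refine EReal.ge_of_forall_gt_iff_ge.1 fun z hz => ?_
    have hδ' : (0 : ℝ) < δ := hδ
    have hz' := EReal.coe_lt_coe_iff.1 hz
    have := key (l - z * δ) (by rw [lt_div_iff₀ hδ'] at hz'; linarith)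
    rwa [sub_sub_cancel, mul_div_cancel_right₀ _ hδ'.ne'] at this

end Value

/-! ### Continuity of bounded additive functionals -/

section Semigroup

variable {E : Type*} [TopologicalSpace E] [MeasurableSpace E] (X : FellerMarkovProcess E)

/-- The information generated by the coordinates up to time `s`. -/
abbrev pathHistory (E : Type*) [TopologicalSpace E] [MeasurableSpace E] (s : ℝ≥0) :
    MeasurableSpace (Path E) :=
  ⨆ u : Set.Iic s, MeasurableSpace.comap (fun η : Path E => η u.1) inferInstance

theorem pathHistory_le (s : ℝ≥0) : pathHistory E s ≤ (inferInstance : MeasurableSpace (Path E)) :=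
  iSup_le fun u => (measurable_eval u.1).comap_le

theorem measurable_eval_pathHistory {u s : ℝ≥0} (h : u ≤ s) :
    Measurable[pathHistory E s] (fun η : Path E => η u) := by
  refine Measurable.mono (comap_measurable (fun η : Path E => η u)) ?_ le_rfl
  exact le_iSup (fun u : Set.Iic s =>
    MeasurableSpace.comap (fun η : Path E => η u.1) inferInstance) ⟨u, h⟩

variable [OpensMeasurableSpace E]

theorem integrable_of_bounded {Ω : Type*} [MeasurableSpace Ω] {P : Measure Ω} [IsFiniteMeasure P]
    {F : Ω → ℝ} (hF : Measurable F) {C : ℝ} (hC : ∀ a, |F a| ≤ C) : Integrable F P :=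
  (integrable_const C).mono' hF.aestronglyMeasurable (Eventually.of_forall hC)

/-- The transition semigroup applied to a function. -/
def semigroup (t : ℝ≥0) (g : E → ℝ) (x : E) : ℝ := ∫ η, g (η t) ∂(X.law x)

omit [OpensMeasurableSpace E] in
theorem measurable_semigroup (t : ℝ≥0) {g : E → ℝ} (hg : Measurable g) :
    Measurable (semigroup X t g) :=
  (StronglyMeasurable.integral_kernel (κ := X.law) (f := fun η : Path E => g (η t))
    (hg.comp (measurable_eval t)).stronglyMeasurable).measurable

omit [OpensMeasurableSpace E] in
theorem abs_semigroup_le (t : ℝ≥0) {g : E → ℝ} {C : ℝ} (hC : ∀ x, |g x| ≤ C) (x : E) :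
    |semigroup X t g x| ≤ C := by
  have := norm_integral_le_of_norm_le_const (μ := X.law x) (f := fun η : Path E => g (η t)) (C := C)
    (Eventually.of_forall fun η => hC _)
  simpa [semigroup] using this

omit [OpensMeasurableSpace E] in
/-- The Markov property for bounded functions: conditional expectations on events. -/
theorem setIntegral_markov (x : E) (s t : ℝ≥0) {g : E → ℝ} (hg : Measurable g) {C : ℝ}
    (hC : ∀ x, |g x| ≤ C) {B : Set (Path E)} (hB : MeasurableSet[pathHistory E s] B) :
    ∫ η in B, semigroup X t g (η s) ∂(X.law x) = ∫ η in B, g (η (s + t)) ∂(X.law x) := by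
  set κ : Kernel (Path E) E := (X.law.map (fun η : Path E => η t)).comap (fun η : Path E => η s)
    (measurable_eval s) with hκ
  have : IsMarkovKernel (X.law.map (fun η : Path E => η t)) :=
    Kernel.IsMarkovKernel.map _ (measurable_eval t)
  set ρ : Kernel Unit (Path E) := Kernel.const Unit ((X.law x).restrict B) with hρ
  have hmap : (κ ∘ₖ ρ) () = ((X.law x).restrict B).map (fun η : Path E => η (s + t)) := by
    ext A hA
    rw [Kernel.comp_apply' _ _ _ hA, Measure.map_apply (measurable_eval _) hA,
      Measure.restrict_apply (measurable_eval _ hA), Set.inter_comm]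
    refine Eq.trans ?_ (X.markov x s t A hA B hB).symm
    refine lintegral_congr fun η => ?_
    rw [hκ, Kernel.comap_apply, Kernel.map_apply' _ (measurable_eval t) _ hA]
    rfl
  have hfin : IsFiniteMeasure (((X.law x).restrict B).map (fun η : Path E => η (s + t))) :=
    inferInstance
  have hi : Integrable g ((κ ∘ₖ ρ) ()) := by
    rw [hmap]
    exact integrable_of_bounded hg hC
  have h := Kernel.integral_comp hi
  rw [hmap, integral_map (measurable_eval _).aemeasurable hg.aestronglyMeasurable] at h
  rw [h]
  refine integral_congr_ae (Eventually.of_forall fun η => ?_)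
  dsimp only
  rw [hκ, Kernel.comap_apply, Kernel.map_apply _ (measurable_eval t),
    integral_map (measurable_eval _).aemeasurable hg.aestronglyMeasurable]
  rfl

omit [OpensMeasurableSpace E] in
/-- The Markov property for bounded functions: products. -/
theorem integral_mul_markov (x : E) (s t : ℝ≥0) {g : E → ℝ} (hg : Measurable g) {C : ℝ}
    (hC : ∀ x, |g x| ≤ C) {H : Path E → ℝ} (hH : Measurable[pathHistory E s] H) {D : ℝ}
    (hD : ∀ η, |H η| ≤ D) :
    ∫ η, H η * g (η (s + t)) ∂(X.law x) = ∫ η, H η * semigroup X t g (η s) ∂(X.law x) := by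
  have hm := pathHistory_le (E := E) s
  have hgi : Integrable (fun η : Path E => g (η (s + t))) (X.law x) :=
    integrable_of_bounded (hg.comp (measurable_eval _)) fun η => hC _
  have hPi : Integrable (fun η : Path E => semigroup X t g (η s)) (X.law x) :=
    integrable_of_bounded ((measurable_semigroup X t hg).comp (measurable_eval _))
      fun η => abs_semigroup_le X t hC _
  have hPm : Measurable[pathHistory E s] (fun η : Path E => semigroup X t g (η s)) :=
    (measurable_semigroup X t hg).comp (measurable_eval_pathHistory le_rfl)
  have h1 : (fun η : Path E => semigroup X t g (η s)) =ᵐ[X.law x]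
      (X.law x)[fun η : Path E => g (η (s + t)) | pathHistory E s] :=
    ae_eq_condExp_of_forall_setIntegral_eq hm hgi (fun _ _ _ => hPi.integrableOn)
      (fun B hB _ => setIntegral_markov X x s t hg hC hB)
      hPm.stronglyMeasurable.aestronglyMeasurable
  have h2 := condExp_stronglyMeasurable_mul_of_bound hm hH.stronglyMeasurable hgi D
    (Eventually.of_forall hD)
  have h3 := integral_condExp hm (μ := X.law x) (f := H * fun η : Path E => g (η (s + t)))
  rw [integral_congr_ae h2] at h3
  refine h3.symm.trans (integral_congr_ae ?_)
  filter_upwards [h1] with η hη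
  simp only [Pi.mul_apply]
  rw [← hη]

omit [OpensMeasurableSpace E] in
theorem continuous_semigroup (t : ℝ≥0) (g : BoundedContinuousFunction E ℝ) :
    Continuous (semigroup X t g) := X.feller t g

/-- The transition semigroup on bounded continuous functions. -/
def semigroupBCF (t : ℝ≥0) (g : BoundedContinuousFunction E ℝ) : BoundedContinuousFunction E ℝ :=
  BoundedContinuousFunction.ofNormedAddCommGroup (semigroup X t g) (continuous_semigroup X t g) ‖g‖
    fun x => abs_semigroup_le X t (fun y => g.norm_coe_le_norm y) x

/-- Finite-dimensional distributions depend continuously on the initial state: ordered times. -/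
theorem continuous_integral_prod_of_monotone (n : ℕ) (t : Fin n → ℝ≥0) (ht : Monotone t)
    (g : Fin n → BoundedContinuousFunction E ℝ) (T : ℝ≥0) (hT : ∀ i, t i ≤ T)
    (h : BoundedContinuousFunction E ℝ) :
    Continuous fun x => ∫ η, (∏ i, g i (η (t i))) * h (η T) ∂(X.law x) := by
  induction n generalizing T h with
  | zero => simpa using! continuous_semigroup X T h
  | succ n ih =>
    have hmon : Monotone fun i : Fin n => t i.castSucc := fun i j hij => ht (by simpa using hij)
    have hle : ∀ i : Fin n, t i.castSucc ≤ t (Fin.last n) := fun i => ht (Fin.le_last _)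
    have key := ih (fun i => t i.castSucc) hmon (fun i => g i.castSucc) (t (Fin.last n)) hle
      (g (Fin.last n) * semigroupBCF X (T - t (Fin.last n)) h)
    refine key.congr fun x => ?_
    set s := t (Fin.last n) with hs
    have hsT : s + (T - s) = T := add_tsub_cancel_of_le (hT _)
    have hHm : Measurable[pathHistory E s] fun η : Path E =>
        (∏ i : Fin n, g i.castSucc (η (t i.castSucc))) * g (Fin.last n) (η s) :=
      (Finset.measurable_prod _ fun i _ => (g i.castSucc).continuous.measurable.comp
        (measurable_eval_pathHistory (hle i))).mul
        ((g (Fin.last n)).continuous.measurable.comp (measurable_eval_pathHistory le_rfl))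
    have hHb : ∀ η : Path E, |(∏ i : Fin n, g i.castSucc (η (t i.castSucc))) *
        g (Fin.last n) (η s)| ≤ (∏ i : Fin n, ‖g i.castSucc‖) * ‖g (Fin.last n)‖ := by
      intro η
      rw [abs_mul, Finset.abs_prod]
      gcongr
      · exact (g _).norm_coe_le_norm _
      · exact (g _).norm_coe_le_norm _
    have hM := integral_mul_markov X x s (T - s) h.continuous.measurable
      (fun y => h.norm_coe_le_norm y) hHm hHb
    rw [hsT] at hM
    calc _ = ∫ η, ((∏ i : Fin n, g i.castSucc (η (t i.castSucc))) * g (Fin.last n) (η s)) *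
          semigroup X (T - s) h (η s) ∂(X.law x) := by
          refine integral_congr_ae (Eventually.of_forall fun η => ?_)
          exact (mul_assoc _ _ _).symm
      _ = _ := by
          rw [← hM]
          refine integral_congr_ae (Eventually.of_forall fun η => ?_)
          dsimp only
          rw [Fin.prod_univ_castSucc]

/-- Finite-dimensional distributions depend continuously on the initial state. -/
theorem continuous_integral_prod {n : ℕ} (t : Fin n → ℝ≥0)
    (g : Fin n → BoundedContinuousFunction E ℝ) :
    Continuous fun x => ∫ η, ∏ i, g i (η (t i)) ∂(X.law x) := by
  have h := continuous_integral_prod_of_monotone X n (t ∘ Tuple.sort t) (Tuple.monotone_sort t)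
    (g ∘ Tuple.sort t) (∑ i, t i)
    (fun i => Finset.single_le_sum (f := t) (fun _ _ => zero_le) (Finset.mem_univ _))
    (BoundedContinuousFunction.const E 1)
  refine h.congr fun x => integral_congr_ae (Eventually.of_forall fun η => ?_)
  simp only [Function.comp_apply, BoundedContinuousFunction.const_apply, mul_one]
  exact Equiv.prod_comp (Tuple.sort t) fun i => g i (η (t i))

omit [MeasurableSpace E] [OpensMeasurableSpace E] in
theorem abs_runningReward_le_of_bounded (δ : ℝ≥0) {f : E → ℝ} {C : ℝ} (hC : ∀ x, |f x| ≤ C)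
    (η : Path E) : |runningReward δ f η| ≤ C * δ := by
  have := intervalIntegral.norm_integral_le_of_norm_le_const (a := (0 : ℝ)) (b := δ)
    (f := fun s => f (η s.toNNReal)) (C := C) fun s _ => hC _
  simpa [runningReward] using this

variable [FirstCountableTopology E]

/-- Moments of a bounded additive functional depend continuously on the initial state, because they
are time integrals of finite-dimensional moments. -/
theorem continuous_integral_runningReward_pow (δ : ℝ≥0) (f g : BoundedContinuousFunction E ℝ)
    (k : ℕ) :
    Continuous fun x => ∫ η, runningReward δ f η ^ k * g (η δ) ∂(X.law x) := by
  set μ : Measure (Fin k → ℝ) := Measure.pi fun _ => volume.restrict (Set.Ioc (0 : ℝ) δ) with hμ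
  have hfin : IsFiniteMeasure μ := inferInstance
  have hmeas : Measurable fun p : Path E × (Fin k → ℝ) =>
      (∏ i, f (p.1 (p.2 i).toNNReal)) * g (p.1 δ) := by
    refine (Finset.measurable_prod _ fun i _ => ?_).mul
      (g.continuous.measurable.comp ((measurable_eval δ).comp measurable_fst))
    exact (measurable_comp_eval_toNNReal f.continuous).comp
      (f := fun p : Path E × (Fin k → ℝ) => (p.2 i, p.1)) (by fun_prop)
  have hbound : ∀ (η : Path E) (s : Fin k → ℝ),
      |(∏ i, f (η (s i).toNNReal)) * g (η δ)| ≤ ‖f‖ ^ k * ‖g‖ := by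
    intro η s
    rw [abs_mul, Finset.abs_prod]
    gcongr
    · calc ∏ i, |f (η (s i).toNNReal)| ≤ ∏ _i : Fin k, ‖f‖ :=
            Finset.prod_le_prod (fun _ _ => abs_nonneg _) fun i _ => f.norm_coe_le_norm _
        _ = ‖f‖ ^ k := by simp
    · exact g.norm_coe_le_norm _
  have hpow : ∀ η : Path E, runningReward δ f η ^ k * g (η δ) =
      ∫ s, (∏ i, f (η (s i).toNNReal)) * g (η δ) ∂μ := by
    intro η
    have h1 : runningReward δ f η = ∫ s in Set.Ioc (0 : ℝ) δ, f (η s.toNNReal) :=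
      intervalIntegral.integral_of_le δ.2
    have h2 := integral_fintype_prod_eq_pow (ι := Fin k) (fun s : ℝ => f (η s.toNNReal))
      (μ := volume.restrict (Set.Ioc (0 : ℝ) δ))
    rw [Fintype.card_fin] at h2
    rw [integral_mul_const, h1, ← h2]
  have hswap : ∀ x, ∫ η, runningReward δ f η ^ k * g (η δ) ∂(X.law x) =
      ∫ s, ∫ η, (∏ i, f (η (s i).toNNReal)) * g (η δ) ∂(X.law x) ∂μ := by
    intro x
    simp_rw [hpow]
    exact integral_integral_swap (integrable_of_bounded hmeas fun p => hbound p.1 p.2)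
  simp_rw [hswap]
  refine continuous_of_dominated (bound := fun _ => ‖f‖ ^ k * ‖g‖) (fun x => ?_) (fun x => ?_)
    (integrable_const _) (Eventually.of_forall fun s => ?_)
  · exact ((hmeas.comp measurable_swap).stronglyMeasurable.integral_prod_right
      (f := fun (s : Fin k → ℝ) (η : Path E) => (∏ i, f (η (s i).toNNReal)) * g (η δ))
      (ν := X.law x)).aestronglyMeasurable
  · refine Eventually.of_forall fun s => ?_
    have := norm_integral_le_of_norm_le_const (μ := X.law x)
      (f := fun η : Path E => (∏ i, f (η (s i).toNNReal)) * g (η δ)) (C := ‖f‖ ^ k * ‖g‖)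
      (Eventually.of_forall fun η => hbound η s)
    simpa using this
  · have h := continuous_integral_prod X (n := k + 1) (Fin.cons δ fun i => (s i).toNNReal)
      (Fin.cons g fun _ => f)
    refine h.congr fun x => integral_congr_ae (Eventually.of_forall fun η => ?_)
    simp only [Fin.prod_univ_succ, Fin.cons_zero, Fin.cons_succ]
    exact mul_comm _ _

/-- Exponential functionals with bounded coefficients depend continuously on the initial state: the
exponential function is uniformly approximated by polynomials on the range of the running reward. -/
theorem continuous_integral_exp_of_bounded (δ : ℝ≥0) (γ : ℝ) (f g : BoundedContinuousFunction E ℝ) :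
    Continuous fun x => ∫ η, Real.exp (γ * runningReward δ f η) * g (η δ) ∂(X.law x) := by
  have hmF := measurable_runningReward δ f.continuous
  have hmg : Measurable fun η : Path E => g (η δ) :=
    g.continuous.measurable.comp (measurable_eval δ)
  set C := ‖f‖ * δ with hC
  have hFC : ∀ η : Path E, |runningReward δ f η| ≤ C := fun η =>
    abs_runningReward_le_of_bounded δ (fun x => f.norm_coe_le_norm x) η
  refine continuous_of_uniform_approx_of_continuous fun u hu => ?_
  obtain ⟨ε, hε, hεu⟩ := Metric.mem_uniformity_dist.1 hu
  have hg1 : 0 < ‖g‖ + 1 := by positivity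
  obtain ⟨p, hp⟩ := exists_polynomial_near_of_continuousOn (-C) C (fun r => Real.exp (γ * r))
    (by fun_prop) (ε / (2 * (‖g‖ + 1))) (by positivity)
  refine ⟨fun x => ∫ η, p.eval (runningReward δ f η) * g (η δ) ∂(X.law x), ?_, fun x => hεu ?_⟩
  · have hint : ∀ x, ∀ k ∈ p.support, Integrable (fun η : Path E =>
        p.coeff k * (runningReward δ f η ^ k * g (η δ))) (X.law x) := by
      intro x k _
      refine Integrable.const_mul ?_ _
      refine integrable_of_bounded (C := C ^ k * ‖g‖) ((hmF.pow_const k).mul hmg) fun η => ?_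
      rw [abs_mul, abs_pow]
      gcongr
      · exact hFC η
      · exact g.norm_coe_le_norm _
    have e : (fun x => ∫ η, p.eval (runningReward δ f η) * g (η δ) ∂(X.law x)) = fun x =>
        ∑ k ∈ p.support, p.coeff k * ∫ η, runningReward δ f η ^ k * g (η δ) ∂(X.law x) := by
      funext x
      simp_rw [← integral_const_mul]
      rw [← integral_finsetSum _ (hint x)]
      refine integral_congr_ae (Eventually.of_forall fun η => ?_)
      simp only [Polynomial.eval_eq_sum, Polynomial.sum, Finset.sum_mul, mul_assoc]
    rw [e]
    exact continuous_finsetSum _ fun k _ =>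
      (continuous_integral_runningReward_pow X δ f g k).const_mul _
  · have hpt : ∀ η : Path E, |Real.exp (γ * runningReward δ f η) * g (η δ) -
        p.eval (runningReward δ f η) * g (η δ)| ≤ ε / 2 := by
      intro η
      rw [← sub_mul, abs_mul, abs_sub_comm]
      have h1 := (hp _ (abs_le.1 (hFC η))).le
      have h2 : |g (η δ)| ≤ ‖g‖ + 1 := (g.norm_coe_le_norm _).trans (by linarith)
      calc _ ≤ ε / (2 * (‖g‖ + 1)) * (‖g‖ + 1) := by gcongr
        _ = ε / 2 := by field_simp
    have hpm : Measurable fun η : Path E => p.eval (runningReward δ f η) * g (η δ) :=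
      (p.continuous.measurable.comp hmF).mul hmg
    have hem : Measurable fun η : Path E => Real.exp (γ * runningReward δ f η) * g (η δ) :=
      ((hmF.const_mul γ).exp).mul hmg
    have hei : Integrable (fun η : Path E => Real.exp (γ * runningReward δ f η) * g (η δ))
        (X.law x) := by
      refine integrable_of_bounded (C := Real.exp (|γ| * C) * ‖g‖) hem fun η => ?_
      rw [abs_mul, abs_of_pos (Real.exp_pos _)]
      have h1 : γ * runningReward δ f η ≤ |γ| * C := by
        refine (le_abs_self _).trans ?_
        rw [abs_mul]
        exact mul_le_mul_of_nonneg_left (hFC η) (abs_nonneg _)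
      have h2 : |g (η δ)| ≤ ‖g‖ := g.norm_coe_le_norm _
      exact mul_le_mul (Real.exp_le_exp.2 h1) h2 (abs_nonneg _) (Real.exp_pos _).le
    have hpi : Integrable (fun η : Path E => p.eval (runningReward δ f η) * g (η δ)) (X.law x) := by
      have := hei.sub (integrable_of_bounded (hem.sub hpm) hpt)
      simpa using this
    rw [Real.dist_eq, ← integral_sub hei hpi]
    have := norm_integral_le_of_norm_le_const (μ := X.law x)
      (f := fun η : Path E => Real.exp (γ * runningReward δ f η) * g (η δ) -
        p.eval (runningReward δ f η) * g (η δ)) (Eventually.of_forall hpt)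
    simp only [probReal_univ, mul_one, Real.norm_eq_abs] at this
    linarith

end Semigroup

/-! ### Compact containment under the `C₀`-Feller property -/

section Containment

variable {E : Type*} [NormedAddCommGroup E] [ProperSpace E] [MeasurableSpace E] [BorelSpace E]
  (X : FellerMarkovProcess E)

omit [MeasurableSpace E] [BorelSpace E] in
theorem isCountablyGenerated_cocompact : (cocompact E).IsCountablyGenerated := by
  rw [← Metric.cobounded_eq_cocompact, ← comap_norm_atTop]
  infer_instance

/-- A strictly positive function that vanishes at infinity. -/
def decay (E : Type*) [NormedAddCommGroup E] [ProperSpace E] : ZeroAtInftyContinuousMap E ℝ where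
  toFun x := (1 + ‖x‖)⁻¹
  continuous_toFun := (continuous_const.add continuous_norm).inv₀ fun x =>
    (by positivity : (0 : ℝ) < 1 + ‖x‖).ne'
  zero_at_infty' := by
    have : Tendsto (fun x : E => ‖x‖) (cocompact E) atTop := tendsto_norm_cocompact_atTop
    exact (tendsto_atTop_add_const_left _ 1 this).inv_tendsto_atTop

omit [MeasurableSpace E] [BorelSpace E] in
theorem decay_pos (x : E) : 0 < decay E x := by
  change (0 : ℝ) < (1 + ‖x‖)⁻¹
  positivity

omit [MeasurableSpace E] [BorelSpace E] in
theorem decay_le_one (x : E) : decay E x ≤ 1 := by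
  change (1 + ‖x‖)⁻¹ ≤ (1 : ℝ)
  exact inv_le_one_of_one_le₀ (by linarith [norm_nonneg x])

omit [MeasurableSpace E] [BorelSpace E] in
theorem abs_decay_le (x : E) : |decay E x| ≤ 1 := by
  rw [abs_of_pos (decay_pos x)]
  exact decay_le_one x

omit [MeasurableSpace E] [BorelSpace E] in
theorem continuous_decay : Continuous (decay E) := (decay E).continuous

/-- The resolvent `∫₀^∞ e^{-t} P_t φ(x) dt` of a positive function `φ` vanishing at infinity. The
process `e^{-t} u(X_t)` with `u` the resolvent is a supermartingale. -/
def resolvent (x : E) : ℝ :=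
  ∫ t in Set.Ioi (0 : ℝ), Real.exp (-t) * semigroup X t.toNNReal (decay E) x

theorem measurable_semigroup_uncurry :
    Measurable fun p : ℝ × E => semigroup X p.1.toNNReal (decay E) p.2 := by
  have hm : Measurable fun q : (ℝ × E) × Path E => decay E (q.2 q.1.1.toNNReal) :=
    (measurable_comp_eval_toNNReal continuous_decay).comp
      (f := fun q : (ℝ × E) × Path E => (q.1.1, q.2)) (by fun_prop)
  exact (hm.stronglyMeasurable.integral_kernel_prod_right'
    (κ := X.law.comap (Prod.snd : ℝ × E → E) measurable_snd)).measurable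

theorem semigroup_decay_pos (t : ℝ≥0) (x : E) : 0 < semigroup X t (decay E) x := by
  have hi : Integrable (fun η : Path E => decay E (η t)) (X.law x) :=
    integrable_of_bounded (continuous_decay.measurable.comp (measurable_eval t))
      fun η => abs_decay_le _
  rw [semigroup, integral_pos_iff_support_of_nonneg (fun η => (decay_pos _).le) hi]
  have : Function.support (fun η : Path E => decay E (η t)) = Set.univ := by
    ext η
    simp [(decay_pos (η t)).ne']
  rw [this]
  simp

theorem integrable_exp_neg_Ioi :
    Integrable (fun t : ℝ => Real.exp (-t)) (volume.restrict (Set.Ioi 0)) :=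
  integrableOn_exp_neg_Ioi 0

omit [BorelSpace E] in
theorem norm_resolvent_integrand_le (t : ℝ) (x : E) :
    ‖Real.exp (-t) * semigroup X t.toNNReal (decay E) x‖ ≤ Real.exp (-t) := by
  rw [norm_mul, Real.norm_eq_abs, Real.norm_eq_abs, abs_of_pos (Real.exp_pos _)]
  have := abs_semigroup_le X t.toNNReal (abs_decay_le (E := E)) x
  nlinarith [Real.exp_pos (-t)]

theorem measurable_resolvent_integrand :
    Measurable fun p : ℝ × E => Real.exp (-p.1) * semigroup X p.1.toNNReal (decay E) p.2 := by
  have := measurable_semigroup_uncurry X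
  fun_prop

theorem integrable_resolvent_integrand (x : E) :
    Integrable (fun t : ℝ => Real.exp (-t) * semigroup X t.toNNReal (decay E) x)
      (volume.restrict (Set.Ioi 0)) :=
  integrable_exp_neg_Ioi.mono'
    ((measurable_resolvent_integrand X).comp (f := fun t : ℝ => (t, x))
      (by fun_prop)).aestronglyMeasurable
    (Eventually.of_forall fun t => norm_resolvent_integrand_le X t x)

theorem resolvent_pos (x : E) : 0 < resolvent X x := by
  rw [resolvent, integral_pos_iff_support_of_nonneg
    (fun t => mul_nonneg (Real.exp_pos _).le (semigroup_decay_pos X _ x).le)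
    (integrable_resolvent_integrand X x)]
  have : Function.support (fun t : ℝ => Real.exp (-t) * semigroup X t.toNNReal (decay E) x) =
      Set.univ := by
    ext t
    simp [(semigroup_decay_pos X t.toNNReal x).ne', (Real.exp_pos (-t)).ne']
  rw [this]
  simp

theorem continuous_resolvent (hX : X.IsC0Feller) : Continuous (resolvent X) := by
  refine continuous_of_dominated (bound := fun t => Real.exp (-t)) (fun x => ?_) (fun x => ?_)
    integrable_exp_neg_Ioi (Eventually.of_forall fun t => ?_)
  · exact (integrable_resolvent_integrand X x).aestronglyMeasurable
  · exact Eventually.of_forall fun t => norm_resolvent_integrand_le X t x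
  · exact (hX t.toNNReal (decay E)).1.const_mul _

theorem tendsto_resolvent (hX : X.IsC0Feller) :
    Tendsto (resolvent X) (cocompact E) (𝓝 0) := by
  have := isCountablyGenerated_cocompact (E := E)
  have h := tendsto_integral_filter_of_dominated_convergence
    (μ := volume.restrict (Set.Ioi (0 : ℝ))) (l := cocompact E)
    (F := fun (x : E) (t : ℝ) => Real.exp (-t) * semigroup X t.toNNReal (decay E) x)
    (f := fun _ => 0) (fun t => Real.exp (-t))
    (Eventually.of_forall fun x => (integrable_resolvent_integrand X x).aestronglyMeasurable)
    (Eventually.of_forall fun x => Eventually.of_forall fun t => norm_resolvent_integrand_le X t x)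
    integrable_exp_neg_Ioi (Eventually.of_forall fun t => by
      have := ((hX t.toNNReal (decay E)).2).const_mul (Real.exp (-t))
      rwa [mul_zero] at this)
  simpa using! h

theorem measurable_resolvent : Measurable (resolvent X) :=
  ((measurable_resolvent_integrand X).comp measurable_swap).stronglyMeasurable.integral_prod_right
    (f := fun (x : E) (t : ℝ) => Real.exp (-t) * semigroup X t.toNNReal (decay E) x)
    (ν := volume.restrict (Set.Ioi (0 : ℝ))) |>.measurable

omit [BorelSpace E] in
theorem abs_resolvent_le (x : E) : |resolvent X x| ≤ ∫ t in Set.Ioi (0 : ℝ), Real.exp (-t) :=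
  norm_integral_le_of_norm_le integrable_exp_neg_Ioi
    (Eventually.of_forall fun t => norm_resolvent_integrand_le X t x)

omit [BorelSpace E] [ProperSpace E] in
theorem semigroup_semigroup (s t : ℝ≥0) {g : E → ℝ} (hg : Measurable g) {C : ℝ}
    (hC : ∀ x, |g x| ≤ C) (x : E) :
    ∫ η, semigroup X t g (η s) ∂(X.law x) = semigroup X (s + t) g x := by
  have := setIntegral_markov X x s t hg hC (B := Set.univ) MeasurableSet.univ
  simpa using! this

/-- The supermartingale property of the discounted resolvent, in the form `P_s u ≤ e^s u`. -/
theorem integral_resolvent_le (s : ℝ≥0) (x : E) :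
    ∫ η, resolvent X (η s) ∂(X.law x) ≤ Real.exp s * resolvent X x := by
  have hm : Measurable fun p : Path E × ℝ =>
      Real.exp (-p.2) * semigroup X p.2.toNNReal (decay E) (p.1 s) :=
    (measurable_resolvent_integrand X).comp (f := fun p : Path E × ℝ => (p.2, p.1 s))
      (measurable_snd.prodMk ((measurable_eval s).comp measurable_fst))
  have hint : Integrable (fun p : Path E × ℝ =>
      Real.exp (-p.2) * semigroup X p.2.toNNReal (decay E) (p.1 s))
      ((X.law x).prod (volume.restrict (Set.Ioi 0))) := by
    refine Integrable.mono' (g := fun p => 1 * Real.exp (-p.2))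
      ((integrable_const (1 : ℝ)).mul_prod integrable_exp_neg_Ioi) hm.aestronglyMeasurable ?_
    refine Eventually.of_forall fun p => ?_
    rw [one_mul]
    exact norm_resolvent_integrand_le X _ _
  have h1 : ∫ η, resolvent X (η s) ∂(X.law x) =
      ∫ t in Set.Ioi (0 : ℝ), Real.exp (-t) * semigroup X (s + t.toNNReal) (decay E) x := by
    unfold resolvent
    rw [integral_integral_swap (f := fun (η : Path E) (t : ℝ) =>
      Real.exp (-t) * semigroup X t.toNNReal (decay E) (η s)) hint]
    refine integral_congr_ae (Eventually.of_forall fun t => ?_)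
    dsimp only
    rw [integral_const_mul, semigroup_semigroup X s _ continuous_decay.measurable
      (abs_decay_le (E := E))]
  -- shift the time variable by `s`
  have h2 : ∫ t in Set.Ioi (0 : ℝ), Real.exp (-t) * semigroup X (s + t.toNNReal) (decay E) x =
      Real.exp s * ∫ t in Set.Ioi (s : ℝ), Real.exp (-t) * semigroup X t.toNNReal (decay E) x := by
    rw [← integral_const_mul, ← integral_indicator measurableSet_Ioi,
      ← integral_indicator measurableSet_Ioi,
      ← integral_add_right_eq_self (μ := (volume : Measure ℝ)) (Set.indicator (Set.Ioi (s : ℝ)) _)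
        (s : ℝ)]
    refine integral_congr_ae (Eventually.of_forall fun t => ?_)
    by_cases ht : 0 < t
    · have ht' : t + s ∈ Set.Ioi (s : ℝ) := by simpa using ht
      have e : (t + s).toNNReal = s + t.toNNReal := by
        rw [Real.toNNReal_add ht.le s.coe_nonneg, Real.toNNReal_coe, add_comm]
      simp only [Set.indicator_of_mem (show t ∈ Set.Ioi (0 : ℝ) from ht),
        Set.indicator_of_mem ht', e]
      rw [← mul_assoc, ← Real.exp_add]
      congr 2
      ring
    · have ht' : t + s ∉ Set.Ioi (s : ℝ) := by simpa using ht
      simp only [Set.indicator_of_notMem (show t ∉ Set.Ioi (0 : ℝ) from ht),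
        Set.indicator_of_notMem ht']
  rw [h1, h2]
  gcongr
  refine setIntegral_mono_set (integrable_resolvent_integrand X x) ?_
    (Set.Ioi_subset_Ioi s.2).eventuallyLE
  exact Eventually.of_forall fun t =>
    mul_nonneg (Real.exp_pos _).le (semigroup_decay_pos X _ x).le

/-- A process started where the resolvent is small is unlikely to reach the region where it is
large. -/
theorem law_resolvent_ge_le {s δ : ℝ≥0} (hs : s ≤ δ) {a r : ℝ} (hr : 0 < r) {x : E}
    (hx : resolvent X x ≤ a) :
    X.law x {η | r ≤ resolvent X (η s)} ≤ ENNReal.ofReal (Real.exp δ * a / r) := by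
  have hi : Integrable (fun η : Path E => resolvent X (η s)) (X.law x) :=
    integrable_of_bounded ((measurable_resolvent X).comp (measurable_eval s))
      fun η => abs_resolvent_le X _
  have h1 := mul_meas_ge_le_integral_of_nonneg (Eventually.of_forall fun η : Path E =>
    (resolvent_pos X (η s)).le) hi r
  have h2 : (X.law x).real {η | r ≤ resolvent X (η s)} ≤ Real.exp δ * a / r := by
    rw [le_div_iff₀ hr, mul_comm]
    refine h1.trans ((integral_resolvent_le X s x).trans ?_)
    have : (s : ℝ) ≤ δ := hs
    have := (resolvent_pos X x).le
    gcongr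
  rw [← ofReal_measureReal]
  exact ENNReal.ofReal_le_ofReal h2

/-- Paths for which the resolvent is below `a` at one of the times `t 0, …, t (n - 1)`. -/
def visitsBelow (a : ℝ) (t : ℕ → ℝ≥0) (n : ℕ) : Set (Path E) :=
  ⋃ i ∈ Finset.range n, {η | resolvent X (η (t i)) < a}

theorem measurableSet_visitsBelow_pathHistory {a : ℝ} {t : ℕ → ℝ≥0} {n : ℕ} {s : ℝ≥0}
    (ht : ∀ i < n, t i ≤ s) : MeasurableSet[pathHistory E s] (visitsBelow X a t n) := by
  refine Finset.measurableSet_biUnion _ fun i hi => ?_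
  exact (measurable_resolvent X).comp
    (measurable_eval_pathHistory (ht i (Finset.mem_range.1 hi))) measurableSet_Iio

theorem measurableSet_visitsBelow (a : ℝ) (t : ℕ → ℝ≥0) (n : ℕ) :
    MeasurableSet (visitsBelow X a t n) :=
  Finset.measurableSet_biUnion _ fun i _ =>
    (measurable_resolvent X).comp (measurable_eval (t i)) measurableSet_Iio

/-- The maximal inequality on a finite time grid, by decomposing according to the first visit. -/
theorem law_visitsBelow_inter_le {δ : ℝ≥0} {a r : ℝ} (hr : 0 < r) (x : E) {t : ℕ → ℝ≥0}
    (ht : Monotone t) (n : ℕ) (hδ : ∀ i < n, t i ≤ δ) :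
    X.law x (visitsBelow X a t n ∩ {η | r ≤ resolvent X (η δ)}) ≤
      ENNReal.ofReal (Real.exp δ * a / r) * X.law x (visitsBelow X a t n) := by
  induction n with
  | zero => simp [visitsBelow]
  | succ n ih =>
    set G : Set (Path E) := {η | r ≤ resolvent X (η δ)} with hG
    set q := ENNReal.ofReal (Real.exp δ * a / r) with hq
    set s := t n with hs
    have hsδ : s ≤ δ := hδ n (Nat.lt_succ_self n)
    have hA : visitsBelow X a t (n + 1) = visitsBelow X a t n ∪ {η | resolvent X (η s) < a} := by
      rw [visitsBelow, Finset.range_add_one, Finset.set_biUnion_insert, Set.union_comm]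
      rfl
    set D : Set (Path E) := {η | resolvent X (η s) < a} \ visitsBelow X a t n with hD
    have hAD : visitsBelow X a t (n + 1) = visitsBelow X a t n ∪ D := by
      rw [hA, hD, Set.union_sdiff_self]
    have hDm : MeasurableSet[pathHistory E s] D :=
      ((measurable_resolvent X).comp (measurable_eval_pathHistory le_rfl) measurableSet_Iio).diff
        (measurableSet_visitsBelow_pathHistory X fun i hi => ht hi.le)
    have hDG : X.law x (D ∩ G) ≤ q * X.law x D := by
      have hmk := X.markov x s (δ - s) {y | r ≤ resolvent X y}
        (measurable_resolvent X measurableSet_Ici) D hDm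
      rw [add_tsub_cancel_of_le hsδ] at hmk
      refine hmk.le.trans ?_
      rw [← setLIntegral_const]
      refine setLIntegral_mono_ae' (pathHistory_le s D hDm) (Eventually.of_forall fun η hη => ?_)
      exact law_resolvent_ge_le X tsub_le_self hr (le_of_lt hη.1)
    have hdisj : Disjoint (visitsBelow X a t n) D := Set.disjoint_sdiff_right
    rw [hAD, Set.union_inter_distrib_right,
      measure_union hdisj (pathHistory_le s D hDm), mul_add]
    exact (measure_union_le _ _).trans
      (add_le_add (ih fun i hi => hδ i (hi.trans (Nat.lt_succ_self n))) hDG)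

/-- The dyadic grid of mesh `δ / 2 ^ n`. -/
def dyadicGrid (δ : ℝ≥0) (n i : ℕ) : ℝ≥0 := i * (δ / 2 ^ n)

theorem dyadicGrid_mono (δ : ℝ≥0) (n : ℕ) : Monotone (dyadicGrid δ n) := by
  intro i j hij
  unfold dyadicGrid
  gcongr

theorem dyadicGrid_le {δ : ℝ≥0} {n i : ℕ} (hi : i < 2 ^ n + 1) : dyadicGrid δ n i ≤ δ := by
  have h : (i : ℝ≥0) ≤ 2 ^ n := by exact_mod_cast Nat.lt_succ_iff.1 hi
  calc (i : ℝ≥0) * (δ / 2 ^ n) ≤ 2 ^ n * (δ / 2 ^ n) := by gcongr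
    _ = δ := by field_simp

theorem dyadicGrid_succ (δ : ℝ≥0) (n i : ℕ) : dyadicGrid δ (n + 1) (2 * i) = dyadicGrid δ n i := by
  unfold dyadicGrid
  push_cast
  rw [pow_succ]
  field_simp

/-- Paths for which the resolvent is below `a` at a dyadic time in `[0, δ]`. -/
def leavesRegion (δ : ℝ≥0) (a : ℝ) : Set (Path E) :=
  ⋃ n, visitsBelow X a (dyadicGrid δ n) (2 ^ n + 1)

theorem measurableSet_leavesRegion (δ : ℝ≥0) (a : ℝ) : MeasurableSet (leavesRegion X δ a) :=
  MeasurableSet.iUnion fun _ => measurableSet_visitsBelow X a _ _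

omit [BorelSpace E] in
theorem monotone_visitsBelow_dyadic (δ : ℝ≥0) (a : ℝ) :
    Monotone fun n => visitsBelow X a (dyadicGrid δ n) (2 ^ n + 1) := by
  refine monotone_nat_of_le_succ fun n η hη => ?_
  obtain ⟨i, hi, h⟩ := Set.mem_iUnion₂.1 hη
  have hi' := Finset.mem_range.1 hi
  refine Set.mem_iUnion₂.2 ⟨2 * i, Finset.mem_range.2 (by rw [pow_succ]; omega), ?_⟩
  rwa [Set.mem_ofPred_eq, dyadicGrid_succ]

/-- By right continuity it suffices to look at dyadic times. -/
theorem mem_leavesRegion (hX : X.IsC0Feller) {δ : ℝ≥0} (hδ : 0 < δ) {a : ℝ} {η : Path E} {s : ℝ≥0}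
    (hs : s ≤ δ) (h : resolvent X (η s) < a) : η ∈ leavesRegion X δ a := by
  have hδn : ∀ n : ℕ, 0 < δ / 2 ^ n := fun n => by positivity
  set i : ℕ → ℕ := fun n => ⌈s / (δ / 2 ^ n)⌉₊ with hi
  have h1 : ∀ n, s ≤ dyadicGrid δ n (i n) := by
    intro n
    have := Nat.le_ceil (s / (δ / 2 ^ n))
    rwa [div_le_iff₀ (hδn n)] at this
  have h2 : ∀ n, dyadicGrid δ n (i n) ≤ s + δ * (1 / 2) ^ n := by
    intro n
    have := (Nat.ceil_lt_add_one (a := s / (δ / 2 ^ n)) zero_le).le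
    calc dyadicGrid δ n (i n) ≤ (s / (δ / 2 ^ n) + 1) * (δ / 2 ^ n) := by
          unfold dyadicGrid
          gcongr
      _ = s + δ * (1 / 2) ^ n := by
          rw [add_mul, div_mul_cancel₀ _ (hδn n).ne', one_mul, one_div, inv_pow, div_eq_mul_inv]
  have h3 : ∀ n, i n < 2 ^ n + 1 := by
    intro n
    rw [Nat.lt_succ_iff, hi]
    refine Nat.ceil_le.2 ?_
    rw [div_le_iff₀ (hδn n)]
    push_cast
    calc s ≤ δ := hs
      _ = 2 ^ n * (δ / 2 ^ n) := by field_simp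
  have hlim : Tendsto (fun n => dyadicGrid δ n (i n)) atTop (𝓝[≥] s) := by
    refine tendsto_nhdsWithin_iff.2 ⟨?_, Eventually.of_forall h1⟩
    have h4 : Tendsto (fun n : ℕ => s + δ * (1 / 2 : ℝ≥0) ^ n) atTop (𝓝 (s + δ * 0)) :=
      tendsto_const_nhds.add ((tendsto_pow_atTop_nhds_zero_of_lt_one zero_le (by
        rw [div_lt_one (by norm_num)]; norm_num)).const_mul _)
    rw [mul_zero, add_zero] at h4
    exact tendsto_of_tendsto_of_tendsto_of_le_of_le tendsto_const_nhds h4 h1 h2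
  have hcad := ((η.2.comp_continuous (continuous_resolvent X hX) s).1.tendsto).comp hlim
  obtain ⟨n, hn⟩ := (hcad.eventually (Iio_mem_nhds h)).exists
  exact Set.mem_iUnion.2 ⟨n, Set.mem_iUnion₂.2 ⟨i n, Finset.mem_range.2 (h3 n), hn⟩⟩

/-- A path that leaves the region where the resolvent is at least `a` is unlikely to be found where
it is at least `r` at time `δ`. -/
theorem law_leavesRegion_inter_le {δ : ℝ≥0} {a r : ℝ} (hr : 0 < r) (x : E) :
    X.law x (leavesRegion X δ a ∩ {η | r ≤ resolvent X (η δ)}) ≤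
      ENNReal.ofReal (Real.exp δ * a / r) := by
  have hmono : Monotone fun n => visitsBelow X a (dyadicGrid δ n) (2 ^ n + 1) ∩
      {η | r ≤ resolvent X (η δ)} := fun m n hmn =>
    Set.inter_subset_inter_left _ (monotone_visitsBelow_dyadic X δ a hmn)
  rw [leavesRegion, Set.iUnion_inter, hmono.measure_iUnion]
  refine iSup_le fun n => (law_visitsBelow_inter_le X hr x (dyadicGrid_mono δ n) (2 ^ n + 1)
    fun i hi => dyadicGrid_le hi).trans ?_
  calc _ ≤ ENNReal.ofReal (Real.exp δ * a / r) * 1 := by gcongr; exact prob_le_one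
    _ = _ := mul_one _

/-- Started near `x₀`, the position at time `δ` lies in a common compact set with high probability,
by the Feller property applied to a continuous cut-off of the set where the resolvent is large. -/
theorem eventually_law_resolvent_lt (hX : X.IsC0Feller) (δ : ℝ≥0) (x₀ : E) {ε : ℝ} (hε : 0 < ε) :
    ∃ r > 0, ∀ᶠ x in 𝓝 x₀, (X.law x).real {η | resolvent X (η δ) < r} ≤ ε := by
  have hu := continuous_resolvent X hX
  have hcont : ∀ n : ℕ, Continuous fun y : E => min 1 ((n + 1) * resolvent X y) := fun n => by
    fun_prop
  have hb : ∀ (n : ℕ) (y : E), |min 1 ((n + 1) * resolvent X y)| ≤ 1 := by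
    intro n y
    have := resolvent_pos X y
    rw [abs_of_nonneg (by positivity)]
    exact min_le_left _ _
  have hlim : Tendsto (fun n : ℕ => ∫ η, min 1 ((n + 1) * resolvent X (η δ)) ∂(X.law x₀)) atTop
      (𝓝 (∫ _η, (1 : ℝ) ∂(X.law x₀))) := by
    refine tendsto_integral_of_dominated_convergence (fun _ => 1) (fun n => ?_)
      (integrable_const _) (fun n => Eventually.of_forall fun η => hb n _)
      (Eventually.of_forall fun η => ?_)
    · exact ((hcont n).measurable.comp (measurable_eval δ)).aestronglyMeasurable
    · have hp := resolvent_pos X (η δ)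
      have h1 : Tendsto (fun n : ℕ => ((n : ℝ) + 1) * resolvent X (η δ)) atTop atTop :=
        (tendsto_atTop_add_const_right _ 1 tendsto_natCast_atTop_atTop).atTop_mul_const hp
      refine tendsto_const_nhds.congr' ?_
      filter_upwards [h1.eventually_ge_atTop 1] with n hn
      exact (min_eq_left hn).symm
  simp only [integral_const, probReal_univ, smul_eq_mul, mul_one] at hlim
  obtain ⟨n, hn⟩ := (hlim.eventually (Ioi_mem_nhds (by linarith : 1 - ε / 2 < 1))).exists
  set g : BoundedContinuousFunction E ℝ := BoundedContinuousFunction.ofNormedAddCommGroup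
    (fun y : E => min 1 ((n + 1) * resolvent X y)) (hcont n) 1 (hb n) with hg
  have hev := ((X.feller δ g).tendsto x₀).eventually (Ioi_mem_nhds hn)
  refine ⟨1 / (2 * (n + 1)), by positivity, ?_⟩
  filter_upwards [hev] with x hx
  have hxi : Integrable (fun η : Path E => min 1 ((n + 1) * resolvent X (η δ))) (X.law x) :=
    integrable_of_bounded ((hcont n).measurable.comp (measurable_eval δ)) fun η => hb n _
  have hx' : 1 - ε / 2 < ∫ η, min 1 ((n + 1) * resolvent X (η δ)) ∂(X.law x) := hx
  have hM := mul_meas_ge_le_integral_of_nonneg (μ := X.law x)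
    (f := fun η : Path E => 1 - min 1 ((n + 1) * resolvent X (η δ)))
    (Eventually.of_forall fun η => sub_nonneg.2 (min_le_left _ _))
    ((integrable_const _).sub hxi) (1 / 2)
  rw [integral_sub (integrable_const _) hxi] at hM
  simp only [integral_const, probReal_univ, smul_eq_mul, mul_one] at hM
  have hsub : {η : Path E | resolvent X (η δ) < 1 / (2 * (n + 1))} ⊆
      {η | 1 / 2 ≤ 1 - min 1 ((n + 1) * resolvent X (η δ))} := by
    intro η hη
    have h1 : ((n : ℝ) + 1) * resolvent X (η δ) ≤ 1 / 2 := by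
      have : resolvent X (η δ) ≤ 1 / (2 * (n + 1)) := le_of_lt hη
      calc ((n : ℝ) + 1) * resolvent X (η δ) ≤ (n + 1) * (1 / (2 * (n + 1))) := by gcongr
        _ = 1 / 2 := by field_simp
    have h2 := min_le_right (1 : ℝ) ((n + 1) * resolvent X (η δ))
    change (1 : ℝ) / 2 ≤ 1 - min 1 ((n + 1) * resolvent X (η δ))
    linarith
  have := measureReal_mono (μ := X.law x) hsub
  linarith

/-- Compact containment: near `x₀`, the whole path up to time `δ` stays, with high probability, in
the common compact set where the resolvent is at least `a`. -/
theorem eventually_law_leavesRegion_le (hX : X.IsC0Feller) (δ : ℝ≥0) (x₀ : E) {ε : ℝ}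
    (hε : 0 < ε) :
    ∃ a > 0, ∀ᶠ x in 𝓝 x₀, (X.law x).real (leavesRegion X δ a) ≤ ε := by
  obtain ⟨r, hr, hev⟩ := eventually_law_resolvent_lt X hX δ x₀ (half_pos hε)
  refine ⟨ε / 2 * r / Real.exp δ, by positivity, hev.mono fun x hx => ?_⟩
  set a := ε / 2 * r / Real.exp δ with ha
  have h1 : (X.law x).real (leavesRegion X δ a ∩ {η | r ≤ resolvent X (η δ)}) ≤ ε / 2 := by
    have := law_leavesRegion_inter_le X (δ := δ) (a := a) hr x
    have e : Real.exp δ * a / r = ε / 2 := by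
      rw [ha]; field_simp
    rw [e] at this
    exact ENNReal.toReal_le_of_le_ofReal (by positivity) this
  have hsub : leavesRegion X δ a ⊆ (leavesRegion X δ a ∩ {η | r ≤ resolvent X (η δ)}) ∪
      {η | resolvent X (η δ) < r} := by
    intro η hη
    by_cases h : r ≤ resolvent X (η δ)
    · exact Or.inl ⟨hη, h⟩
    · exact Or.inr (not_le.1 h)
  have := (measureReal_mono (μ := X.law x) hsub).trans (measureReal_union_le _ _)
  linarith

theorem isCompact_resolvent_ge (hX : X.IsC0Feller) {a : ℝ} (ha : 0 < a) :
    IsCompact {y : E | a ≤ resolvent X y} := by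
  have h := (tendsto_resolvent X hX).eventually (Iio_mem_nhds ha)
  obtain ⟨K, hK, hKa⟩ := mem_cocompact.1 h
  refine hK.of_isClosed_subset (isClosed_le continuous_const (continuous_resolvent X hX)) ?_
  intro y hy
  by_contra hyK
  exact absurd (show resolvent X y < a from hKa hyK) (not_lt.2 hy)

/-! ### Continuity of the one-period operator -/

/-- Truncation of a continuous function at level `N`. -/
def truncate {f : E → ℝ} (hf : Continuous f) {N : ℝ} (hN : 0 ≤ N) : BoundedContinuousFunction E ℝ :=
  BoundedContinuousFunction.ofNormedAddCommGroup (fun y => max (-N) (min N (f y)))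
    (by fun_prop) N fun y => abs_le.2 ⟨le_max_left _ _, max_le (by linarith) (min_le_left _ _)⟩

omit [ProperSpace E] [MeasurableSpace E] [BorelSpace E] in
theorem truncate_eq {f : E → ℝ} (hf : Continuous f) {N : ℝ} (hN : 0 ≤ N) {y : E} (h : |f y| ≤ N) :
    truncate hf hN y = f y := by
  change max (-N) (min N (f y)) = f y
  rw [min_eq_right (abs_le.1 h).2, max_eq_right (abs_le.1 h).1]

omit [ProperSpace E] [MeasurableSpace E] [BorelSpace E] in
theorem abs_truncate_le {f : E → ℝ} (hf : Continuous f) {N : ℝ} (hN : 0 ≤ N) (y : E) :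
    |truncate hf hN y| ≤ |f y| := by
  change |max (-N) (min N (f y))| ≤ |f y|
  rw [abs_le]
  have h0 := abs_nonneg (f y)
  constructor
  · rcases le_total 0 (f y) with h | h
    · exact le_max_of_le_right (le_min (by linarith) (by linarith))
    · exact le_max_of_le_right (le_min (by linarith) (neg_abs_le _))
  · exact max_le (by linarith) ((min_le_right _ _).trans (le_abs_self _))

omit [ProperSpace E] [MeasurableSpace E] [BorelSpace E] in
theorem runningReward_congr {δ : ℝ≥0} {f g : E → ℝ} {η : Path E}
    (h : ∀ s ≤ δ, f (η s) = g (η s)) : runningReward δ f η = runningReward δ g η := by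
  unfold runningReward
  refine intervalIntegral.integral_congr fun s hs => ?_
  rw [Set.uIcc_of_le δ.coe_nonneg] at hs
  refine h _ ?_
  rw [← NNReal.coe_le_coe, Real.coe_toNNReal _ hs.1]
  exact hs.2

/-- Exponential functionals with coefficients of linear growth in the weight depend continuously on
the initial state: by compact containment they are locally uniform limits of functionals with
truncated coefficients. -/
theorem RewardData.continuous_integral_exp {X : FellerMarkovProcess E} {δ : ℝ≥0} {ω : E → ℝ}
    {b : ℝ} {M : ℝ → ℝ} {f : E → ℝ} {K γ A : ℝ} {g : E → ℝ} (hD : RewardData X δ ω b M f K γ)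
    (hX : X.IsC0Feller) (hδ : 0 < δ) (hgc : Continuous g) (hg : GrowthBound ω A g) (hA : 0 < A) :
    Continuous fun x => ∫ η, Real.exp (γ * payoff δ f g η) ∂(X.law x) := by
  refine continuous_of_locally_uniform_approx_of_continuousAt fun x₀ u hu => ?_
  obtain ⟨ε, hε, hεu⟩ := Metric.mem_uniformity_dist.1 hu
  have hfc := hD.reward_continuous
  set p := RewardData.exponentGrowth δ K γ A with hp
  have hp0 : 0 < p := hD.exponentGrowth_pos hA
  -- a local bound for the second exponential moment
  set L := Real.exp (2 * p * (1 + 2 * (ω x₀ + 1) + 2 * M (2 * (2 * p)))) with hL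
  have hL0 : 0 < L := Real.exp_pos _
  set t := ε / (4 * L) with ht
  have ht0 : 0 < t := by positivity
  obtain ⟨a, ha, hev⟩ := eventually_law_leavesRegion_le X hX δ x₀ (ε := t * (ε / 4)) (by positivity)
  have hωev : ∀ᶠ x in 𝓝 x₀, ω x ≤ ω x₀ + 1 :=
    (hD.continuous.tendsto x₀).eventually (Iic_mem_nhds (by linarith))
  have hcomp := isCompact_resolvent_ge X hX ha
  obtain ⟨N₁, hN₁⟩ := hcomp.bddAbove_image hfc.abs.continuousOn
  obtain ⟨N₂, hN₂⟩ := hcomp.bddAbove_image hgc.abs.continuousOn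
  set N := max 0 (max N₁ N₂) with hN
  have hN0 : 0 ≤ N := le_max_left _ _
  set fN := truncate hfc hN0 with hfN
  set gN := truncate hgc hN0 with hgN
  have hDN : RewardData X δ ω b M fN K γ :=
    ⟨hD.toExpLyapunov, fN.continuous,
      fun y => (abs_truncate_le hfc hN0 y).trans (hD.reward_bound y), hD.growth_nonneg, hD.risk_neg⟩
  have hgNb : GrowthBound ω A gN :=
    ⟨gN.continuous.measurable, fun y => (abs_truncate_le hgc hN0 y).trans (hg.bound y)⟩
  refine ⟨_, hev.and hωev, fun x => ∫ η, Real.exp (γ * payoff δ fN gN η) ∂(X.law x), ?_,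
    fun x hx => hεu ?_⟩
  · set e : BoundedContinuousFunction E ℝ := BoundedContinuousFunction.ofNormedAddCommGroup
      (fun y => Real.exp (γ * gN y)) (by fun_prop) (Real.exp (|γ| * ‖gN‖)) (fun y => by
        rw [Real.norm_eq_abs, abs_of_pos (Real.exp_pos _)]
        refine Real.exp_le_exp.2 ((le_abs_self _).trans ?_)
        rw [abs_mul]
        exact mul_le_mul_of_nonneg_left (gN.norm_coe_le_norm y) (abs_nonneg _)) with he
    refine ((continuous_integral_exp_of_bounded X δ γ fN e).congr fun x => ?_).continuousAt
    refine integral_congr_ae (Eventually.of_forall fun η => ?_)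
    change Real.exp _ * Real.exp (γ * gN (η δ)) = _
    rw [← Real.exp_add, ← mul_add]
    rfl
  · obtain ⟨hx1, hx2⟩ := hx
    have hi1 := hD.integrable_exp_exponent hg x
    have hi2 := hDN.integrable_exp_exponent hgNb x
    have hS := measurableSet_leavesRegion X δ a
    have h2p : 0 < 2 * p := by linarith
    have hE := hD.exp_gauge h2p x
    have hEL : ∫ η, Real.exp (2 * p * gauge δ ω η) ∂(X.law x) ≤ L :=
      hE.2.trans (Real.exp_le_exp.2 (by gcongr))
    have hbad : Integrable (Set.indicator (leavesRegion X δ a) fun _ : Path E => t⁻¹) (X.law x) :=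
      (integrable_const _).indicator hS
    have hpt : ∀ η : Path E, |Real.exp (γ * payoff δ f g η) - Real.exp (γ * payoff δ fN gN η)| ≤
        t * Real.exp (2 * p * gauge δ ω η) +
          Set.indicator (leavesRegion X δ a) (fun _ => t⁻¹) η := by
      intro η
      by_cases hη : η ∈ leavesRegion X δ a
      · rw [Set.indicator_of_mem hη]
        have h1 : Real.exp (γ * payoff δ f g η) ≤ Real.exp (p * gauge δ ω η) :=
          Real.exp_le_exp.2 ((le_abs_self _).trans (hD.abs_exponent_le hg η))
        have h2 : Real.exp (γ * payoff δ fN gN η) ≤ Real.exp (p * gauge δ ω η) :=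
          Real.exp_le_exp.2 ((le_abs_self _).trans (hDN.abs_exponent_le hgNb η))
        have h3 : |Real.exp (γ * payoff δ f g η) - Real.exp (γ * payoff δ fN gN η)| ≤
            2 * Real.exp (p * gauge δ ω η) := by
          rw [abs_le]
          constructor <;>
            linarith [Real.exp_pos (γ * payoff δ f g η), Real.exp_pos (γ * payoff δ fN gN η)]
        have h4 : Real.exp (2 * p * gauge δ ω η) = Real.exp (p * gauge δ ω η) ^ 2 := by
          rw [← Real.exp_nat_mul]
          ring_nf
        rw [h4]
        -- on the bad event, `2 e ≤ t e² + t⁻¹`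
        have h5 : 0 ≤ t⁻¹ * (t * Real.exp (p * gauge δ ω η) - 1) ^ 2 := by positivity
        have h6 : t⁻¹ * (t * Real.exp (p * gauge δ ω η) - 1) ^ 2 =
            t * Real.exp (p * gauge δ ω η) ^ 2 + t⁻¹ - 2 * Real.exp (p * gauge δ ω η) := by
          field_simp
          ring
        linarith
      -- off the bad event the truncation has no effect
      · have hin : ∀ s ≤ δ, a ≤ resolvent X (η s) := fun s hs =>
          not_lt.1 fun h => hη (mem_leavesRegion X hX hδ hs h)
        have hf : ∀ s ≤ δ, f (η s) = fN (η s) := fun s hs =>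
          (truncate_eq hfc hN0 ((hN₁ ⟨_, hin s hs, rfl⟩).trans
            ((le_max_left _ _).trans (le_max_right _ _)))).symm
        have hg' : g (η δ) = gN (η δ) :=
          (truncate_eq hgc hN0 ((hN₂ ⟨_, hin δ le_rfl, rfl⟩).trans
            ((le_max_right _ _).trans (le_max_right _ _)))).symm
        have : payoff δ f g η = payoff δ fN gN η := by
          rw [payoff, payoff, runningReward_congr hf, hg']
        rw [this, sub_self, abs_zero, Set.indicator_of_notMem hη]
        positivity
    rw [Real.dist_eq, ← integral_sub hi1 hi2]
    refine (abs_integral_le_integral_abs).trans_lt ?_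
    refine (integral_mono (hi1.sub hi2).abs ((hE.1.const_mul t).add hbad) hpt).trans_lt ?_
    rw [integral_add' (hE.1.const_mul t) hbad, integral_const_mul, integral_indicator_const _ hS,
      smul_eq_mul]
    have h7 : t * ∫ η, Real.exp (2 * p * gauge δ ω η) ∂(X.law x) ≤ ε / 4 := by
      calc _ ≤ t * L := by gcongr
        _ = ε / 4 := by rw [ht]; field_simp
    have h8 : (X.law x).real (leavesRegion X δ a) * t⁻¹ ≤ ε / 4 := by
      calc _ ≤ t * (ε / 4) * t⁻¹ := by gcongr
        _ = ε / 4 := by field_simp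
    linarith

theorem RewardData.continuous_entropicStep {X : FellerMarkovProcess E} {δ : ℝ≥0} {ω : E → ℝ}
    {b : ℝ} {M : ℝ → ℝ} {f : E → ℝ} {K γ A : ℝ} {g : E → ℝ} (hD : RewardData X δ ω b M f K γ)
    (hX : X.IsC0Feller) (hδ : 0 < δ) (hgc : Continuous g) (hg : GrowthBound ω A g) (hA : 0 < A) :
    Continuous (entropicStep X δ f γ g) :=
  ((hD.continuous_integral_exp hX hδ hgc hg hA).log fun x =>
    (integral_exp_pos (hD.integrable_exp_exponent hg x)).ne').const_mul _

end Containment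

/-! ### Contraction of the span seminorm -/

section Contraction

variable {E : Type*}

/-- The weighted span seminorm of `u`, with weight `1 + β ω`, is at most `D`. -/
def SpanBound (ω : E → ℝ) (β D : ℝ) (u : E → ℝ) : Prop :=
  ∀ x y, u x - u y ≤ D * (2 + β * ω x + β * ω y)

/-- Up to a constant, a span bound is a bound in the weighted supremum norm. -/
theorem SpanBound.exists_center [Nonempty E] {ω : E → ℝ} {β D : ℝ} {u : E → ℝ}
    (h : SpanBound ω β D u) : ∃ a, ∀ x, |u x - a| ≤ D * (1 + β * ω x) := by
  have hb : ∀ y, ∀ x, u x - D * (1 + β * ω x) ≤ u y + D * (1 + β * ω y) := fun y x => by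
    linarith [h x y]
  obtain ⟨y₀⟩ := ‹Nonempty E›
  have hbdd : BddAbove (Set.range fun x => u x - D * (1 + β * ω x)) :=
    ⟨_, Set.forall_mem_range.2 (hb y₀)⟩
  have : Nonempty E := ⟨y₀⟩
  refine ⟨⨆ x, (u x - D * (1 + β * ω x)), fun x => abs_le.2 ⟨?_, ?_⟩⟩
  · linarith [ciSup_le (hb x)]
  · linarith [le_ciSup hbdd x]

variable [TopologicalSpace E] [MeasurableSpace E]

theorem abs_integral_le_of_abs_le {Ω : Type*} [MeasurableSpace Ω] (P : Measure Ω)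
    [IsProbabilityMeasure P] {v : Ω → ℝ} {D : ℝ} (h : ∀ η, |v η| ≤ D) : |∫ η, v η ∂P| ≤ D := by
  have h1 : ∀ᵐ η ∂P, ‖v η‖ ≤ D := Eventually.of_forall h
  simpa using norm_integral_le_of_norm_le_const h1

theorem LocalMinorization.exists_real {X : FellerMarkovProcess E} {δ : ℝ≥0} {U : Set E}
    {ω : E → ℝ} (h : LocalMinorization X δ U ω) {R : ℝ} (hR : 0 < R) :
    ∃ d : ℝ, 0 < d ∧ ∃ ν : Measure E, IsProbabilityMeasure ν ∧ 0 < ν.real U ∧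
      ∀ x, ω x ≤ R → ∀ A, MeasurableSet A →
        d * ν.real A ≤ (X.law x).real {η : Path E | η δ ∈ A} := by
  obtain ⟨d, hd, ν, hν, hνU, h⟩ := h R hR
  refine ⟨d, hd, ν, hν, ENNReal.toReal_pos hνU.ne' (measure_ne_top _ _), fun x hx A hA => ?_⟩
  have := ENNReal.toReal_mono (measure_ne_top _ _) (h x hx A hA)
  rwa [ENNReal.toReal_mul, ENNReal.toReal_ofReal hd.le] at this

variable [OpensMeasurableSpace E] {X : FellerMarkovProcess E} {δ : ℝ≥0} {U : Set E} {ω : E → ℝ}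
  {b : ℝ} {M : ℝ → ℝ} {f : E → ℝ} {K γ A : ℝ}

/-- On sublevel sets of the weight, the exponential moments of the exponent are bounded. -/
theorem RewardData.exists_integral_exp_le (hD : RewardData X δ ω b M f K γ) (hA : 0 < A) (R : ℝ) :
    ∃ C : ℝ, 0 < C ∧ ∀ (g : E → ℝ) (x : E), GrowthBound ω A g → ω x ≤ R →
      ∫ η, Real.exp (γ * payoff δ f g η) ∂(X.law x) ≤ C ∧
      Integrable (fun η => Real.exp (-(γ * payoff δ f g η))) (X.law x) ∧
      ∫ η, Real.exp (-(γ * payoff δ f g η)) ∂(X.law x) ≤ C := by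
  set p := exponentGrowth δ K γ A
  have hp : 0 < p := hD.exponentGrowth_pos hA
  refine ⟨Real.exp (p * (1 + 2 * R + 2 * M (2 * p))), Real.exp_pos _, fun g x hg hx => ?_⟩
  have hm := hD.measurable_exponent hg
  have hb := hD.abs_exponent_le hg
  have hb' : ∀ η, |-(γ * payoff δ f g η)| ≤ p * gauge δ ω η := fun η => by
    rw [abs_neg]
    exact hb η
  have hR : Real.exp (p * (1 + 2 * ω x + 2 * M (2 * p))) ≤
      Real.exp (p * (1 + 2 * R + 2 * M (2 * p))) := by gcongr
  exact ⟨(hD.integral_exp_le hp hm hb x).trans hR,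
    integrable_exp_of_le (hD.integrable_exp_gauge x) hm.neg hb',
    (hD.integral_exp_le hp hm.neg hb' x).trans hR⟩

/-- Doeblin condition: tilting preserves the local minorization, so that any two tilted laws that
start in a sublevel set of the weight overlap. -/
theorem RewardData.exists_overlap (hD : RewardData X δ ω b M f K γ) (hA : 0 < A)
    (hmin : LocalMinorization X δ U ω) {R : ℝ} (hR : 0 < R) :
    ∃ ε : ℝ, 0 < ε ∧ ∀ (g h : E → ℝ) (z z' : E), GrowthBound ω A g → GrowthBound ω A h →
      ω z ≤ R → ω z' ≤ R → ∀ (v : E → ℝ) (D : ℝ), Measurable v → (∀ y, |v y| ≤ D) →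
        ∫ η, v (η δ) ∂(tiltedLaw X δ f γ g z) - ∫ η, v (η δ) ∂(tiltedLaw X δ f γ h z') ≤
          D * (2 - ε) := by
  obtain ⟨C, hC, hCb⟩ := hD.exists_integral_exp_le hA R
  obtain ⟨d, hd, ν, hν, -, hmin⟩ := hmin.exists_real hR
  refine ⟨(d * (1 / 2) / C) ^ 2, by positivity, ?_⟩
  intro g h z z' hg hh hz hz' v D hv hvD
  set ε := (d * (1 / 2) / C) ^ 2 with hε
  have hD0 : 0 ≤ D := (abs_nonneg _).trans (hvD z)
  -- sets of large `ν`-mass are charged by the tilted laws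
  have mass : ∀ (g : E → ℝ) (z : E), GrowthBound ω A g → ω z ≤ R → ∀ B, MeasurableSet B →
      1 / 2 ≤ ν.real B → ε ≤ (tiltedLaw X δ f γ g z).real {η : Path E | η δ ∈ B} := by
    intro g z hg hz B hB hνB
    obtain ⟨c1, c2, c3⟩ := hCb g z hg hz
    refine le_trans ?_ (sq_measureReal_le_tilted (hD.integrable_exp_exponent hg z) c2 c1 c3
      {η : Path E | η δ ∈ B}).2
    have := (mul_le_mul_of_nonneg_left hνB hd.le).trans (hmin z hz B hB)
    rw [hε]
    gcongr
  -- a function with values in `[-D, D]` is separated from `D` on its negativity set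
  have upper : ∀ (v : E → ℝ), Measurable v → (∀ y, |v y| ≤ D) → ∀ (g : E → ℝ) (z : E),
      GrowthBound ω A g → ω z ≤ R → ∀ B, MeasurableSet B → 1 / 2 ≤ ν.real B →
      (∀ y ∈ B, v y ≤ 0) → ∫ η, v (η δ) ∂(tiltedLaw X δ f γ g z) ≤ D * (1 - ε) := by
    intro v hv hvD g z hg hz B hB hνB hvB
    have := hD.isProbabilityMeasure_tiltedLaw hg z
    have hBm : MeasurableSet {η : Path E | η δ ∈ B} := measurable_eval δ hB
    have hvi : Integrable (fun η : Path E => v (η δ)) (tiltedLaw X δ f γ g z) :=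
      Integrable.of_bound (hv.comp (measurable_eval δ)).aestronglyMeasurable D
        (Eventually.of_forall fun η => hvD _)
    have hi : Integrable ({η : Path E | η δ ∈ B}.indicator fun _ => D) (tiltedLaw X δ f γ g z) :=
      (integrable_const D).indicator hBm
    have h1 : ∫ η, v (η δ) ∂(tiltedLaw X δ f γ g z) ≤
        ∫ η, (D - {η : Path E | η δ ∈ B}.indicator (fun _ => D) η) ∂(tiltedLaw X δ f γ g z) := by
      refine integral_mono hvi ((integrable_const D).sub hi) fun η => ?_
      by_cases hη : η ∈ {η : Path E | η δ ∈ B}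
      · simpa [Set.indicator_of_mem hη] using hvB _ hη
      · simpa [Set.indicator_of_notMem hη] using (abs_le.1 (hvD (η δ))).2
    rw [integral_sub (integrable_const D) hi, integral_indicator_const _ hBm] at h1
    simp only [integral_const, probReal_univ, smul_eq_mul, one_mul] at h1
    have h2 := mul_le_mul_of_nonneg_right (mass g z hg hz B hB hνB) hD0
    linarith
  have bd : ∀ (v : E → ℝ), (∀ y, |v y| ≤ D) → ∀ (g : E → ℝ) (z : E),
      GrowthBound ω A g → |∫ η, v (η δ) ∂(tiltedLaw X δ f γ g z)| ≤ D := by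
    intro v hvD g z hg
    have := hD.isProbabilityMeasure_tiltedLaw hg z
    exact abs_integral_le_of_abs_le _ fun η : Path E => hvD (η δ)
  have hB : MeasurableSet {y | v y ≤ 0} := measurableSet_le hv measurable_const
  have hsum : ν.real {y | v y ≤ 0} + ν.real {y | v y ≤ 0}ᶜ = 1 := by
    rw [measureReal_add_measureReal_compl hB, probReal_univ]
  rcases le_or_gt (1 / 2) (ν.real {y | v y ≤ 0}) with hh1 | hh1
  · have h1 := upper v hv hvD g z hg hz _ hB hh1 fun y hy => hy
    have h2 := (abs_le.1 (bd v hvD h z' hh)).1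
    linarith
  · have h1 := upper (fun y => -v y) hv.neg (fun y => by rw [abs_neg]; exact hvD y) h z' hh hz' _
      hB.compl (by linarith) fun y hy => by
        have : 0 < v y := not_le.1 hy
        linarith
    have h2 := (abs_le.1 (bd v hvD g z hg)).2
    rw [integral_neg] at h1
    linarith

/-- Choice of the weight `β` and of the contraction factor `L` from the drift rate `r`, the drift
constant `N` and the overlap `ε` on the set where the total weight is at most `R`. -/
theorem exists_contraction_constants {r N ε R : ℝ} (hr1 : r < 1) (hN : 0 ≤ N)
    (hε : 0 < ε) (hR : 0 < R) (hNR : 4 * N ≤ (1 - r) * R) :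
    ∃ β L : ℝ, 0 < β ∧ 0 ≤ L ∧ L < 1 ∧
      (∀ s, 0 ≤ s → 2 - ε + β * (r * s + 2 * N) ≤ L * (2 + β * s)) ∧
      ∀ s, R ≤ s → 2 + β * (r * s + 2 * N) ≤ L * (2 + β * s) := by
  set β := ε / (4 * (N + 1)) with hβ
  have hβ0 : 0 < β := by positivity
  have hβN : 2 * (β * N) ≤ ε / 2 := by
    have : β * (N + 1) = ε / 4 := by rw [hβ]; field_simp
    nlinarith
  have hr : 0 < 1 - r := by linarith
  set t₁ := β * (1 - r) * R / (2 * (2 + β * R)) with ht₁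
  have ht₁0 : 0 < t₁ := by positivity
  set t := min 1 (min (ε / 4) (min (1 - r) t₁)) with ht
  have ht0 : 0 < t := by positivity
  have h0 : t ≤ 1 := min_le_left _ _
  have h1 : t ≤ ε / 4 := (min_le_right _ _).trans (min_le_left _ _)
  have h2 : t ≤ 1 - r := (min_le_right _ _).trans ((min_le_right _ _).trans (min_le_left _ _))
  have h3 : t ≤ t₁ := (min_le_right _ _).trans ((min_le_right _ _).trans (min_le_right _ _))
  refine ⟨β, 1 - t, hβ0, by linarith, by linarith, fun s hs => ?_, fun s hs => ?_⟩
  · have := mul_le_mul_of_nonneg_right h2 (mul_nonneg hβ0.le hs)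
    linarith
  · have h4 : t * (2 + β * R) ≤ β * (1 - r) * R / 2 := by
      calc _ ≤ t₁ * (2 + β * R) := by gcongr
        _ = _ := by rw [ht₁]; field_simp
    -- the slope in `s` and the value at `s = R` are both controlled
    have h5 : t * β ≤ β * (1 - r) / 2 := by
      have : t * β * R ≤ β * (1 - r) / 2 * R := by nlinarith
      exact le_of_mul_le_mul_right this hR
    have h6 := mul_le_mul_of_nonneg_right h5 (sub_nonneg.2 hs)
    have h7 := mul_le_mul_of_nonneg_left hNR hβ0.le
    have h8 := mul_le_mul_of_nonneg_left hs (mul_nonneg hβ0.le hr.le)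
    nlinarith

/-- Harris-type contraction: expectations of `g - h` under tilted laws, after a possible shift into
`U`, contract the weighted span. -/
theorem RewardData.exists_span_contraction (hD : RewardData X δ ω b M f K γ) (hA : 0 < A)
    (hmin : LocalMinorization X δ U ω) {W : ℝ} (hW0 : 0 ≤ W) (hW : ∀ ξ ∈ U, ω ξ ≤ W) :
    ∃ β L : ℝ, 0 < β ∧ 0 ≤ L ∧ L < 1 ∧ ∀ (g h : E → ℝ) (D : ℝ), GrowthBound ω A g →
      GrowthBound ω A h → 0 ≤ D → SpanBound ω β D (fun y => g y - h y) →
      ∀ x y z z', (z = x ∨ z ∈ U) → (z' = y ∨ z' ∈ U) →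
        ∫ η, (g (η δ) - h (η δ)) ∂(tiltedLaw X δ f γ h z) -
          ∫ η, (g (η δ) - h (η δ)) ∂(tiltedLaw X δ f γ g z') ≤
            L * D * (2 + β * ω x + β * ω y) := by
  obtain ⟨r, N, hr0, hr1, hN, hdrift⟩ := hD.exists_drift hA
  set N' := N + r * W with hN'
  have hN'0 : 0 ≤ N' := by positivity
  set R := 4 * N' / (1 - r) + 1 with hR
  have hr : 0 < 1 - r := by linarith
  have hR0 : 0 < R := by positivity
  have hNR : 4 * N' ≤ (1 - r) * R := by
    have : (1 - r) * (4 * N' / (1 - r)) = 4 * N' := by field_simp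
    rw [hR, mul_add (1 - r), this]
    linarith
  obtain ⟨ε, hε, hover⟩ := hD.exists_overlap hA hmin (R := R + W) (by positivity)
  obtain ⟨β, L, hβ, hL0, hL1, hsmall, hlarge⟩ :=
    exists_contraction_constants hr1 hN'0 hε hR0 hNR
  refine ⟨β, L, hβ, hL0, hL1, fun g h D hg hh hD0 hspan x y z z' hz hz' => ?_⟩
  have hωz : ∀ {x z}, (z = x ∨ z ∈ U) → r * ω z + N ≤ r * ω x + N' ∧ ω z ≤ ω x + W := by
    rintro x z (rfl | hz)
    · exact ⟨by linarith [mul_nonneg hr0.le hW0], by linarith⟩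
    · have h1 := hD.nonneg x
      have h2 := hW z hz
      exact ⟨by nlinarith, by linarith⟩
  have : Nonempty E := ⟨x⟩
  obtain ⟨a, ha⟩ := hspan.exists_center
  have hpQ := hD.isProbabilityMeasure_tiltedLaw hh z
  have hpQ' := hD.isProbabilityMeasure_tiltedLaw hg z'
  set Q := tiltedLaw X δ f γ h z with hQ
  set Q' := tiltedLaw X δ f γ g z' with hQ'
  set u : E → ℝ := fun y => g y - h y with hu
  -- the overlap acts on the part of `u - a` with values in `[-D, D]`, the drift on the rest
  set v : E → ℝ := fun y => max (-D) (min D (u y - a)) with hv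
  have hum : Measurable u := hg.measurable.sub hh.measurable
  have hvm : Measurable v := by fun_prop
  have hvD : ∀ y, |v y| ≤ D := fun y =>
    abs_le.2 ⟨le_max_left _ _, max_le (by linarith) (min_le_left _ _)⟩
  have huv : ∀ y, |u y - a - v y| ≤ D * (β * ω y) := by
    intro y
    have h1 := abs_le.1 (ha y)
    have h2 : 0 ≤ D * (β * ω y) := mul_nonneg hD0 (mul_nonneg hβ.le (hD.nonneg y))
    simp only [hv]
    rw [abs_le]
    rcases le_total D (u y - a) with h3 | h3
    · rw [min_eq_left h3, max_eq_right (by linarith)]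
      constructor <;> linarith
    · rw [min_eq_right h3]
      rcases le_total (-D) (u y - a) with h4 | h4
      · rw [max_eq_right h4]
        constructor <;> linarith
      · rw [max_eq_left h4]
        constructor <;> linarith
  have hw := hD.growthBound_weight
  have iω := hD.integrable_tiltedLaw hh hw z
  have iω' := hD.integrable_tiltedLaw hg hw z'
  have iu : Integrable (fun η : Path E => u (η δ)) Q :=
    (hD.integrable_tiltedLaw hh hg z).sub (hD.integrable_tiltedLaw hh hh z)
  have iu' : Integrable (fun η : Path E => u (η δ)) Q' :=
    (hD.integrable_tiltedLaw hg hg z').sub (hD.integrable_tiltedLaw hg hh z')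
  have iv : ∀ P : Measure (Path E), IsProbabilityMeasure P →
      Integrable (fun η : Path E => v (η δ)) P := fun P hP =>
    Integrable.of_bound (hvm.comp (measurable_eval δ)).aestronglyMeasurable D
      (Eventually.of_forall fun η => hvD _)
  have e1 : ∫ η, u (η δ) ∂Q ≤ a + ∫ η, v (η δ) ∂Q + D * (β * ∫ η, ω (η δ) ∂Q) := by
    have : ∫ η, u (η δ) ∂Q ≤ ∫ η, (a + v (η δ) + D * (β * ω (η δ))) ∂Q :=
      integral_mono iu (((integrable_const a).add (iv Q hpQ)).add ((iω.const_mul β).const_mul D))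
        fun η => by linarith [(abs_le.1 (huv (η δ))).2]
    rw [integral_add (f := fun η : Path E => a + v (η δ)) ((integrable_const a).add (iv Q hpQ))
      ((iω.const_mul β).const_mul D), integral_add (integrable_const a) (iv Q hpQ),
      integral_const_mul, integral_const_mul] at this
    simpa using this
  have e2 : a + ∫ η, v (η δ) ∂Q' - D * (β * ∫ η, ω (η δ) ∂Q') ≤ ∫ η, u (η δ) ∂Q' := by
    have : ∫ η, (a + v (η δ) - D * (β * ω (η δ))) ∂Q' ≤ ∫ η, u (η δ) ∂Q' :=
      integral_mono (((integrable_const a).add (iv Q' hpQ')).sub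
        ((iω'.const_mul β).const_mul D)) iu'
        fun η => by linarith [(abs_le.1 (huv (η δ))).1]
    rw [integral_sub (f := fun η : Path E => a + v (η δ)) ((integrable_const a).add (iv Q' hpQ'))
      ((iω'.const_mul β).const_mul D), integral_add (integrable_const a) (iv Q' hpQ'),
      integral_const_mul, integral_const_mul] at this
    simpa using this
  have d1 := (hdrift z h hh).trans (hωz hz).1
  have d2 := (hdrift z' g hg).trans (hωz hz').1
  have e3 : D * (β * ∫ η, ω (η δ) ∂Q) + D * (β * ∫ η, ω (η δ) ∂Q') ≤
      D * (β * (r * (ω x + ω y) + 2 * N')) := by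
    rw [← mul_add, ← mul_add]
    refine mul_le_mul_of_nonneg_left (mul_le_mul_of_nonneg_left ?_ hβ.le) hD0
    linarith
  have hs0 : 0 ≤ ω x + ω y := add_nonneg (hD.nonneg x) (hD.nonneg y)
  rcases le_or_gt R (ω x + ω y) with hs | hs
  · have e4 : ∫ η, v (η δ) ∂Q - ∫ η, v (η δ) ∂Q' ≤ D * 2 := by
      have b1 := (abs_le.1 (abs_integral_le_of_abs_le Q fun η : Path E => hvD (η δ))).2
      have b2 := (abs_le.1 (abs_integral_le_of_abs_le Q' fun η : Path E => hvD (η δ))).1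
      linarith
    have e5 := mul_le_mul_of_nonneg_left (hlarge _ hs) hD0
    linarith
  · have e4 := hover h g z z' hh hg (by linarith [(hωz hz).2, hD.nonneg y])
      (by linarith [(hωz hz').2, hD.nonneg x]) v D hvm hvD
    have e5 := mul_le_mul_of_nonneg_left (hsmall _ hs0) hD0
    linarith

end Contraction

/-! ### Fixed points modulo constants -/

section FixedPoint

variable {E : Type*} [TopologicalSpace E]

/-- If the iteration of an operator `S`, modulo additive constants, stays in a ball of the weighted
norm on which `S` contracts the weighted span, then it converges to a fixed point of `S` modulo
constants. -/
theorem exists_fixed_point_mod_const {ω : E → ℝ} (hω : Continuous ω) (hω0 : ∀ x, 0 ≤ ω x)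
    {S : (E → ℝ) → E → ℝ} {β L A : ℝ} (hβ : 0 < β) (hL0 : 0 ≤ L) (hL1 : L < 1) (hA : 0 < A)
    (z₀ : E) {g : ℕ → E → ℝ} (hgc : ∀ n, Continuous (g n))
    (hgA : ∀ n x, |g n x| ≤ A * (1 + ω x))
    (hstep : ∀ n x y, g (n + 1) x - g (n + 1) y = S (g n) x - S (g n) y)
    (hS : ∀ (u v : E → ℝ) (D : ℝ), Continuous u → Continuous v →
      (∀ x, |u x| ≤ A * (2 + ω z₀) * (1 + ω x)) → (∀ x, |v x| ≤ A * (2 + ω z₀) * (1 + ω x)) →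
      0 ≤ D → SpanBound ω β D (fun x => u x - v x) →
      SpanBound ω β (L * D) (fun x => S u x - S v x)) :
    ∃ (w : E → ℝ) (l : ℝ), Continuous w ∧ (∀ x, |w x| ≤ A * (2 + ω z₀) * (1 + ω x)) ∧
      ∀ x, S w x = w x + l := by
  have hz₀ := hω0 z₀
  have hgA' : ∀ n x, |g n x| ≤ A * (2 + ω z₀) * (1 + ω x) := fun n x => by
    refine (hgA n x).trans ?_
    have := hω0 x
    gcongr
    nlinarith
  set D₀ := 2 * A * (1 + 1 / β) with hD₀
  have hD₀0 : 0 ≤ D₀ := by positivity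
  -- increments of the iteration decay geometrically
  have hinc : ∀ n, SpanBound ω β (L ^ n * D₀) (fun x => g (n + 1) x - g n x) := by
    intro n
    induction n with
    | zero =>
      intro x y
      have h1 := abs_le.1 (hgA 0 x)
      have h2 := abs_le.1 (hgA 1 x)
      have h3 := abs_le.1 (hgA 0 y)
      have h4 := abs_le.1 (hgA 1 y)
      have h5 : ∀ x, 2 * (A * (1 + ω x)) ≤ D₀ * (1 + β * ω x) := by
        intro x
        have : D₀ * (1 + β * ω x) = 2 * (A * (1 + ω x)) + 2 * A * (1 / β + β * ω x) := by
          rw [hD₀]; field_simp; ring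
        rw [this]
        have := hω0 x
        have : 0 ≤ 2 * A * (1 / β + β * ω x) := by positivity
        linarith
      have h6 := h5 x
      have h7 := h5 y
      simp only [pow_zero, one_mul, zero_add]
      linarith
    | succ n ih =>
      intro x y
      have h := hS _ _ _ (hgc (n + 1)) (hgc n) (hgA' (n + 1)) (hgA' n) (by positivity) ih x y
      have h1 := hstep (n + 1) x y
      have h2 := hstep n x y
      rw [pow_succ', mul_assoc L]
      linarith
  have hL : 0 < 1 - L := by linarith
  have hcum : ∀ n k, SpanBound ω β (L ^ n * D₀ * ((1 - L ^ k) / (1 - L)))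
      (fun x => g (n + k) x - g n x) := by
    intro n k
    induction k with
    | zero => intro x y; simp
    | succ k ih =>
      intro x y
      have h1 := ih x y
      have h2 := hinc (n + k) x y
      have h3 : L ^ n * D₀ * ((1 - L ^ (k + 1)) / (1 - L)) =
          L ^ n * D₀ * ((1 - L ^ k) / (1 - L)) + L ^ (n + k) * D₀ := by
        field_simp
        ring
      rw [h3, ← add_assoc]
      simp only [] at h1 h2 ⊢
      linarith
  set C := D₀ / (1 - L) with hC
  have hC0 : 0 ≤ C := by positivity
  have hcum' : ∀ n k, SpanBound ω β (L ^ n * C) (fun x => g (n + k) x - g n x) := by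
    intro n k x y
    refine (hcum n k x y).trans ?_
    have hx := hω0 x
    have hy := hω0 y
    refine mul_le_mul_of_nonneg_right ?_ (by positivity)
    rw [hC, mul_assoc, mul_div_assoc']
    refine mul_le_mul_of_nonneg_left (div_le_div_of_nonneg_right ?_ hL.le) (pow_nonneg hL0 n)
    nlinarith [mul_nonneg hD₀0 (pow_nonneg hL0 k)]
  -- the normalised iterates converge pointwise
  have hcauchy : ∀ x, CauchySeq fun n => g n x - g n z₀ := by
    intro x
    set c := C * (2 + β * ω x + β * ω z₀) with hc
    refine cauchySeq_of_le_tendsto_0' (fun n => L ^ n * c) ?_ ?_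
    · intro n m hnm
      obtain ⟨k, rfl⟩ := Nat.exists_eq_add_of_le hnm
      have h1 := hcum' n k x z₀
      have h2 := hcum' n k z₀ x
      rw [Real.dist_eq, abs_le, hc]
      constructor <;> nlinarith
    · simpa using (tendsto_pow_atTop_nhds_zero_of_lt_one hL0 hL1).mul_const c
  choose w hw using fun x => cauchySeq_tendsto_of_complete (hcauchy x)
  have hlim : ∀ n, SpanBound ω β (L ^ n * C) (fun x => w x - g n x) := by
    intro n x y
    have h1 : Tendsto (fun k => (g (n + k) x - g (n + k) z₀ - g n x) -
        (g (n + k) y - g (n + k) z₀ - g n y)) atTop (𝓝 (w x - g n x - (w y - g n y))) := by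
      have hs : Tendsto (fun k => n + k) atTop atTop := by
        simpa only [add_comm] using tendsto_add_atTop_nat n
      exact (((hw x).comp hs).sub_const _).sub (((hw y).comp hs).sub_const _)
    refine le_of_tendsto h1 (Eventually.of_forall fun k => ?_)
    have := hcum' n k x y
    linarith
  have hwz : w z₀ = 0 := by
    have : Tendsto (fun n => g n z₀ - g n z₀) atTop (𝓝 0) := by simp
    exact tendsto_nhds_unique (hw z₀) this
  have hwA : ∀ x, |w x| ≤ A * (2 + ω z₀) * (1 + ω x) := by
    intro x
    refine le_of_tendsto (hw x).abs (Eventually.of_forall fun n => ?_)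
    have h1 := abs_sub (g n x) (g n z₀)
    have h2 := hgA n x
    have h3 := hgA n z₀
    have : 0 ≤ A * ((1 + ω z₀) * ω x) := by have := hω0 x; positivity
    linarith
  have hwc : Continuous w := by
    refine continuous_of_locally_uniform_approx_of_continuousAt fun x₀ u hu => ?_
    obtain ⟨ε, hε, hεu⟩ := Metric.mem_uniformity_dist.1 hu
    have hωev : ∀ᶠ x in 𝓝 x₀, ω x ≤ ω x₀ + 1 :=
      (hω.tendsto x₀).eventually (Iic_mem_nhds (by linarith))
    set c := C * (2 + β * (ω x₀ + 1) + β * ω z₀) with hc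
    have ht : Tendsto (fun n => L ^ n * c) atTop (𝓝 0) := by
      simpa using (tendsto_pow_atTop_nhds_zero_of_lt_one hL0 hL1).mul_const c
    obtain ⟨n, hn⟩ := (ht.eventually (Iio_mem_nhds hε)).exists
    refine ⟨_, hωev, fun x => g n x - g n z₀, ((hgc n).sub continuous_const).continuousAt,
      fun x hx => hεu (lt_of_le_of_lt ?_ hn)⟩
    have h1 := hlim n x z₀
    have h2 := hlim n z₀ x
    simp only [hwz] at h1 h2
    have h3 : L ^ n * C * (2 + β * ω x + β * ω z₀) ≤ L ^ n * c := by
      rw [hc, ← mul_assoc]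
      gcongr
      exact hx
    rw [Real.dist_eq, abs_le]
    constructor <;> linarith
  -- one inequality for all pairs `x`, `y` gives equality
  have hSw : ∀ x y, S w x - S w y ≤ w x - w y := by
    intro x y
    have h1 : Tendsto (fun n => L * (L ^ n * C) * (2 + β * ω x + β * ω y) +
        ((g (n + 1) x - g (n + 1) z₀) - (g (n + 1) y - g (n + 1) z₀))) atTop
        (𝓝 (L * (0 * C) * (2 + β * ω x + β * ω y) + (w x - w y))) :=
      ((((tendsto_pow_atTop_nhds_zero_of_lt_one hL0 hL1).mul_const C).const_mul L).mul_const _).add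
        (((hw x).comp (tendsto_add_atTop_nat 1)).sub ((hw y).comp (tendsto_add_atTop_nat 1)))
    have h2 : w x - w y = L * (0 * C) * (2 + β * ω x + β * ω y) + (w x - w y) := by ring
    rw [h2]
    refine ge_of_tendsto h1 (Eventually.of_forall fun n => ?_)
    have h3 := hS _ _ _ hwc (hgc n) hwA (hgA' n) (by positivity) (hlim n) x y
    have h4 := hstep n x y
    linarith
  exact ⟨w, S w z₀ - w z₀, hwc, hwA, fun x => by linarith [hSw x z₀, hSw z₀ x]⟩

end FixedPoint

/-! ### Maximisation over impulses -/

section ImpulseMax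

variable {E : Type*}

/-- The best of waiting, with value `φ x`, and of shifting to some `ξ ∈ U`, with value
`φ ξ + c x ξ`. -/
def impulseMax (U : Set E) (c : E → E → ℝ) (φ : E → ℝ) (x : E) : ℝ :=
  max (φ x) (⨆ ξ : U, (φ ξ + c x ξ))

variable [TopologicalSpace E] {U : Set E} {c : E → E → ℝ} {φ ψ : E → ℝ}

theorem exists_eq_iSup_of_continuousOn (hU : IsCompact U) (hUn : U.Nonempty)
    (hφ : ContinuousOn φ U) : ∃ ξ₀ ∈ U, ⨆ ξ : U, φ ξ = φ ξ₀ ∧ ∀ ξ ∈ U, φ ξ ≤ φ ξ₀ := by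
  obtain ⟨ξ₀, h₀, hmax⟩ := hU.exists_isMaxOn hUn hφ
  have : Nonempty U := ⟨⟨ξ₀, h₀⟩⟩
  refine ⟨ξ₀, h₀, le_antisymm (ciSup_le fun ξ => hmax ξ.2) ?_, fun ξ hξ => hmax hξ⟩
  exact le_ciSup (f := fun ξ : U => φ ξ) ⟨φ ξ₀, Set.forall_mem_range.2 fun ξ => hmax ξ.2⟩ ⟨ξ₀, h₀⟩

theorem impulseMax_spec (hU : IsCompact U) (hUn : U.Nonempty)
    (hc : ContinuousOn (fun p : E × E => c p.1 p.2) (Set.univ ×ˢ U)) (hφ : Continuous φ) (x : E) :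
    φ x ≤ impulseMax U c φ x ∧ (∀ ξ ∈ U, φ ξ + c x ξ ≤ impulseMax U c φ x) ∧
      (impulseMax U c φ x = φ x ∨ ∃ ξ ∈ U, impulseMax U c φ x = φ ξ + c x ξ) := by
  have hcx : ContinuousOn (fun ξ => φ ξ + c x ξ) U :=
    hφ.continuousOn.add
      (hc.comp (f := fun ξ => (x, ξ)) (by fun_prop) fun ξ hξ => ⟨trivial, hξ⟩)
  obtain ⟨ξ₀, h₀, he, hmax⟩ := exists_eq_iSup_of_continuousOn hU hUn hcx
  refine ⟨le_max_left _ _, fun ξ hξ => le_max_of_le_right (he ▸ hmax ξ hξ), ?_⟩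
  rcases max_choice (φ x) (⨆ ξ : U, (φ ξ + c x ξ)) with h | h
  · exact Or.inl h
  · exact Or.inr ⟨ξ₀, h₀, h.trans he⟩

theorem continuous_impulseMax (hU : IsCompact U)
    (hc : ContinuousOn (fun p : E × E => c p.1 p.2) (Set.univ ×ˢ U)) (hφ : Continuous φ) :
    Continuous (impulseMax U c φ) := by
  have : CompactSpace U := isCompact_iff_compactSpace.1 hU
  have hf : Continuous fun p : E × U => φ p.2 + c p.1 p.2 := by
    refine (hφ.comp (continuous_subtype_val.comp continuous_snd)).add ?_
    exact hc.comp_continuous (f := fun p : E × U => (p.1, (p.2 : E))) (by fun_prop)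
      fun p => ⟨trivial, p.2.2⟩
  have h := isCompact_univ.continuous_sSup (f := fun x (ξ : U) => φ ξ + c x ξ) hf
  simp only [Set.image_univ] at h
  exact hφ.max h

/-- Differences of impulse maxima are bounded by the difference at a maximiser. -/
theorem exists_impulseMax_sub_le (hU : IsCompact U) (hUn : U.Nonempty)
    (hc : ContinuousOn (fun p : E × E => c p.1 p.2) (Set.univ ×ˢ U)) (hφ : Continuous φ)
    (hψ : Continuous ψ) (x : E) :
    ∃ z, (z = x ∨ z ∈ U) ∧ impulseMax U c φ x - impulseMax U c ψ x ≤ φ z - ψ z := by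
  obtain ⟨-, -, h⟩ := impulseMax_spec hU hUn hc hφ x
  obtain ⟨h1, h2, -⟩ := impulseMax_spec hU hUn hc hψ x
  rcases h with h | ⟨ξ, hξ, h⟩
  · exact ⟨x, Or.inl rfl, by linarith⟩
  · exact ⟨ξ, Or.inr hξ, by linarith [h2 ξ hξ]⟩

end ImpulseMax

/-! ### Existence of solutions of the Bellman equation -/

section Existence

variable {E : Type*} [TopologicalSpace E]

/-- The class of continuous functions that the normalised Bellman operator leaves invariant. -/
structure Admissible (U : Set E) (ω : E → ℝ) (κ a B : ℝ) (g : E → ℝ) : Prop where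
  continuous : Continuous g
  lower : ∀ x, -(κ * (1 + ω x)) ≤ g x
  upper : ∀ x, g x ≤ a + B * ω x
  nonpos : ∀ x ∈ U, g x ≤ 0

/-- The Bellman operator, normalised by the best value of restarting in `U`. -/
def normalizedStep [MeasurableSpace E] (X : FellerMarkovProcess E) (δ : ℝ≥0) (U : Set E)
    (f : E → ℝ) (c : E → E → ℝ) (γ : ℝ) (g : E → ℝ) (x : E) : ℝ :=
  impulseMax U c (entropicStep X δ f γ g) x - ⨆ ξ : U, entropicStep X δ f γ g ξ

variable {U : Set E} {ω : E → ℝ} {κ a B : ℝ} {g : E → ℝ}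

theorem Admissible.growthBound [MeasurableSpace E] [OpensMeasurableSpace E]
    (h : Admissible U ω κ a B g) (hω : ∀ x, 0 ≤ ω x) (hκ : 0 ≤ κ) (ha : 0 ≤ a) (hB : 0 ≤ B) :
    GrowthBound ω (κ + a + B + 1) g := by
  refine ⟨h.continuous.measurable, fun x => ?_⟩
  have h0 := hω x
  have h1 := h.lower x
  have h2 := h.upper x
  have h3 := mul_nonneg hκ h0
  have h4 := mul_nonneg ha h0
  have h5 := mul_nonneg hB h0
  rw [abs_le]
  constructor <;> linarith

variable [MeasurableSpace E] [OpensMeasurableSpace E] {X : FellerMarkovProcess E} {δ : ℝ≥0}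
  {f : E → ℝ} {b : ℝ} {M : ℝ → ℝ} {K γ A : ℝ}

/-- By Jensen's inequality the entropic utility is at most the expectation of the payoff, hence at
most an affine function of the weight. -/
theorem RewardData.exists_entropicStep_le (hD : RewardData X δ ω b M f K γ) :
    ∃ r N k : ℝ, 0 < r ∧ r < 1 ∧ 0 ≤ N ∧ 0 ≤ k ∧ ∀ (g : E → ℝ) (a B A : ℝ), 0 ≤ B →
      GrowthBound ω A g → (∀ x, g x ≤ a + B * ω x) →
        ∀ x, entropicStep X δ f γ g x ≤ k * (1 + ω x) + a + B * (r * ω x + N) := by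
  obtain ⟨r, N, hr0, hr1, hN, hdrift⟩ := hD.exists_tilted_drift (A := 1) one_pos
  have hK := hD.growth_nonneg
  have hM := hD.noise_nonneg 2
  refine ⟨r, N, K * (1 + δ) * (2 + 2 * M 2), hr0, hr1, hN, by positivity, ?_⟩
  intro g a B A hB hg hgu x
  have hω0 := hD.nonneg x
  have hint : Integrable (fun η => γ * payoff δ f g η) (X.law x) :=
    hD.integrable_of_le (hD.measurable_exponent hg) (hD.abs_exponent_le hg) x
  have hJ := integral_le_log_integral_exp hint (hD.integrable_exp_exponent hg x)
  have h1 : entropicStep X δ f γ g x ≤ ∫ η, payoff δ f g η ∂(X.law x) := by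
    have := mul_le_mul_of_nonpos_left hJ (inv_lt_zero.2 hD.risk_neg).le
    rwa [integral_const_mul, inv_mul_cancel_left₀ hD.risk_neg.ne] at this
  have hpi : Integrable (payoff δ f g) (X.law x) :=
    hD.integrable_of_le (measurable_payoff δ hD.reward_continuous hg.measurable)
      (hD.abs_payoff_le hD.reward_continuous hD.reward_bound hg.bound) x
  have hgi : Integrable (gauge δ ω) (X.law x) :=
    hD.integrable_of_le (A := 1) hD.measurable_gauge
      (fun η => by rw [abs_of_nonneg (by linarith [hD.one_le_gauge η]), one_mul]) x
  have hωi : Integrable (fun η : Path E => ω (η δ)) (X.law x) :=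
    hD.integrable_of_le (A := 1) (hD.continuous.measurable.comp (measurable_eval δ))
      (fun η => by
        have h0 := hD.nonneg (η δ)
        have h1 := runningReward_nonneg δ hD.nonneg η
        change |ω (η δ)| ≤ 1 * (1 + runningReward δ ω η + ω (η δ))
        rw [abs_of_nonneg h0]
        linarith) x
  have hpt : ∀ η : Path E,
      payoff δ f g η ≤ K * (1 + δ) * gauge δ ω η + (a + B * ω (η δ)) := by
    intro η
    have h2 := hgu (η δ)
    have h3 := (abs_le.1 (abs_runningReward_le δ hD.reward_continuous hD.continuous
      hD.reward_bound η)).2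
    have h4 := runningReward_nonneg δ hD.nonneg η
    have h5 := hD.nonneg (η δ)
    have h6 : δ + runningReward δ ω η ≤ (1 + δ) * gauge δ ω η := by
      have := δ.coe_nonneg
      unfold gauge
      nlinarith [mul_nonneg this h4, mul_nonneg this h5]
    have h7 := mul_le_mul_of_nonneg_left h6 hK
    rw [payoff]
    linarith
  have h2 : ∫ η, payoff δ f g η ∂(X.law x) ≤
      ∫ η, (K * (1 + δ) * gauge δ ω η + (a + B * ω (η δ))) ∂(X.law x) :=
    integral_mono hpi ((hgi.const_mul _).add ((integrable_const a).add (hωi.const_mul B))) hpt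
  rw [integral_add (hgi.const_mul _) (g := fun η : Path E => a + B * ω (η δ))
      ((integrable_const a).add (hωi.const_mul B)),
    integral_add (integrable_const a) (hωi.const_mul B), integral_const_mul, integral_const_mul,
    integral_const, probReal_univ, one_smul] at h2
  have h3 := hdrift x (fun _ => 0) measurable_const fun η => by
    simpa using zero_le_one.trans (hD.one_le_gauge η)
  have h3' : ∫ η, ω (η δ) ∂(X.law x) ≤ r * ω x + N := by
    simpa [tilted_const] using h3
  have h4 := mul_le_mul_of_nonneg_left h3' hB
  have h5 := mul_le_mul_of_nonneg_left (hD.integral_gauge_le x)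
    (show 0 ≤ K * (1 + (δ : ℝ)) by positivity)
  have h6 : K * (1 + (δ : ℝ)) * (1 + 2 * ω x + 2 * M 2) ≤
      K * (1 + δ) * (2 + 2 * M 2) * (1 + ω x) := by
    rw [mul_assoc (K * (1 + (δ : ℝ)))]
    gcongr
    nlinarith [mul_nonneg hM hω0]
  linarith

/-- On sublevel sets of the weight, the entropic utility is bounded above uniformly over the
terminal values that are nonpositive on `U`: with probability bounded below the process ends in
`U`, and this event alone bounds the exponential moment from below. -/
theorem RewardData.exists_entropicStep_le_of_nonpos (hD : RewardData X δ ω b M f K γ)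
    (hU : MeasurableSet U) (hmin : LocalMinorization X δ U ω) {R : ℝ} (hR : 0 < R) :
    ∃ C : ℝ, ∀ (g : E → ℝ) (A : ℝ), GrowthBound ω A g → (∀ x ∈ U, g x ≤ 0) →
      ∀ x, ω x ≤ R → entropicStep X δ f γ g x ≤ C := by
  obtain ⟨C, hC, hCb⟩ := hD.exists_integral_exp_le one_pos R
  obtain ⟨d, hd, ν, hν, hνU, hmin⟩ := hmin.exists_real hR
  set q := (d * ν.real U) ^ 2 / C with hq
  have hq0 : 0 < q := by positivity
  refine ⟨γ⁻¹ * Real.log q, fun g A hg hgU x hx => ?_⟩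
  refine mul_le_mul_of_nonpos_left (Real.log_le_log hq0 ?_) (inv_lt_zero.2 hD.risk_neg).le
  have h0 : GrowthBound ω 1 fun _ => (0 : ℝ) :=
    ⟨measurable_const, fun y => by rw [abs_zero]; linarith [hD.nonneg y]⟩
  obtain ⟨c1, c2, c3⟩ := hCb _ x h0 hx
  have hm : MeasurableSet {η : Path E | η δ ∈ U} := measurable_eval δ hU
  have i0 := hD.integrable_exp_exponent h0 x
  have i1 := hD.integrable_exp_exponent hg x
  calc q ≤ (X.law x).real {η : Path E | η δ ∈ U} ^ 2 / C := by
        have := hmin x hx U hU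
        rw [hq]
        gcongr
    _ ≤ ∫ η in {η : Path E | η δ ∈ U}, Real.exp (γ * payoff δ f (fun _ => 0) η) ∂(X.law x) :=
        (sq_measureReal_le_tilted i0 c2 c1 c3 _).1
    _ ≤ ∫ η in {η : Path E | η δ ∈ U}, Real.exp (γ * payoff δ f g η) ∂(X.law x) := by
        refine setIntegral_mono_on i0.integrableOn i1.integrableOn hm fun η hη => ?_
        refine Real.exp_le_exp.2 (mul_le_mul_of_nonpos_left ?_ hD.risk_neg.le)
        have := hgU _ hη
        rw [payoff, payoff]
        linarith
    _ ≤ _ := setIntegral_le_integral i1 (Eventually.of_forall fun η => (Real.exp_pos _).le)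

end Existence

section Existence

variable {E : Type*} [TopologicalSpace E] [MeasurableSpace E] [BorelSpace E]
  {X : FellerMarkovProcess E} {δ : ℝ≥0} {U : Set E} {ω f : E → ℝ} {b K γ : ℝ}
  {M : ℝ → ℝ} {c : E → E → ℝ}

/-- The normalised Bellman operator leaves a class of admissible functions invariant. -/
theorem RewardData.exists_admissible_normalizedStep
    (hD : RewardData X δ ω b M f K γ) (hU : IsCompact U) (hUm : MeasurableSet U)
    (hc : CostConstraints U ω c) (hmin : LocalMinorization X δ U ω)
    (hcont : ∀ (g : E → ℝ) (A : ℝ), 0 < A → Continuous g → GrowthBound ω A g →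
      Continuous (entropicStep X δ f γ g)) :
    ∃ κ a B : ℝ, 0 ≤ κ ∧ 0 ≤ a ∧ 0 ≤ B ∧ ∀ g, Admissible U ω κ a B g →
      Admissible U ω κ a B (normalizedStep X δ U f c γ g) := by
  obtain ⟨κ, hκ, hcκ⟩ := hc.exists_lower_bound hD.nonneg hU
  obtain ⟨c₀, hc₀, hcc⟩ := hc.2.1
  have hUn := hmin.nonempty
  obtain ⟨z₀, hz₀⟩ := hUn
  obtain ⟨r, N, k, hr0, hr1, hN, hk, hJ⟩ := hD.exists_entropicStep_le
  -- the lower bound of admissible functions bounds the normalising constant from below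
  set lo : E → ℝ := fun x => -(κ * (1 + ω x)) with hlo
  have hloG : GrowthBound ω κ lo := by
    refine ⟨by have := hD.continuous.measurable; fun_prop, fun x => ?_⟩
    have := hD.nonneg x
    rw [hlo, abs_neg, abs_of_nonneg (by positivity)]
  set s₀ := |entropicStep X δ f γ lo z₀| with hs₀
  have hr : 0 < 1 - r := by linarith
  -- beyond level `R` the growth coefficient `B` absorbs the one-period payoff
  set B := (k + 1) / (1 - r) with hB
  have hB0 : 0 ≤ B := by positivity
  have hBr : B * (1 - r) = k + 1 := by rw [hB]; field_simp
  set R := k + B * N + s₀ + 1 with hR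
  have hR0 : 0 < R := by positivity
  obtain ⟨C, hC⟩ := hD.exists_entropicStep_le_of_nonpos hUm hmin hR0
  set a := |C| + s₀ with ha
  have ha0 : 0 ≤ a := by positivity
  refine ⟨κ, a, B, hκ.le, ha0, hB0, fun g hg => ?_⟩
  have hgG := hg.growthBound hD.nonneg hκ.le ha0 hB0
  have hφ := hcont g _ (by positivity) hg.continuous hgG
  obtain ⟨ξ₀, hξ₀, hs, hsmax⟩ := exists_eq_iSup_of_continuousOn hU ⟨z₀, hz₀⟩ hφ.continuousOn
  have hspec := impulseMax_spec hU ⟨z₀, hz₀⟩ hc.1 hφ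
  have hslo : -s₀ ≤ entropicStep X δ f γ g ξ₀ :=
    (neg_abs_le _).trans ((hD.entropicStep_mono hloG hgG hg.lower z₀).trans (hsmax z₀ hz₀))
  refine ⟨(continuous_impulseMax hU hc.1 hφ).sub continuous_const, fun x => ?_, fun x => ?_,
    fun x hx => ?_⟩
  · have h1 := (hspec x).2.1 ξ₀ hξ₀
    have h2 := hcκ x ξ₀ hξ₀
    rw [normalizedStep, hs]
    linarith
  · rw [normalizedStep, hs]
    have hω0 := hD.nonneg x
    rcases (hspec x).2.2 with h | ⟨ξ, hξ, h⟩
    · rw [h]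
      rcases le_or_gt (ω x) R with hx | hx
      · have h1 := hC g _ hgG hg.nonpos x hx
        have h2 := le_abs_self C
        have h3 := mul_nonneg hB0 hω0
        linarith
      · have h1 := hJ g a B _ hB0 hgG hg.upper x
        have h2 : B * (1 - r) * ω x = (k + 1) * ω x := by rw [hBr]
        linarith
    · rw [h]
      have h1 := hsmax ξ hξ
      have h2 := hcc x ξ hξ
      have h3 := mul_nonneg hB0 hω0
      linarith
  · rw [normalizedStep, hs]
    rcases (hspec x).2.2 with h | ⟨ξ, hξ, h⟩
    · linarith [hsmax x hx]
    · linarith [hsmax ξ hξ, hcc x ξ hξ]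

/-- If the one-period operator preserves continuity, the Bellman equation has a solution: iterates
of the normalised operator stay admissible, and the Harris-type contraction makes them converge
modulo constants. -/
theorem exists_isBellmanSolution [T2Space E]
    (hD : RewardData X δ ω b M f K γ) (hU : IsCompact U)
    (hc : CostConstraints U ω c) (hmin : LocalMinorization X δ U ω)
    (hcont : ∀ (g : E → ℝ) (A : ℝ), 0 < A → Continuous g → GrowthBound ω A g →
      Continuous (entropicStep X δ f γ g)) :
    ∃ (w : E → ℝ) (l : ℝ), IsBellmanSolution X δ U ω f c γ w l := by
  obtain ⟨κ, a, B, hκ, ha, hB, hinv⟩ :=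
    hD.exists_admissible_normalizedStep hU hU.isClosed.measurableSet hc hmin hcont
  have hUn := hmin.nonempty
  obtain ⟨z₀, hz₀⟩ := id hUn
  obtain ⟨W, hW0, hW⟩ := exists_weight_bound hD.continuous hU
  set A := κ + a + B + 1 with hA
  have hA0 : 0 < A := by positivity
  have hz0 := hD.nonneg z₀
  -- growth constant of the limit, which is normalised at `z₀`
  set A' := A * (2 + ω z₀) with hA'
  have hA'0 : 0 < A' := by positivity
  obtain ⟨β, L, hβ, hL0, hL1, hcontr⟩ := hD.exists_span_contraction hA'0 hmin hW0 hW
  set T := normalizedStep X δ U f c γ with hT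
  set S : (E → ℝ) → E → ℝ := fun g => impulseMax U c (entropicStep X δ f γ g) with hS
  have hadm : ∀ n, Admissible U ω κ a B (T^[n] fun _ => 0) := by
    intro n
    induction n with
    | zero =>
      refine ⟨continuous_const, fun x => ?_, fun x => ?_, fun x _ => le_rfl⟩
      · have := hD.nonneg x
        have : 0 ≤ κ * (1 + ω x) := by positivity
        simpa using this
      · have := hD.nonneg x
        have : 0 ≤ a + B * ω x := by positivity
        simpa using this
    | succ n ih =>
      rw [Function.iterate_succ_apply']
      exact hinv _ ih
  obtain ⟨w, l, hwc, hwA, hwl⟩ := exists_fixed_point_mod_const (S := S) hD.continuous hD.nonneg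
    hβ hL0 hL1 hA0 z₀ (fun n => (hadm n).continuous)
    (fun n => ((hadm n).growthBound hD.nonneg hκ ha hB).bound)
    (fun n x y => by
      rw [Function.iterate_succ_apply']
      simp only [hT, normalizedStep, hS]
      ring)
    (fun u v D hu hv huA hvA hD0 hspan x y => by
      have hug : GrowthBound ω A' u := ⟨hu.measurable, huA⟩
      have hvg : GrowthBound ω A' v := ⟨hv.measurable, hvA⟩
      have hφu := hcont u _ hA'0 hu hug
      have hφv := hcont v _ hA'0 hv hvg
      obtain ⟨z, hz, h1⟩ := exists_impulseMax_sub_le hU hUn hc.1 hφu hφv x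
      obtain ⟨z', hz', h2⟩ := exists_impulseMax_sub_le hU hUn hc.1 hφv hφu y
      have h3 := hD.entropicStep_sub_le hug hvg z
      have h4 := hD.le_entropicStep_sub hug hvg z'
      have h5 := hcontr u v D hug hvg hD0 hspan x y z z' hz hz'
      simp only [hS]
      linarith)
  have hwG : GrowthBound ω A' w := ⟨hwc.measurable, hwA⟩
  have hspec := impulseMax_spec hU hUn hc.1 (hcont w _ hA'0 hwc hwG)
  refine ⟨w, l, (isBellmanSolution_iff hD hwG hwc).2 ⟨fun x => ?_, fun x ξ hξ => ?_, fun x => ?_⟩⟩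
  · exact (hspec x).1.trans (hwl x).le
  · exact ((hspec x).2.1 ξ hξ).trans (hwl x).le
  · rw [← hwl x]
    rcases (hspec x).2.2 with h | ⟨ξ, hξ, h⟩
    · exact Or.inl h.le
    · exact Or.inr fun ε hε => ⟨ξ, hξ, by simp only [hS]; linarith⟩

end Existence

end

end ImpulseControl

open ImpulseControl

theorem mainTheorem2 (m : ℕ) (X : FellerMarkovProcess (EuclideanSpace ℝ (Fin m)))
    (δ : ℝ≥0) (hδ : 0 < δ) (U : Set (EuclideanSpace ℝ (Fin m))) (hU : IsCompact U)
    (ω : EuclideanSpace ℝ (Fin m) → ℝ) (hω : Continuous ω) (hω_nonneg : ∀ x, 0 ≤ ω x)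
    (f : EuclideanSpace ℝ (Fin m) → ℝ)
    (c : EuclideanSpace ℝ (Fin m) → EuclideanSpace ℝ (Fin m) → ℝ)
    (γ : ℝ) (hγ : γ < 0)
    (hA1 : RewardConstraints ω f) (hA2 : CostConstraints U ω c)
    (hA3 : GeometricDrift X δ ω) (hA4 : LocalMinorization X δ U ω) :
    (∀ (w : EuclideanSpace ℝ (Fin m) → ℝ) (l : ℝ), IsBellmanSolution X δ U ω f c γ w l →
      ∀ x : EuclideanSpace ℝ (Fin m),
        (⨆ V : DyadicStrategy δ U, longRunValue X f c γ x V) = ((l / δ : ℝ) : EReal)) ∧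
    (X.IsC0Feller →
      ∃ (w : EuclideanSpace ℝ (Fin m) → ℝ) (l : ℝ), IsBellmanSolution X δ U ω f c γ w l) := by
  obtain ⟨b, M, hL⟩ := hA3.expLyapunov hω hω_nonneg
  obtain ⟨K, hD⟩ := hA1.rewardData hL hγ
  exact ⟨fun w l hw x => iSup_longRunValue_eq hδ hU hA4.nonempty hD hA2 hw x,
    fun hX => exists_isBellmanSolution hD hU hA2 hA4 fun g A hA hgc hg =>
      hD.continuous_entropicStep hX hδ hgc hg hA⟩
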